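/- Let $A_0(x_1,x_2)=\frac12(-x_2,x_1)$ on the half-plane $\mathbb R\times\mathbb R_+$ and let $H^1_{A_0}$ be the space of all $u\in L^2(\mathbb R\times\mathbb R_+)$ with $(\nabla-iA_0)u\in L^2(\mathbb R\times\mathbb R_+)$. For $\gamma\in\mathbb R$ let $$\Theta(\gamma)=\inf_{0\neq u\in H^1_{A_0}}\frac{\|(\nabla-iA_0)u\|_{L^2}^2+\gamma\int_{\mathbb R}|u(x_1,0)|^2\,dx_1}{\|u\|_{L^2}^2}.$$ For $\gamma,\xi\in\mathbb R$ let $\mu^{(1)}(\gamma,\xi)$ be the first eigenvalue of the operator $H[\gamma,\xi]=-\frac{d^2}{dt^2}+(t-\xi)^2$ on $L^2(\mathbb R_+)$ with domain $\{u\in H^2(\mathbb R_+):\ t^2u\in L^2(\mathbb R_+),\ u'(0)=\gamma u(0)\}$. Then, for every $\gamma\in\mathbb R$, the function $\xi\mapsto\mu^{(1)}(\gamma,\xi)$ attains its minimum over $\mathbb R$ at a unique point $\xi(\gamma)$, and $\xi(\gamma)>0$; the number $\Theta(\gamma)$ is an eigenvalue of $H[\gamma,\xi(\gamma)]$ with a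 unique strictly positive $L^2(\mathbb R_+)$-normalized eigenfunction $\varphi_\gamma$. With these $\xi(\gamma)$ and $\varphi_\gamma$, the function $\gamma\mapsto\Theta(\gamma)$ is of class $C^1$ on $\mathbb R$ and $$\Theta'(\gamma)=|\varphi_\gamma(0)|^2\qquad(\gamma\in\mathbb R).$$ In particular, with $M_3(\gamma)=\frac16\bigl(1+(\gamma\,\xi(\gamma))^2\bigr)|\varphi_\gamma(0)|^2$ and $M_3=M_3(0)$, $$\Theta'(0)=6M_3>0.$$ -/

import Mathlib

open MeasureTheory Set
open scoped ContDiff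

noncomputable section

namespace RobinHalfPlane

/-! ### The half-plane model and the function `Θ` -/

/-- The half-plane `ℝ × ℝ₊`. -/
def halfPlane : Set (ℝ × ℝ) := {x | 0 < x.2}

/-- The magnetic potential `A₀(x₁, x₂) = (-x₂, x₁) / 2`, of unit curl. -/
def A₀ (x : ℝ × ℝ) : ℝ × ℝ := (-x.2 / 2, x.1 / 2)

/-- `(d₁, d₂)` is the weak magnetic gradient `(∇ - i A₀) u` on the half-plane: the distributional
partial derivatives of `u` are `∂ⱼ u = dⱼ + i (A₀)ⱼ u`, `j = 1, 2`. -/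
def IsMagneticGradient (u d₁ d₂ : ℝ × ℝ → ℂ) : Prop :=
  ∀ f : ℝ × ℝ → ℂ, ContDiff ℝ ∞ f → HasCompactSupport f → tsupport f ⊆ halfPlane →
    (∫ x in halfPlane, u x * fderiv ℝ f x (1, 0)
      = -∫ x in halfPlane, (d₁ x + Complex.I * (A₀ x).1 * u x) * f x) ∧
    (∫ x in halfPlane, u x * fderiv ℝ f x (0, 1)
      = -∫ x in halfPlane, (d₂ x + Complex.I * (A₀ x).2 * u x) * f x)

/-- `u` lies in the form domain `H¹_{A₀}(ℝ × ℝ₊)`, i.e. `u ∈ L²` and `(∇ - i A₀) u ∈ L²`, and its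
magnetic gradient is `(d₁, d₂)`. -/
def MemMagneticH1 (u d₁ d₂ : ℝ × ℝ → ℂ) : Prop :=
  MemLp u 2 (volume.restrict halfPlane) ∧
  MemLp d₁ 2 (volume.restrict halfPlane) ∧
  MemLp d₂ 2 (volume.restrict halfPlane) ∧
  IsMagneticGradient u d₁ d₂

/-- `g ∈ L²(ℝ)` is the boundary trace `x₁ ↦ u(x₁, 0)` of a function `u ∈ H¹_{A₀}(ℝ × ℝ₊)` whose
second magnetic derivative is `d₂`. The trace is the function that makes Green's formula
`∫ u ∂₂f = -∫ (∂₂u) f - ∫ u(x₁, 0) f(x₁, 0) dx₁` hold for all test functions `f` that need not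
vanish near the boundary; every `u ∈ H¹_{A₀}` has exactly one such trace (up to null sets). -/
def IsTrace (u d₂ : ℝ × ℝ → ℂ) (g : ℝ → ℂ) : Prop :=
  MemLp g 2 (volume : Measure ℝ) ∧
  ∀ f : ℝ × ℝ → ℂ, ContDiff ℝ ∞ f → HasCompactSupport f →
    ∫ x in halfPlane, u x * fderiv ℝ f x (0, 1)
      = -(∫ x in halfPlane, (d₂ x + Complex.I * (A₀ x).2 * u x) * f x)
        - ∫ s : ℝ, g s * f (s, 0)

/-- The bottom of the Rayleigh quotients
`(‖(∇ - i A₀) u‖² + γ ∫ |u(x₁, 0)|² dx₁) / ‖u‖²`, `0 ≠ u ∈ H¹_{A₀}(ℝ × ℝ₊)`. -/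
def Theta (γ : ℝ) : ℝ :=
  sInf {r : ℝ | ∃ (u d₁ d₂ : ℝ × ℝ → ℂ) (g : ℝ → ℂ),
    MemMagneticH1 u d₁ d₂ ∧ IsTrace u d₂ g ∧
    ¬ (u =ᵐ[volume.restrict halfPlane] 0) ∧
    r = ((∫ x in halfPlane, (‖d₁ x‖ ^ 2 + ‖d₂ x‖ ^ 2)) + γ * ∫ s : ℝ, ‖g s‖ ^ 2)
        / ∫ x in halfPlane, ‖u x‖ ^ 2}

/-! ### The operators `H[γ, ξ] = -d²/dt² + (t - ξ)²` on the half-line -/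

/-- `v` is the weak derivative of `u` on `ℝ₊`. -/
def HasWeakDeriv (u v : ℝ → ℂ) : Prop :=
  ∀ f : ℝ → ℂ, ContDiff ℝ ∞ f → HasCompactSupport f → tsupport f ⊆ Ioi 0 →
    ∫ t in Ioi (0 : ℝ), u t * deriv f t = -∫ t in Ioi (0 : ℝ), v t * f t

/-- `u ∈ B²(ℝ₊) = {u ∈ H²(ℝ₊) : t² u ∈ L²(ℝ₊)}`, with weak derivatives `u' = u₁`, `u'' = u₂`.
As usual, `u` and `u₁` stand for their continuous representatives on `[0, ∞)`, so that the boundary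
values `u(0)` and `u'(0)` are `u 0` and `u₁ 0`. -/
def MemB2 (u u₁ u₂ : ℝ → ℂ) : Prop :=
  ContinuousOn u (Ici 0) ∧ ContinuousOn u₁ (Ici 0) ∧
  MemLp u 2 (volume.restrict (Ioi 0)) ∧
  MemLp u₁ 2 (volume.restrict (Ioi 0)) ∧
  MemLp u₂ 2 (volume.restrict (Ioi 0)) ∧
  MemLp (fun t : ℝ => (t : ℂ) ^ 2 * u t) 2 (volume.restrict (Ioi 0)) ∧
  HasWeakDeriv u u₁ ∧ HasWeakDeriv u₁ u₂

/-- `u` is an eigenfunction, with eigenvalue `lam`, of the operator `H[γ, ξ] = -d²/dt² + (t - ξ)²`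
with domain `{u ∈ B²(ℝ₊) : u'(0) = γ u(0)}`. -/
def IsEigenfunction (γ ξ lam : ℝ) (u : ℝ → ℂ) : Prop :=
  ∃ u₁ u₂ : ℝ → ℂ, MemB2 u u₁ u₂ ∧ u₁ 0 = γ * u 0 ∧
    ¬ (u =ᵐ[volume.restrict (Ioi 0)] 0) ∧
    ∀ᵐ t ∂(volume.restrict (Ioi (0 : ℝ))), -u₂ t + ((t : ℂ) - ξ) ^ 2 * u t = lam * u t

/-- The first eigenvalue `μ⁽¹⁾(γ, ξ)` of `H[γ, ξ]`. -/
def mu1 (γ ξ : ℝ) : ℝ := sInf {lam : ℝ | ∃ u : ℝ → ℂ, IsEigenfunction γ ξ lam u}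

/-- `ξ` is a point where the function `μ⁽¹⁾(γ, ·)` attains its minimum over `ℝ`. -/
def IsMinimizer (γ ξ : ℝ) : Prop := ∀ η : ℝ, mu1 γ ξ ≤ mu1 γ η

/-- `φ` is a strictly positive, `L²(ℝ₊)`-normalized eigenfunction of `H[γ, ξ]` with eigenvalue
`lam`. -/
def IsPositiveNormalizedEigenfunction (γ ξ lam : ℝ) (φ : ℝ → ℝ) : Prop :=
  IsEigenfunction γ ξ lam (fun t => (φ t : ℂ)) ∧
  (∀ t : ℝ, 0 < t → 0 < φ t) ∧
  ∫ t in Ioi (0 : ℝ), |φ t| ^ 2 = 1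

/-- The quantity `M₃(γ) = (1 + (γ ξ(γ))²) |φ_γ(0)|² / 6`, for given `ξ(γ) = ξ` and `φ_γ = φ`. -/
def M3 (γ ξ : ℝ) (φ : ℝ → ℝ) : ℝ := 1 / 6 * (1 + (γ * ξ) ^ 2) * |φ 0| ^ 2

end RobinHalfPlane

end

/-! Everything rests on one explicit function. After the shift `s = t - ξ` the eigenvalue equation
on the half-line reads `u'' = (s² - lam) u` for `s > -ξ`. For `lam < 1` it has a positive solution
decaying at `+∞`, `decaySol lam`, given by an integral of Hermite type. Let `F = robinF lam` be its
logarithmic derivative; if `F(-ξ) = γ`, then `lam` is an eigenvalue of `H[γ, ξ]`. `F` solves the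
Riccati equation `F' = s² - lam - F²`, and `robinK`, which equals `F'` times the squared solution,
has derivative `2s` times that square. Hence `F` has exactly one maximum point, and it is negative.
Let `E = groundEnergy γ` be an energy at which `max F = γ`, and let `ξ(γ) = optimalXi γ` be minus
the maximum point.

Completing the square with the Riccati equation gives, for all `ξ`, the ground state representation
`∫ |v' - F(t-ξ) v|² = ∫ |v'|² + ∫ (t-ξ)² |v|² - lam ∫ |v|² + F(-ξ) |v(0)|²`
(`integral_norm_sq_sub_robinF_mul`). At `lam = E` one has `F ≤ γ` everywhere, so the Robin form is
at least `E ‖v‖²` for every `ξ` at once. This bounds all eigenvalues below by `E`. Equality at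
`ξ(γ)` forces `v' = F v`, so the ground state is unique up to a factor; for `η ≠ ξ(γ)` there is room
to raise `lam` slightly, so `ξ(γ)` is the only minimizer. Eigenvalues must also be shown to exist
for every `ξ`; this is done by shooting (`exists_isEigenfunction`).

The same representation gives `Theta γ = E`. A gauge factor and the Fourier transform in `x₁` split
the half-plane form into half-line forms with `ξ = -2πk`; integrating the bound over `k` and
removing a cutoff in `x₁` gives `Theta γ ≥ E`. Slowly varying cutoffs times the ground state give
the reverse inequality (`Theta_eq_groundEnergy`).

Finally, inserting the ground state for `γ` into the form for `γ'` yields `E(γ') ≤ E(γ) + (γ' - γ)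
φ_γ(0)²` (`groundEnergy_le`). So `φ_γ(0)²` is a supergradient of `E`. It is continuous, because `E`
and `ξ(γ) = √(E + γ²)` are, hence it is the derivative. -/

namespace RobinHalfPlane

open Filter Topology

/-! ### Decaying solutions of `u'' = (s² - lam) u` -/

/-- The integral `∫₀^∞ y^p e^{-y² - 2sy} dy`. -/
noncomputable def hermiteInt (p s : ℝ) : ℝ := ∫ y in Ioi (0 : ℝ), y ^ p * Real.exp (-y ^ 2 - 2 * s * y)

/-- Completing the square gives `-y² - 2sy ≤ 2s² - y²/2`, and `y^a`, `y^b` control `y^p` for `y ≤ 1`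
and `y ≥ 1` respectively. The bound is uniform in `p` and `s`, as dominated convergence in both
variables requires. -/
theorem hermiteInt_integrand_le {a b M p s y : ℝ} (hy : 0 < y) (hap : a ≤ p) (hpb : p ≤ b)
    (hs : |s| ≤ M) :
    y ^ p * Real.exp (-y ^ 2 - 2 * s * y)
      ≤ Real.exp (2 * M ^ 2) * (y ^ a * Real.exp (-(1 / 2) * y ^ 2))
        + Real.exp (2 * M ^ 2) * (y ^ b * Real.exp (-(1 / 2) * y ^ 2)) := by
  have h1 : y ^ p ≤ y ^ a + y ^ b := by
    rcases le_total y 1 with h | h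
    · have := Real.rpow_le_rpow_of_exponent_ge hy h hap
      have := Real.rpow_nonneg hy.le b
      linarith
    · have := Real.rpow_le_rpow_of_exponent_le h hpb
      have := Real.rpow_nonneg hy.le a
      linarith
  have h2 : Real.exp (-y ^ 2 - 2 * s * y) ≤ Real.exp (2 * M ^ 2) * Real.exp (-(1 / 2) * y ^ 2) := by
    rw [← Real.exp_add]
    apply Real.exp_le_exp.mpr
    have : s ^ 2 ≤ M ^ 2 := sq_le_sq.mpr (hs.trans (le_abs_self M))
    nlinarith [sq_nonneg (y + 2 * s)]
  calc _ ≤ (y ^ a + y ^ b) * (Real.exp (2 * M ^ 2) * Real.exp (-(1 / 2) * y ^ 2)) := by gcongr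
    _ = _ := by ring

theorem integrableOn_hermiteInt_bound {a b : ℝ} (ha : -1 < a) (hb : -1 < b) (C : ℝ) :
    IntegrableOn (fun y : ℝ => C * (y ^ a * Real.exp (-(1 / 2) * y ^ 2))
        + C * (y ^ b * Real.exp (-(1 / 2) * y ^ 2))) (Ioi 0) :=
  ((integrableOn_rpow_mul_exp_neg_mul_sq (by norm_num) ha).const_mul C).add
    ((integrableOn_rpow_mul_exp_neg_mul_sq (by norm_num) hb).const_mul C)

theorem measurable_hermiteInt_integrand (p s : ℝ) :
    Measurable (fun y : ℝ => y ^ p * Real.exp (-y ^ 2 - 2 * s * y)) := by fun_prop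

theorem integrableOn_hermiteInt {p : ℝ} (hp : -1 < p) (s : ℝ) :
    IntegrableOn (fun y : ℝ => y ^ p * Real.exp (-y ^ 2 - 2 * s * y)) (Ioi 0) := by
  refine (integrableOn_hermiteInt_bound hp hp (Real.exp (2 * |s| ^ 2))).mono'
    (measurable_hermiteInt_integrand p s).aestronglyMeasurable ?_
  filter_upwards [ae_restrict_mem measurableSet_Ioi] with y hy
  rw [Real.norm_of_nonneg (mul_nonneg (Real.rpow_nonneg (le_of_lt hy) _) (Real.exp_pos _).le)]
  exact hermiteInt_integrand_le hy le_rfl le_rfl le_rfl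

theorem hermiteInt_pos {p : ℝ} (hp : -1 < p) (s : ℝ) : 0 < hermiteInt p s := by
  rw [hermiteInt, setIntegral_pos_iff_support_of_nonneg_ae ?_ (integrableOn_hermiteInt hp s)]
  · have : Ioi (0 : ℝ) ⊆ Function.support (fun y : ℝ => y ^ p * Real.exp (-y ^ 2 - 2 * s * y)) :=
      fun y hy => (mul_pos (Real.rpow_pos_of_pos hy _) (Real.exp_pos _)).ne'
    rw [inter_eq_right.mpr this]
    simp
  · filter_upwards [ae_restrict_mem measurableSet_Ioi] with y hy
    exact mul_nonneg (Real.rpow_nonneg (le_of_lt hy) _) (Real.exp_pos _).le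

theorem hasDerivAt_hermiteInt {p : ℝ} (hp : -1 < p) (s : ℝ) :
    HasDerivAt (hermiteInt p) (-2 * hermiteInt (p + 1) s) s := by
  have key := hasDerivAt_integral_of_dominated_loc_of_deriv_le (μ := volume.restrict (Ioi (0 : ℝ)))
    (F := fun s y => y ^ p * Real.exp (-y ^ 2 - 2 * s * y))
    (F' := fun s y => -2 * (y ^ (p + 1) * Real.exp (-y ^ 2 - 2 * s * y)))
    (x₀ := s) (s := Metric.ball s 1)
    (bound := fun y => 2 * (Real.exp (2 * (|s| + 1) ^ 2) * (y ^ (p + 1) * Real.exp (-(1 / 2) * y ^ 2))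
        + Real.exp (2 * (|s| + 1) ^ 2) * (y ^ (p + 1) * Real.exp (-(1 / 2) * y ^ 2))))
    (Metric.ball_mem_nhds s one_pos)
    (Eventually.of_forall fun x => (measurable_hermiteInt_integrand p x).aestronglyMeasurable)
    (integrableOn_hermiteInt hp s)
    ((measurable_hermiteInt_integrand (p + 1) s).const_mul (-2)).aestronglyMeasurable
    ?_ ((integrableOn_hermiteInt_bound (by linarith) (by linarith) _).const_mul 2) ?_
  · have := key.2
    rw [integral_const_mul] at this
    exact this
  · filter_upwards [ae_restrict_mem measurableSet_Ioi] with y hy x hx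
    rw [norm_mul, Real.norm_of_nonneg
      (mul_nonneg (Real.rpow_nonneg (le_of_lt hy) _) (Real.exp_pos _).le)]
    have hx' : |x| ≤ |s| + 1 := by
      rw [Metric.mem_ball, Real.dist_eq] at hx
      have := abs_sub_abs_le_abs_sub x s
      linarith
    have := hermiteInt_integrand_le (y := y) hy (le_refl (p + 1)) (le_refl (p + 1)) hx'
    norm_num
    norm_num at this
    linarith
  · filter_upwards [ae_restrict_mem measurableSet_Ioi] with y hy x hx
    have h1 : HasDerivAt (fun x : ℝ => -y ^ 2 - 2 * x * y) (-(2 * y)) x := by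
      have := ((hasDerivAt_id x).const_mul (2 : ℝ)).mul_const y
      simpa using this.const_sub (-y ^ 2)
    convert! (h1.exp.const_mul (y ^ p)) using 1
    rw [Real.rpow_add_one (ne_of_gt hy)]
    ring

theorem hermiteInt_strictAnti {p : ℝ} (hp : -1 < p) : StrictAnti (hermiteInt p) := by
  apply strictAnti_of_deriv_neg
  intro s
  rw [(hasDerivAt_hermiteInt hp s).deriv]
  have := hermiteInt_pos (p := p + 1) (by linarith) s
  linarith

/-- Integrate the derivative of `y^(p+1) e^{-y² - 2sy}`; the boundary terms vanish because `p + 1 >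
0`. This identity is what makes `decaySol` solve its differential equation. -/
theorem hermiteInt_recurrence {p : ℝ} (hp : -1 < p) (s : ℝ) :
    2 * hermiteInt (p + 2) s + 2 * s * hermiteInt (p + 1) s = (p + 1) * hermiteInt p s := by
  have hd : ∀ y ∈ Ioi (0 : ℝ), HasDerivAt (fun y : ℝ => y ^ (p + 1) * Real.exp (-y ^ 2 - 2 * s * y))
      ((p + 1) * (y ^ p * Real.exp (-y ^ 2 - 2 * s * y))
        - 2 * s * (y ^ (p + 1) * Real.exp (-y ^ 2 - 2 * s * y))
        - 2 * (y ^ (p + 2) * Real.exp (-y ^ 2 - 2 * s * y))) y := by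
    intro y hy
    have h1 : HasDerivAt (fun y : ℝ => -y ^ 2 - 2 * s * y) (-(2 * y) - 2 * s) y := by
      convert! ((hasDerivAt_pow 2 y).neg).sub ((hasDerivAt_id y).const_mul (2 * s)) using 1
      simp
    have h2 := Real.hasDerivAt_rpow_const (x := y) (p := p + 1) (Or.inl (ne_of_gt hy))
    convert! h2.mul h1.exp using 1
    rw [show p + 2 = p + 1 + 1 by ring, Real.rpow_add_one (ne_of_gt hy) (p + 1)]
    simp
    ring
  have i0 := integrableOn_hermiteInt hp s
  have i1 := integrableOn_hermiteInt (p := p + 1) (by linarith) s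
  have i2 := integrableOn_hermiteInt (p := p + 2) (by linarith) s
  have hint01 : IntegrableOn (fun y : ℝ => (p + 1) * (y ^ p * Real.exp (-y ^ 2 - 2 * s * y))
      - 2 * s * (y ^ (p + 1) * Real.exp (-y ^ 2 - 2 * s * y))) (Ioi 0) :=
    (i0.const_mul (p + 1)).sub (i1.const_mul (2 * s))
  have hint := hint01.sub (i2.const_mul 2)
  have hc : ContinuousWithinAt (fun y : ℝ => y ^ (p + 1) * Real.exp (-y ^ 2 - 2 * s * y)) (Ici 0) 0 := by
    apply ContinuousAt.continuousWithinAt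
    apply ContinuousAt.mul
    · exact Real.continuousAt_rpow_const _ _ (Or.inr (by linarith))
    · fun_prop
  have ht := tendsto_zero_of_hasDerivAt_of_integrableOn_Ioi hd hint i1
  have := integral_Ioi_of_hasDerivAt_of_tendsto hc hd hint ht
  rw [integral_sub hint01 (i2.const_mul 2),
    integral_sub (i0.const_mul (p + 1)) (i1.const_mul (2 * s)), integral_const_mul,
    integral_const_mul, integral_const_mul] at this
  simp only [Real.zero_rpow (show p + 1 ≠ 0 by linarith)] at this
  simp only [hermiteInt]
  linarith

theorem continuousOn_hermiteInt :
    ContinuousOn (fun z : ℝ × ℝ => hermiteInt z.1 z.2) (Ioi (-1) ×ˢ univ) := by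
  rintro ⟨p, s⟩ ⟨hp, -⟩
  apply ContinuousAt.continuousWithinAt
  simp only [mem_Ioi] at hp
  -- The midpoint of `-1` and `p`: smaller than `p`, yet still an integrable power at `0`.
  set a := (p - 1) / 2 with ha
  set b := p + 1 with hb
  have hU : ∀ᶠ z : ℝ × ℝ in 𝓝 (p, s), a ≤ z.1 ∧ z.1 ≤ b ∧ |z.2| ≤ |s| + 1 := by
    have h1 : ∀ᶠ z : ℝ × ℝ in 𝓝 (p, s), a < z.1 :=
      continuousAt_fst.eventually (lt_mem_nhds (by simp only; rw [ha]; linarith))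
    have h2 : ∀ᶠ z : ℝ × ℝ in 𝓝 (p, s), z.1 < b :=
      continuousAt_fst.eventually (gt_mem_nhds (by simp only; rw [hb]; linarith))
    have h3 : ∀ᶠ z : ℝ × ℝ in 𝓝 (p, s), |z.2| < |s| + 1 :=
      (continuousAt_snd.abs).eventually (gt_mem_nhds (by simp))
    filter_upwards [h1, h2, h3] with z h1 h2 h3 using ⟨h1.le, h2.le, h3.le⟩
  refine continuousAt_of_dominated
    (bound := fun y => Real.exp (2 * (|s| + 1) ^ 2) * (y ^ a * Real.exp (-(1 / 2) * y ^ 2))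
        + Real.exp (2 * (|s| + 1) ^ 2) * (y ^ b * Real.exp (-(1 / 2) * y ^ 2)))
    (Eventually.of_forall fun x => (measurable_hermiteInt_integrand _ _).aestronglyMeasurable)
    ?_ (integrableOn_hermiteInt_bound (by linarith) (by linarith) _) ?_
  · filter_upwards [hU] with z hz
    filter_upwards [ae_restrict_mem measurableSet_Ioi] with y hy
    rw [Real.norm_of_nonneg (mul_nonneg (Real.rpow_nonneg (le_of_lt hy) _) (Real.exp_pos _).le)]
    exact hermiteInt_integrand_le hy hz.1 hz.2.1 hz.2.2
  · filter_upwards [ae_restrict_mem measurableSet_Ioi] with y hy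
    apply ContinuousAt.mul
    · exact (Real.continuousAt_const_rpow (ne_of_gt hy)).comp continuousAt_fst
    · fun_prop

/-- The solution of `u'' = (s² - lam) u` decaying at `+∞`, for `lam < 1`. -/
noncomputable def decaySol (lam s : ℝ) : ℝ := Real.exp (-s ^ 2 / 2) * hermiteInt (-(lam + 1) / 2) s

/-- The derivative of `decaySol lam`. -/
noncomputable def decaySolDeriv (lam s : ℝ) : ℝ :=
  Real.exp (-s ^ 2 / 2) *
    (-s * hermiteInt (-(lam + 1) / 2) s - 2 * hermiteInt (-(lam + 1) / 2 + 1) s)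

theorem hasDerivAt_gaussian (s : ℝ) :
    HasDerivAt (fun s : ℝ => Real.exp (-s ^ 2 / 2)) (Real.exp (-s ^ 2 / 2) * (-s)) s := by
  have h : HasDerivAt (fun s : ℝ => -s ^ 2 / 2) (-s) s := by
    convert! ((hasDerivAt_pow 2 s).neg).div_const 2 using 1
    simp
    ring
  exact h.exp

theorem hasDerivAt_decaySol {lam : ℝ} (h : lam < 1) (s : ℝ) :
    HasDerivAt (decaySol lam) (decaySolDeriv lam s) s := by
  convert! (hasDerivAt_gaussian s).mul (hasDerivAt_hermiteInt (p := -(lam + 1) / 2) (by linarith) s)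
    using 1
  simp only [decaySolDeriv]
  ring

/-- With `p = -(lam + 1)/2`, differentiation produces the integrals of exponents `p`, `p + 1`, `p +
2`. The recurrence removes the last two and leaves the factor `s² + 2p + 1 = s² - lam`. -/
theorem hasDerivAt_decaySolDeriv {lam : ℝ} (h : lam < 1) (s : ℝ) :
    HasDerivAt (decaySolDeriv lam) ((s ^ 2 - lam) * decaySol lam s) s := by
  have hp : -1 < -(lam + 1) / 2 := by linarith
  have h0 := hasDerivAt_hermiteInt hp s
  have h1 := hasDerivAt_hermiteInt (p := -(lam + 1) / 2 + 1) (by linarith) s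
  have hr := hermiteInt_recurrence hp s
  convert! (hasDerivAt_gaussian s).mul
    (((hasDerivAt_id s).neg.mul h0).sub (h1.const_mul 2)) using 1
  simp only [decaySol, Pi.neg_apply, id, Pi.mul_apply, Pi.sub_apply]
  rw [show -(lam + 1) / 2 + 1 + 1 = -(lam + 1) / 2 + 2 by ring]
  linear_combination (-2 * Real.exp (-s ^ 2 / 2)) * hr

theorem decaySol_pos {lam : ℝ} (h : lam < 1) (s : ℝ) : 0 < decaySol lam s :=
  mul_pos (Real.exp_pos _) (hermiteInt_pos (by linarith) s)

theorem decaySol_lt_neg {lam s : ℝ} (h : lam < 1) (hs : 0 < s) :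
    decaySol lam s < decaySol lam (-s) := by
  simp only [decaySol, neg_sq]
  exact mul_lt_mul_of_pos_left (hermiteInt_strictAnti (by linarith) (by linarith)) (Real.exp_pos _)

theorem tendsto_pow_mul_gaussian (k : ℕ) :
    Tendsto (fun s : ℝ => s ^ k * Real.exp (-s ^ 2 / 2)) atTop (𝓝 0) := by
  have h := Real.tendsto_pow_mul_exp_neg_atTop_nhds_zero k
  refine squeeze_zero' ?_ ?_ h
  · filter_upwards [eventually_ge_atTop 0] with s hs
    positivity
  · filter_upwards [eventually_ge_atTop 2] with s hs
    gcongr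
    nlinarith

theorem tendsto_pow_mul_decaySol {lam : ℝ} (h : lam < 1) (k : ℕ) :
    Tendsto (fun s : ℝ => s ^ k * decaySol lam s) atTop (𝓝 0) := by
  have h1 := (tendsto_pow_mul_gaussian k).mul_const (hermiteInt (-(lam + 1) / 2) 0)
  rw [zero_mul] at h1
  refine squeeze_zero' ?_ ?_ h1
  · filter_upwards [eventually_ge_atTop 0] with s hs
    have := decaySol_pos h s
    positivity
  · filter_upwards [eventually_ge_atTop 0] with s hs
    rw [decaySol, mul_assoc]
    have := (hermiteInt_strictAnti (p := -(lam + 1) / 2) (by linarith)).antitone hs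
    gcongr

theorem tendsto_pow_mul_decaySolDeriv {lam : ℝ} (h : lam < 1) (k : ℕ) :
    Tendsto (fun s : ℝ => s ^ k * decaySolDeriv lam s) atTop (𝓝 0) := by
  have h1 := (tendsto_pow_mul_decaySol h (k + 1)).neg
  -- Lowering the energy by two raises the exponent `-(lam + 1)/2` by one, so the second term of
  -- `decaySolDeriv lam` is `-2 * decaySol (lam - 2)`.
  have h2 := (tendsto_pow_mul_decaySol (lam := lam - 2) (by linarith) k).const_mul (-2)
  have := h1.add h2
  simp only [neg_zero, mul_zero, add_zero] at this
  refine this.congr fun s => ?_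
  simp only [decaySolDeriv, decaySol]
  rw [show -(lam - 2 + 1) / 2 = -(lam + 1) / 2 + 1 by ring]
  ring

theorem continuousOn_decaySol :
    ContinuousOn (fun z : ℝ × ℝ => decaySol z.1 z.2) (Iio 1 ×ˢ univ) := by
  apply ContinuousOn.mul (by fun_prop)
  refine continuousOn_hermiteInt.comp (f := fun z : ℝ × ℝ => (-(z.1 + 1) / 2, z.2)) (by fun_prop) ?_
  rintro ⟨l, s⟩ ⟨hl, -⟩
  simp only [mem_Iio] at hl
  refine ⟨?_, mem_univ _⟩
  simp only [mem_Ioi]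
  linarith

theorem continuousOn_decaySolDeriv :
    ContinuousOn (fun z : ℝ × ℝ => decaySolDeriv z.1 z.2) (Iio 1 ×ˢ univ) := by
  have h1 : ContinuousOn (fun z : ℝ × ℝ => -z.2 * decaySol z.1 z.2 - 2 * decaySol (z.1 - 2) z.2)
      (Iio 1 ×ˢ univ) := by
    apply ContinuousOn.sub
    · exact ContinuousOn.mul (by fun_prop) continuousOn_decaySol
    · apply ContinuousOn.mul (by fun_prop)
      refine continuousOn_decaySol.comp (f := fun z : ℝ × ℝ => (z.1 - 2, z.2)) (by fun_prop) ?_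
      rintro ⟨l, s⟩ ⟨hl, -⟩
      simp only [mem_Iio] at hl
      refine ⟨?_, mem_univ _⟩
      simp only [mem_Iio]
      linarith
  refine h1.congr fun z _ => ?_
  simp only [decaySolDeriv, decaySol]
  rw [show -(z.1 - 2 + 1) / 2 = -(z.1 + 1) / 2 + 1 by ring]
  ring

/-- The logarithmic derivative of the decaying solution. -/
noncomputable def robinF (lam s : ℝ) : ℝ := decaySolDeriv lam s / decaySol lam s

theorem robinF_mul {lam : ℝ} (h : lam < 1) (s : ℝ) :
    robinF lam s * decaySol lam s = decaySolDeriv lam s :=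
  div_mul_cancel₀ _ (decaySol_pos h s).ne'

theorem hasDerivAt_robinF {lam : ℝ} (h : lam < 1) (s : ℝ) :
    HasDerivAt (robinF lam) (s ^ 2 - lam - robinF lam s ^ 2) s := by
  have h0 := (decaySol_pos h s).ne'
  convert! (hasDerivAt_decaySolDeriv h s).div (hasDerivAt_decaySol h s) h0 using 1
  simp only [robinF]
  field_simp

theorem continuous_robinF {lam : ℝ} (h : lam < 1) : Continuous (robinF lam) :=
  continuous_iff_continuousAt.mpr fun s => (hasDerivAt_robinF h s).continuousAt

theorem continuousOn_uncurry_robinF :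
    ContinuousOn (fun z : ℝ × ℝ => robinF z.1 z.2) (Iio 1 ×ˢ univ) :=
  continuousOn_decaySolDeriv.div continuousOn_decaySol fun _ hz => (decaySol_pos hz.1 _).ne'

theorem robinF_eq {lam : ℝ} (h : lam < 1) (s : ℝ) :
    robinF lam s = -s - 2 * (hermiteInt (-(lam + 1) / 2 + 1) s / hermiteInt (-(lam + 1) / 2) s) := by
  have h0 := (hermiteInt_pos (p := -(lam + 1) / 2) (by linarith) s).ne'
  have he := (Real.exp_pos (-s ^ 2 / 2)).ne'
  rw [robinF, decaySolDeriv, decaySol, mul_div_mul_left _ _ he, sub_div, mul_div_cancel_right₀ _ h0,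
    mul_div_assoc]

/-- Apart from `-s`, the function `robinF` is a ratio of two integrals. For `s ≥ 1` the recurrence
bounds the ratio; for `s₀ ≤ s ≤ 1` monotonicity of both integrals does. Linear growth is what puts
`F v` in `L²` when `v` and `(t - ξ) v` are. -/
theorem exists_abs_robinF_le {lam : ℝ} (h : lam < 1) (s₀ : ℝ) :
    ∃ C, 0 ≤ C ∧ ∀ s, s₀ ≤ s → |robinF lam s| ≤ |s| + C := by
  set p := -(lam + 1) / 2 with hpdef
  have hp : -1 < p := by rw [hpdef]; linarith
  have hp1 : -1 < p + 1 := by linarith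
  set C := (p + 1) + 2 * (hermiteInt (p + 1) s₀ / hermiteInt p 1) with hC
  have hC0 : 0 ≤ 2 * (hermiteInt (p + 1) s₀ / hermiteInt p 1) := by
    have := hermiteInt_pos hp1 s₀
    have := hermiteInt_pos hp 1
    positivity
  refine ⟨C, by rw [hC]; linarith, fun s hs => ?_⟩
  have hpos := hermiteInt_pos hp s
  have hpos1 := hermiteInt_pos hp1 s
  have hm : 0 ≤ 2 * (hermiteInt (p + 1) s / hermiteInt p s) := by positivity
  have hmC : 2 * (hermiteInt (p + 1) s / hermiteInt p s) ≤ C := by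
    rcases le_total 1 s with h1 | h1
    · have hr := hermiteInt_recurrence hp s
      have h2 := hermiteInt_pos (p := p + 2) (by linarith) s
      have : 2 * (hermiteInt (p + 1) s / hermiteInt p s) ≤ p + 1 := by
        rw [← mul_div_assoc, div_le_iff₀ hpos]
        nlinarith
      linarith
    · have hle1 := (hermiteInt_strictAnti hp1).antitone hs
      have hle2 := (hermiteInt_strictAnti hp).antitone h1
      have hq := hermiteInt_pos hp 1
      have : hermiteInt (p + 1) s / hermiteInt p s ≤ hermiteInt (p + 1) s₀ / hermiteInt p 1 := by
        have := hermiteInt_pos hp1 s₀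
        gcongr
      rw [hC]
      linarith
  rw [robinF_eq h]
  rw [← hpdef]
  calc _ ≤ |-s| + |2 * (hermiteInt (p + 1) s / hermiteInt p s)| := abs_sub _ _
    _ ≤ _ := by rw [abs_neg, abs_of_nonneg hm]; linarith

/-- `robinF lam s` tends to `-s` as `lam → 1`. -/
theorem exists_robinF_gt {s c : ℝ} (hc : c < -s) : ∃ lam < 1, c < robinF lam s := by
  set A := hermiteInt 0 s + hermiteInt 1 s with hA
  have hA0 : 0 < A := add_pos (hermiteInt_pos (by norm_num) s) (hermiteInt_pos (by norm_num) s)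
  set B := Real.exp (-1 - 2 * |s|) with hB
  have hB0 : 0 < B := Real.exp_pos _
  set q := min 1 ((-s - c) * B / (4 * A)) with hq
  have hq0 : 0 < q := by
    rw [hq]
    have : 0 < -s - c := by linarith
    positivity
  have hq1 : q ≤ 1 := min_le_left _ _
  have hq2 : q ≤ (-s - c) * B / (4 * A) := min_le_right _ _
  -- For `lam = 1 - 2q` the exponents are `q - 1` and `q`. The integral with exponent `q - 1` is at
  -- least `B / q`, the other at most `A`. The choice of `q` makes their ratio at most `(-s - c) /
  -- 4`.
  refine ⟨1 - 2 * q, by linarith, ?_⟩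
  rw [robinF_eq (by linarith)]
  have e1 : -(1 - 2 * q + 1) / 2 = q - 1 := by ring
  rw [e1, show q - 1 + 1 = q by ring]
  have up : hermiteInt q s ≤ A := by
    have i0 := integrableOn_hermiteInt (p := 0) (by norm_num) s
    have i1 := integrableOn_hermiteInt (p := 1) (by norm_num) s
    rw [hA, hermiteInt, hermiteInt, hermiteInt, ← integral_add i0 i1]
    refine setIntegral_mono_on (integrableOn_hermiteInt (by linarith) s) (i0.add i1)
      measurableSet_Ioi fun y hy => ?_
    rw [← add_mul]
    gcongr
    have hy0 : 0 < y := hy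
    rcases le_total y 1 with h | h
    · have := Real.rpow_le_rpow_of_exponent_ge hy0 h hq0.le
      exact this.trans (le_add_of_nonneg_right (Real.rpow_nonneg hy0.le 1))
    · have := Real.rpow_le_rpow_of_exponent_le h hq1
      exact this.trans (le_add_of_nonneg_left (Real.rpow_nonneg hy0.le 0))
  have low : B / q ≤ hermiteInt (q - 1) s := by
    have i := integrableOn_hermiteInt (p := q - 1) (by linarith) s
    have hpow : ∫ y in Ioc (0 : ℝ) 1, y ^ (q - 1) * B = B / q := by
      rw [integral_mul_const, ← intervalIntegral.integral_of_le zero_le_one,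
        integral_rpow (Or.inl (by linarith))]
      rw [show q - 1 + 1 = q by ring, Real.one_rpow, Real.zero_rpow hq0.ne']
      ring
    rw [← hpow]
    calc _ ≤ ∫ y in Ioc (0 : ℝ) 1, y ^ (q - 1) * Real.exp (-y ^ 2 - 2 * s * y) := by
          refine setIntegral_mono_on ?_ (i.mono_set Ioc_subset_Ioi_self) measurableSet_Ioc
            fun y hy => ?_
          · refine Integrable.mul_const ?_ _
            exact (intervalIntegrable_iff_integrableOn_Ioc_of_le zero_le_one).mp
              (intervalIntegral.intervalIntegrable_rpow' (by linarith))
          · have hy0 := hy.1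
            have hy1 := hy.2
            have : 2 * s * y ≤ 2 * |s| := by
              have := le_abs_self s
              have := abs_nonneg s
              nlinarith
            have : y ^ 2 ≤ 1 := by nlinarith
            have := Real.rpow_nonneg hy0.le (q - 1)
            rw [hB]
            gcongr
      _ ≤ _ := by
          refine setIntegral_mono_set i ?_ (Ioc_subset_Ioi_self.eventuallyLE)
          filter_upwards [ae_restrict_mem measurableSet_Ioi] with y hy
          exact mul_nonneg (Real.rpow_nonneg (le_of_lt hy) _) (Real.exp_pos _).le
  have hfrac : hermiteInt q s / hermiteInt (q - 1) s ≤ A / (B / q) := by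
    have : 0 < B / q := by positivity
    gcongr
  have : A / (B / q) ≤ (-s - c) / 4 := by
    rw [div_div_eq_mul_div, div_le_iff₀ hB0]
    rw [le_div_iff₀ (by positivity)] at hq2
    linarith
  linarith

/-! ### The maximum of the logarithmic derivative -/

theorem neg_of_strictMonoOn_of_tendsto_zero {f : ℝ → ℝ} {a : ℝ} (hf : StrictMonoOn f (Ici a))
    (h : Tendsto f atTop (𝓝 0)) {s : ℝ} (hs : a ≤ s) : f s < 0 := by
  have h1 : f s < f (s + 1) := hf hs (by simp only [mem_Ici]; linarith) (by linarith)
  have h2 : f (s + 1) ≤ 0 := by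
    refine ge_of_tendsto h ?_
    filter_upwards [eventually_ge_atTop (s + 1)] with t ht
    exact hf.monotoneOn (by simp only [mem_Ici]; linarith) (by simp only [mem_Ici]; linarith) ht
  linarith

/-- The quantity `(s² - lam) D² - D'²`, which has the sign of the derivative of `robinF lam`. -/
noncomputable def robinK (lam s : ℝ) : ℝ :=
  (s ^ 2 - lam) * decaySol lam s ^ 2 - decaySolDeriv lam s ^ 2

/-- The mixed terms cancel by the differential equation, so the monotonicity of `robinK` is governed
by the sign of `s` alone. -/
theorem hasDerivAt_robinK {lam : ℝ} (h : lam < 1) (s : ℝ) :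
    HasDerivAt (robinK lam) (2 * s * decaySol lam s ^ 2) s := by
  convert! (((hasDerivAt_pow 2 s).sub_const lam).mul ((hasDerivAt_decaySol h s).pow 2)).sub
    ((hasDerivAt_decaySolDeriv h s).pow 2) using 1
  simp
  ring

theorem tendsto_robinK {lam : ℝ} (h : lam < 1) : Tendsto (robinK lam) atTop (𝓝 0) := by
  have h0 := tendsto_pow_mul_decaySol h 0
  have h1 := tendsto_pow_mul_decaySol h 1
  have h2 := tendsto_pow_mul_decaySolDeriv h 0
  have := ((h1.pow 2).sub ((h0.pow 2).const_mul lam)).sub (h2.pow 2)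
  norm_num at this
  refine this.congr fun s => ?_
  simp only [robinK]
  ring

theorem continuous_robinK {lam : ℝ} (h : lam < 1) : Continuous (robinK lam) :=
  continuous_iff_continuousAt.mpr fun s => (hasDerivAt_robinK h s).continuousAt

theorem robinK_strictMonoOn {lam : ℝ} (h : lam < 1) : StrictMonoOn (robinK lam) (Ici 0) := by
  refine strictMonoOn_of_deriv_pos (convex_Ici 0) (continuous_robinK h).continuousOn fun s hs => ?_
  rw [interior_Ici, mem_Ioi] at hs
  rw [(hasDerivAt_robinK h s).deriv]
  have := decaySol_pos h s
  positivity

theorem robinK_strictAntiOn {lam : ℝ} (h : lam < 1) : StrictAntiOn (robinK lam) (Iic 0) := by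
  refine strictAntiOn_of_deriv_neg (convex_Iic 0) (continuous_robinK h).continuousOn fun s hs => ?_
  rw [interior_Iic, mem_Iio] at hs
  rw [(hasDerivAt_robinK h s).deriv]
  have : 0 < decaySol lam s ^ 2 := pow_pos (decaySol_pos h s) 2
  nlinarith

theorem robinK_neg {lam : ℝ} (h : lam < 1) {s : ℝ} (hs : 0 ≤ s) : robinK lam s < 0 :=
  neg_of_strictMonoOn_of_tendsto_zero (robinK_strictMonoOn h) (tendsto_robinK h) hs

/-- The difference `robinK (-s) - robinK s` has derivative `2s (D(-s)² - D(s)²)`, which is positive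
for `s > 0` because the Gaussian factor of `D = decaySol lam` is even and the integral factor
decreases. So the difference stays above a positive constant, while `robinK s` tends to `0`. -/
theorem exists_robinK_pos {lam : ℝ} (h : lam < 1) : ∃ s < 0, 0 < robinK lam s := by
  have hd : ∀ s, HasDerivAt (fun s => robinK lam (-s) - robinK lam s)
      (2 * s * (decaySol lam (-s) ^ 2 - decaySol lam s ^ 2)) s := by
    intro s
    have h1 := (hasDerivAt_robinK h (-s)).comp s (hasDerivAt_neg s)
    convert! h1.sub (hasDerivAt_robinK h s) using 1
    ring
  have hm : StrictMonoOn (fun s => robinK lam (-s) - robinK lam s) (Ici 0) := by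
    refine strictMonoOn_of_deriv_pos (convex_Ici 0)
      (continuous_iff_continuousAt.mpr fun s => (hd s).continuousAt).continuousOn fun s hs => ?_
    rw [interior_Ici, mem_Ioi] at hs
    rw [(hd s).deriv]
    have h1 := decaySol_pos h s
    have h2 := decaySol_lt_neg h hs
    have : decaySol lam s ^ 2 < decaySol lam (-s) ^ 2 := by gcongr
    exact mul_pos (by linarith) (by linarith)
  have h01 := hm (show (0 : ℝ) ∈ Ici 0 by simp) (show (1 : ℝ) ∈ Ici 0 by simp) one_pos
  simp only [neg_zero, sub_self] at h01
  have hev := (tendsto_robinK h).eventually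
    (lt_mem_nhds (show -(robinK lam (-1) - robinK lam 1) < 0 by linarith))
  obtain ⟨t, ht, ht1⟩ := (hev.and (eventually_ge_atTop 1)).exists
  refine ⟨-t, by linarith, ?_⟩
  have := hm.monotoneOn (show (1 : ℝ) ∈ Ici 0 by simp) (show t ∈ Ici 0 by simp; linarith) ht1
  linarith

theorem exists_robinK_zero {lam : ℝ} (h : lam < 1) : ∃ s < 0, robinK lam s = 0 := by
  obtain ⟨a, ha, hKa⟩ := exists_robinK_pos h
  have h0 := robinK_neg h le_rfl
  obtain ⟨s, hs, hs0⟩ := intermediate_value_Icc' ha.le (continuous_robinK h).continuousOn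
    (show (0 : ℝ) ∈ Icc (robinK lam 0) (robinK lam a) from ⟨h0.le, hKa.le⟩)
  refine ⟨s, lt_of_le_of_ne hs.2 ?_, hs0⟩
  rintro rfl
  linarith

open Classical in
/-- The point where `robinF lam` attains its maximum. -/
noncomputable def robinArgmax (lam : ℝ) : ℝ :=
  if h : lam < 1 then (exists_robinK_zero h).choose else 0

theorem robinArgmax_neg {lam : ℝ} (h : lam < 1) : robinArgmax lam < 0 := by
  rw [robinArgmax, dif_pos h]
  exact (exists_robinK_zero h).choose_spec.1

theorem robinK_robinArgmax {lam : ℝ} (h : lam < 1) : robinK lam (robinArgmax lam) = 0 := by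
  rw [robinArgmax, dif_pos h]
  exact (exists_robinK_zero h).choose_spec.2

/-- `robinK` is strictly decreasing on `(-∞, 0]` and negative on `[0, ∞)`, hence it changes sign
only at `robinArgmax`. The equivalence also allows the maximum point to be located from the sign at
a fixed `s`. -/
theorem robinK_pos_iff {lam : ℝ} (h : lam < 1) {s : ℝ} : 0 < robinK lam s ↔ s < robinArgmax lam := by
  have h0 := robinArgmax_neg h
  have hK := robinK_robinArgmax h
  constructor
  · intro hs
    have hs0 : s < 0 := by
      by_contra hn
      linarith [robinK_neg h (not_lt.mp hn)]
    by_contra hn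
    have := (robinK_strictAntiOn h).antitoneOn h0.le hs0.le (not_lt.mp hn)
    linarith
  · intro hs
    have := robinK_strictAntiOn h (show s ∈ Iic 0 from (hs.trans h0).le) h0.le hs
    linarith

theorem robinK_neg_iff {lam : ℝ} (h : lam < 1) {s : ℝ} : robinK lam s < 0 ↔ robinArgmax lam < s := by
  have h0 := robinArgmax_neg h
  have hK := robinK_robinArgmax h
  constructor
  · intro hs
    by_contra hn
    rcases (not_lt.mp hn).lt_or_eq with h1 | h1
    · linarith [(robinK_pos_iff h).mpr h1]
    · rw [h1] at hs
      linarith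
  · intro hs
    rcases le_total 0 s with h1 | h1
    · exact robinK_neg h h1
    · have := robinK_strictAntiOn h h0.le h1 hs
      linarith

theorem continuousOn_uncurry_robinK :
    ContinuousOn (fun z : ℝ × ℝ => robinK z.1 z.2) (Iio 1 ×ˢ univ) :=
  (ContinuousOn.mul (by fun_prop) (continuousOn_decaySol.pow 2)).sub (continuousOn_decaySolDeriv.pow 2)

theorem continuousOn_fst_of_uncurry {f : ℝ → ℝ → ℝ} {L : ℝ}
    (hf : ContinuousOn (fun z : ℝ × ℝ => f z.1 z.2) (Iio L ×ˢ univ)) (s : ℝ) :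
    ContinuousOn (fun lam => f lam s) (Iio L) :=
  hf.comp (f := fun lam : ℝ => (lam, s)) (by fun_prop) fun _ hl => ⟨hl, mem_univ _⟩

/-- `a < robinArgmax lam` means `robinK lam a > 0`, and `robinArgmax lam < a` means `robinK lam a <
0`. Both are open conditions on `lam`, since `robinK` is continuous in `lam`. -/
theorem continuousOn_robinArgmax : ContinuousOn robinArgmax (Iio 1) := by
  intro lam hlam
  refine ContinuousAt.continuousWithinAt ?_
  have hn : Iio (1 : ℝ) ∈ 𝓝 lam := Iio_mem_nhds hlam
  have hK : ∀ s, ContinuousAt (fun l => robinK l s) lam := fun s =>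
    (continuousOn_fst_of_uncurry continuousOn_uncurry_robinK s).continuousAt hn
  refine tendsto_order.mpr ⟨fun a ha => ?_, fun a ha => ?_⟩
  · filter_upwards [hn, (hK a).eventually (lt_mem_nhds ((robinK_pos_iff hlam).mpr ha))] with l hl h
    exact (robinK_pos_iff hl).mp h
  · filter_upwards [hn, (hK a).eventually (gt_mem_nhds ((robinK_neg_iff hlam).mpr ha))] with l hl h
    exact (robinK_neg_iff hl).mp h

theorem deriv_robinF {lam : ℝ} (h : lam < 1) (s : ℝ) :
    deriv (robinF lam) s = robinK lam s / decaySol lam s ^ 2 := by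
  rw [(hasDerivAt_robinF h s).deriv, eq_div_iff (pow_pos (decaySol_pos h s) 2).ne', robinK,
    ← robinF_mul h]
  ring

theorem robinF_lt_max {lam : ℝ} (h : lam < 1) {s : ℝ} (hs : s ≠ robinArgmax lam) :
    robinF lam s < robinF lam (robinArgmax lam) := by
  rcases hs.lt_or_gt with h1 | h1
  · refine strictMonoOn_of_deriv_pos (convex_Iic (robinArgmax lam))
      (continuous_robinF h).continuousOn (fun t ht => ?_) h1.le (mem_Iic.mpr le_rfl) h1
    rw [interior_Iic, mem_Iio] at ht
    rw [deriv_robinF h]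
    exact div_pos ((robinK_pos_iff h).mpr ht) (pow_pos (decaySol_pos h t) 2)
  · refine strictAntiOn_of_deriv_neg (convex_Ici (robinArgmax lam))
      (continuous_robinF h).continuousOn (fun t ht => ?_) (mem_Ici.mpr le_rfl) h1.le h1
    rw [interior_Ici, mem_Ioi] at ht
    rw [deriv_robinF h]
    exact div_neg_of_neg_of_pos ((robinK_neg_iff h).mpr ht) (pow_pos (decaySol_pos h t) 2)

theorem robinF_le_max {lam : ℝ} (h : lam < 1) (s : ℝ) :
    robinF lam s ≤ robinF lam (robinArgmax lam) := by
  rcases eq_or_ne s (robinArgmax lam) with rfl | hs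
  · exact le_rfl
  · exact (robinF_lt_max h hs).le

/-- The right-hand side of the Riccati equation vanishes at the maximum point. -/
theorem robinArgmax_sq {lam : ℝ} (h : lam < 1) :
    robinArgmax lam ^ 2 = lam + robinF lam (robinArgmax lam) ^ 2 := by
  have hK := robinK_robinArgmax h
  rw [robinK, ← robinF_mul h] at hK
  have hD : decaySol lam (robinArgmax lam) ^ 2 ≠ 0 := (pow_pos (decaySol_pos h _) 2).ne'
  have : decaySol lam (robinArgmax lam) ^ 2 *
      (robinArgmax lam ^ 2 - lam - robinF lam (robinArgmax lam) ^ 2) = 0 := by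
    linear_combination hK
  have := (mul_eq_zero.mp this).resolve_left hD
  linarith

/-! ### The ground energy: the level at which the maximum of `robinF` equals `γ`. -/

theorem robinF_neg {lam : ℝ} (h : lam < 0) (s : ℝ) : robinF lam s < 0 := by
  have h1 : lam < 1 := by linarith
  refine div_neg_of_neg_of_pos ?_ (decaySol_pos h1 s)
  have ht := tendsto_pow_mul_decaySolDeriv h1 0
  simp only [pow_zero, one_mul] at ht
  refine neg_of_strictMonoOn_of_tendsto_zero (a := s) (StrictMono.strictMonoOn ?_ _) ht le_rfl
  refine strictMono_of_deriv_pos fun t => ?_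
  rw [(hasDerivAt_decaySolDeriv h1 t).deriv]
  exact mul_pos (by nlinarith [sq_nonneg t]) (decaySol_pos h1 t)

/-- Intermediate value theorem for `lam ↦ max robinF lam`. At `lam = -γ² - 1` the maximum is
negative and its square is at least `γ² + 1`, so it is at most `γ`. Near `lam = 1` the value at `s =
-γ - 1` exceeds `γ`, since it approaches `γ + 1`. -/
theorem exists_robin_max (γ : ℝ) : ∃ lam < 1, robinF lam (robinArgmax lam) = γ := by
  have hcont : ContinuousOn (fun lam => robinF lam (robinArgmax lam)) (Iio 1) :=
    continuousOn_uncurry_robinF.comp (f := fun lam : ℝ => (lam, robinArgmax lam))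
      (continuousOn_id.prodMk continuousOn_robinArgmax) fun _ hl => ⟨hl, mem_univ _⟩
  have hlow : robinF (-γ ^ 2 - 1) (robinArgmax (-γ ^ 2 - 1)) ≤ γ := by
    have hl : -γ ^ 2 - 1 < 0 := by nlinarith [sq_nonneg γ]
    have h1 := robinF_neg hl (robinArgmax (-γ ^ 2 - 1))
    have h2 := robinArgmax_sq (lam := -γ ^ 2 - 1) (by linarith)
    nlinarith [sq_nonneg (robinArgmax (-γ ^ 2 - 1))]
  obtain ⟨l, hl, hl'⟩ := exists_robinF_gt (s := -γ - 1) (c := γ) (by linarith)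
  have hup : γ ≤ robinF l (robinArgmax l) := hl'.le.trans (robinF_le_max hl _)
  have := isPreconnected_Iio.intermediate_value (show -γ ^ 2 - 1 ∈ Iio (1 : ℝ) by
    simp only [mem_Iio]; nlinarith [sq_nonneg γ]) hl hcont ⟨hlow, hup⟩
  obtain ⟨lam, h, h'⟩ := this
  exact ⟨lam, h, h'⟩

/-- The bottom of the spectrum, as the value of `lam` for which `max robinF lam = γ`. -/
noncomputable def groundEnergy (γ : ℝ) : ℝ := (exists_robin_max γ).choose

/-- The optimal parameter `ξ(γ)`. -/
noncomputable def optimalXi (γ : ℝ) : ℝ := -robinArgmax (groundEnergy γ)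

theorem groundEnergy_lt_one (γ : ℝ) : groundEnergy γ < 1 := (exists_robin_max γ).choose_spec.1

theorem optimalXi_pos (γ : ℝ) : 0 < optimalXi γ :=
  neg_pos.mpr (robinArgmax_neg (groundEnergy_lt_one γ))

theorem robinF_neg_optimalXi (γ : ℝ) : robinF (groundEnergy γ) (-optimalXi γ) = γ := by
  rw [optimalXi, neg_neg]
  exact (exists_robin_max γ).choose_spec.2

theorem robinF_lt_of_ne {γ η : ℝ} (h : η ≠ optimalXi γ) : robinF (groundEnergy γ) (-η) < γ := by
  conv_rhs => rw [← robinF_neg_optimalXi γ, optimalXi, neg_neg]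
  refine robinF_lt_max (groundEnergy_lt_one γ) fun h' => h ?_
  rw [optimalXi, ← h', neg_neg]

theorem robinF_groundEnergy_le (γ s : ℝ) : robinF (groundEnergy γ) s ≤ γ := by
  conv_rhs => rw [← robinF_neg_optimalXi γ, optimalXi, neg_neg]
  exact robinF_le_max (groundEnergy_lt_one γ) s

theorem optimalXi_sq (γ : ℝ) : optimalXi γ ^ 2 = groundEnergy γ + γ ^ 2 := by
  have := robinArgmax_sq (groundEnergy_lt_one γ)
  have h2 := robinF_neg_optimalXi γ
  rw [optimalXi, neg_neg] at h2
  rw [optimalXi, neg_sq, this, h2]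

/-! ### Absolutely continuous functions on the half-line -/

/-- `P` is locally absolutely continuous on `[0, ∞)` with derivative `p`. -/
structure IsPrimitive (P p : ℝ → ℝ) : Prop where
  ac : ∀ T, 0 ≤ T → AbsolutelyContinuousOnInterval P 0 T
  deriv_ae : ∀ᵐ t, 0 < t → HasDerivAt P (p t) t

namespace IsPrimitive

theorem mul {P p Q q : ℝ → ℝ} (hP : IsPrimitive P p) (hQ : IsPrimitive Q q) :
    IsPrimitive (fun t => P t * Q t) (fun t => p t * Q t + P t * q t) where
  ac T hT := (hP.ac T hT).fun_mul (hQ.ac T hT)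
  deriv_ae := by
    filter_upwards [hP.deriv_ae, hQ.deriv_ae] with t h1 h2 ht using (h1 ht).mul (h2 ht)

theorem of_hasDerivAt {P p : ℝ → ℝ} (h : ∀ t, HasDerivAt P (p t) t) (hp : Continuous p) :
    IsPrimitive P p where
  ac T _ := by
    refine ContDiffOn.absolutelyContinuousOnInterval (ContDiff.contDiffOn ?_)
    rw [contDiff_one_iff_deriv]
    refine ⟨fun t => (h t).differentiableAt, ?_⟩
    rwa [show deriv P = p from funext fun t => (h t).deriv]
  deriv_ae := Eventually.of_forall fun t _ => h t

theorem of_integral {g : ℝ → ℝ} (hg : ∀ T, 0 ≤ T → IntervalIntegrable g volume 0 T) (c : ℝ) :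
    IsPrimitive (fun t => c + ∫ x in (0 : ℝ)..t, g x) g where
  ac T hT := by
    refine AbsolutelyContinuousOnInterval.add (f := fun _ => c) ?_
      ((hg T hT).absolutelyContinuousOnInterval_intervalIntegral (by simp))
    exact ContDiffOn.absolutelyContinuousOnInterval contDiffOn_const
  deriv_ae := by
    have := ae_all_iff.mpr fun n : ℕ => (hg n n.cast_nonneg).ae_hasDerivAt_integral
    filter_upwards [this] with t ht ht0
    obtain ⟨n, hn⟩ := exists_nat_ge t
    have hmem : t ∈ uIcc (0 : ℝ) n := by
      rw [uIcc_of_le n.cast_nonneg]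
      exact ⟨ht0.le, hn⟩
    exact (ht n hmem 0 (by simp)).const_add c

theorem integral_eq_sub {P p : ℝ → ℝ} (hP : IsPrimitive P p) {T : ℝ} (hT : 0 ≤ T) :
    ∫ t in (0 : ℝ)..T, p t = P T - P 0 := by
  rw [← (hP.ac T hT).integral_deriv_eq_sub]
  refine intervalIntegral.integral_congr_ae ?_
  filter_upwards [hP.deriv_ae] with t ht htm
  rw [uIoc_of_le hT] at htm
  exact (ht htm.1).deriv.symm

/-- `P` has a limit at infinity because `p` is integrable; being integrable itself, `P` can only
tend to `0`. -/
theorem integral_Ioi_eq {P p : ℝ → ℝ} (hP : IsPrimitive P p) (hp : IntegrableOn p (Ioi 0))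
    (hPi : IntegrableOn P (Ioi 0)) : ∫ t in Ioi (0 : ℝ), p t = -P 0 := by
  have h1 : Tendsto (fun T => P 0 + ∫ t in (0 : ℝ)..T, p t) atTop
      (𝓝 (P 0 + ∫ t in Ioi (0 : ℝ), p t)) :=
    (intervalIntegral_tendsto_integral_Ioi 0 hp tendsto_id).const_add _
  have h2 : Tendsto P atTop (𝓝 (P 0 + ∫ t in Ioi (0 : ℝ), p t)) := by
    refine h1.congr' ?_
    filter_upwards [eventually_ge_atTop 0] with T hT
    rw [hP.integral_eq_sub hT]
    ring
  have h3 := IntegrableAtFilter.eq_zero_of_tendsto (μ := volume)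
    (⟨Ioi 0, Ioi_mem_atTop 0, hPi⟩ : IntegrableAtFilter P atTop volume) ?_ h2
  · linarith
  · intro s hs
    rcases mem_atTop_sets.1 hs with ⟨b, hb⟩
    rw [← top_le_iff, ← Real.volume_Ici (a := b)]
    exact measure_mono hb

theorem continuousOn {P p : ℝ → ℝ} (hP : IsPrimitive P p) : ContinuousOn P (Ici 0) := by
  intro t ht
  have h := (hP.ac (t + 1) (by simp only [mem_Ici] at ht; linarith)).continuousOn
  rw [uIcc_of_le (by simp only [mem_Ici] at ht; linarith)] at h
  refine (h t ⟨ht, by linarith⟩).mono_of_mem_nhdsWithin ?_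
  have : Icc 0 (t + 1) = Ici 0 ∩ Iic (t + 1) := rfl
  rw [this]
  exact inter_mem self_mem_nhdsWithin (mem_nhdsWithin_of_mem_nhds (Iic_mem_nhds (by linarith)))

end IsPrimitive

/-! ### Weak derivatives on the half-line and the du Bois-Reymond lemma. -/

theorem intervalIntegrable_zero_of_memLp {E : Type*} [NormedAddCommGroup E] {g : ℝ → E}
    (hg : MemLp g 2 (volume.restrict (Ioi 0))) {T : ℝ} (hT : 0 ≤ T) :
    IntervalIntegrable g volume 0 T := by
  rw [intervalIntegrable_iff_integrableOn_Ioc_of_le hT]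
  have : MemLp g 2 (volume.restrict (Ioc 0 T)) :=
    hg.mono_measure (Measure.restrict_mono Ioc_subset_Ioi_self le_rfl)
  exact this.integrable (by norm_num)

/-- A smooth bump supported in `(0, ∞)` with integral one. -/
theorem exists_bump_Ioi : ∃ k : ℝ → ℝ, ContDiff ℝ ∞ k ∧ HasCompactSupport k ∧
    tsupport k ⊆ Ioi 0 ∧ ∫ t, k t = 1 := by
  let b : ContDiffBump (1 : ℝ) := ⟨1 / 4, 1 / 2, by norm_num, by norm_num⟩
  refine ⟨b.normed volume, b.contDiff_normed, b.hasCompactSupport_normed, ?_, b.integral_normed⟩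
  rw [b.tsupport_normed_eq]
  intro x hx
  rw [Metric.mem_closedBall, Real.dist_eq] at hx
  have h2 : -(1 / 2) ≤ x - 1 := (abs_le.mp hx).1
  simp only [mem_Ioi]
  linarith

theorem exists_Icc_of_tsupport_subset_Ioi {k : ℝ → ℝ} (hc : HasCompactSupport k)
    (hs : tsupport k ⊆ Ioi 0) : ∃ ε M, 0 < ε ∧ ε ≤ M ∧ ∀ t, t ∉ Icc ε M → k t = 0 := by
  rcases (tsupport k).eq_empty_or_nonempty with h | h
  · refine ⟨1, 1, one_pos, le_rfl, fun t _ => ?_⟩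
    rw [tsupport_eq_empty_iff] at h
    simp [h]
  · obtain ⟨a, ha, hamin⟩ := hc.isCompact.exists_isLeast h
    obtain ⟨b, hb, hbmax⟩ := hc.isCompact.exists_isGreatest h
    refine ⟨a, b, hs ha, hamin hb, fun t ht => ?_⟩
    by_contra hne
    have := subset_tsupport k (Function.mem_support.mpr hne)
    exact ht ⟨hamin this, hbmax this⟩

/-- A test function with integral zero has a primitive that is a test function. -/
theorem exists_testFunction_primitive {k : ℝ → ℝ} (hk : ContDiff ℝ ∞ k) (hc : HasCompactSupport k)
    (hs : tsupport k ⊆ Ioi 0) (hint : ∫ t, k t = 0) :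
    ∃ h : ℝ → ℝ, ContDiff ℝ ∞ h ∧ HasCompactSupport h ∧ tsupport h ⊆ Ioi 0 ∧ deriv h = k := by
  obtain ⟨ε, M, hε, hM, hz⟩ := exists_Icc_of_tsupport_subset_Ioi hc hs
  have hd : ∀ t, HasDerivAt (fun t => ∫ x in (0 : ℝ)..t, k x) (k t) t := fun t =>
    intervalIntegral.integral_hasDerivAt_right (hk.continuous.intervalIntegrable _ _)
      (hk.continuous.stronglyMeasurableAtFilter _ _) hk.continuous.continuousAt
  have hderiv : deriv (fun t => ∫ x in (0 : ℝ)..t, k x) = k := funext fun t => (hd t).deriv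
  have hzero : ∀ t, t ∉ Icc ε M → ∫ x in (0 : ℝ)..t, k x = 0 := by
    intro t ht
    rcases lt_or_ge t ε with h1 | h1
    · refine intervalIntegral.integral_zero_ae (Eventually.of_forall fun x hx => hz x fun hx' => ?_)
      have := hx.2
      rcases le_max_iff.mp this with h2 | h2
      · linarith [hx'.1]
      · linarith [hx'.1]
    · have h2 : M < t := by
        by_contra hn
        exact ht ⟨h1, not_lt.mp hn⟩
      rw [intervalIntegral.integral_eq_integral_of_support_subset, hint]
      intro x hx
      by_contra hn
      refine hx (hz x fun hx' => hn ⟨by linarith [hx'.1], by linarith [hx'.2]⟩)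
  have hts : tsupport (fun t => ∫ x in (0 : ℝ)..t, k x) ⊆ Icc ε M := by
    refine closure_minimal (fun t ht => ?_) isClosed_Icc
    by_contra hn
    exact ht (hzero t hn)
  refine ⟨fun t => ∫ x in (0 : ℝ)..t, k x, ?_, ?_, hts.trans fun t ht => lt_of_lt_of_le hε ht.1,
    hderiv⟩
  · rw [contDiff_infty_iff_deriv, hderiv]
    exact ⟨fun t => (hd t).differentiableAt, hk⟩
  · exact isCompact_Icc.of_isClosed_subset (isClosed_tsupport _) hts

theorem integrableOn_Ioi_mul_test {P f : ℝ → ℝ} (hP : ContinuousOn P (Ici 0)) (hf : Continuous f)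
    (hc : HasCompactSupport f) : IntegrableOn (fun t => P t * f t) (Ioi 0) := by
  have h1 : IntegrableOn (fun t => P t * f t) (tsupport f ∩ Ici 0) :=
    ContinuousOn.integrableOn_compact (hc.isCompact.inter_right isClosed_Ici)
      ((hP.mono inter_subset_right).mul hf.continuousOn)
  have h2 : IntegrableOn (fun t => P t * f t) (Ici 0) := by
    refine h1.of_forall_sdiff_eq_zero measurableSet_Ici fun t ht => ?_
    have : t ∉ tsupport f := fun h => ht.2 ⟨h, ht.1⟩
    rw [image_eq_zero_of_notMem_tsupport this, mul_zero]
  exact h2.mono_set Ioi_subset_Ici_self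

theorem integrableOn_Ioi_mul_test_of_memLp {v f : ℝ → ℝ} (hv : MemLp v 2 (volume.restrict (Ioi 0)))
    (hf : Continuous f) (hc : HasCompactSupport f) : IntegrableOn (fun t => v t * f t) (Ioi 0) :=
  hv.integrable_mul (q := 2) ((hf.memLp_of_hasCompactSupport hc).restrict _)

theorem integral_primitive_mul_deriv {g f : ℝ → ℝ} (hg : MemLp g 2 (volume.restrict (Ioi 0)))
    (hf : ContDiff ℝ ∞ f) (hc : HasCompactSupport f) (c : ℝ) :
    ∫ t in Ioi (0 : ℝ), (c + ∫ x in (0 : ℝ)..t, g x) * deriv f t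
      = -(∫ t in Ioi (0 : ℝ), g t * f t) - c * f 0 := by
  have hP := IsPrimitive.of_integral (fun T hT => intervalIntegrable_zero_of_memLp hg hT) c
  have hfc' : Continuous (deriv f) := hf.continuous_deriv (by simp)
  have hQ := IsPrimitive.of_hasDerivAt (P := f) (p := deriv f)
    (fun t => (hf.differentiable (by simp) t).hasDerivAt) hfc'
  have i1 := integrableOn_Ioi_mul_test_of_memLp hg hf.continuous hc
  have i2 := integrableOn_Ioi_mul_test hP.continuousOn hfc' hc.deriv
  have := (hP.mul hQ).integral_Ioi_eq (i1.add i2)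
    (integrableOn_Ioi_mul_test hP.continuousOn hf.continuous hc)
  rw [integral_add i1 i2] at this
  simp only [intervalIntegral.integral_same, add_zero] at this
  linarith

/-- A square integrable function with square integrable weak derivative on `(0, ∞)` is almost
everywhere equal to a primitive. -/
theorem exists_ae_eq_primitive {v g : ℝ → ℝ} (hv : MemLp v 2 (volume.restrict (Ioi 0)))
    (hg : MemLp g 2 (volume.restrict (Ioi 0)))
    (h : ∀ f : ℝ → ℝ, ContDiff ℝ ∞ f → HasCompactSupport f → tsupport f ⊆ Ioi 0 →
      ∫ t in Ioi (0 : ℝ), v t * deriv f t = -∫ t in Ioi (0 : ℝ), g t * f t) :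
    ∃ c, ∀ᵐ t ∂(volume.restrict (Ioi (0 : ℝ))), v t = c + ∫ x in (0 : ℝ)..t, g x := by
  obtain ⟨k₀, hk₀, hc₀, hs₀, hi₀⟩ := exists_bump_Ioi
  have hP := IsPrimitive.of_integral (fun T hT => intervalIntegrable_zero_of_memLp hg hT) 0
  set w : ℝ → ℝ := fun t => v t - (0 + ∫ x in (0 : ℝ)..t, g x) with hw
  have hwi : ∀ k : ℝ → ℝ, ContDiff ℝ ∞ k → HasCompactSupport k →
      IntegrableOn (fun t => w t * k t) (Ioi 0) := by
    intro k hk hkc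
    have := (integrableOn_Ioi_mul_test_of_memLp hv hk.continuous hkc).sub
      (integrableOn_Ioi_mul_test hP.continuousOn hk.continuous hkc)
    refine this.congr (Eventually.of_forall fun t => ?_)
    simp only [hw, Pi.sub_apply]
    ring
  set c := ∫ t in Ioi (0 : ℝ), w t * k₀ t with hcdef
  refine ⟨c, ?_⟩
  have key : ∀ k : ℝ → ℝ, ContDiff ℝ ∞ k → HasCompactSupport k → tsupport k ⊆ Ioi 0 →
      ∫ t in Ioi (0 : ℝ), k t • (w t - c) = 0 := by
    intro k hk hkc hks
    have hki : ∫ t in Ioi (0 : ℝ), k t = ∫ t, k t :=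
      setIntegral_eq_integral_of_forall_compl_eq_zero fun t ht =>
        image_eq_zero_of_notMem_tsupport fun h' => ht (hks h')
    -- `k - m k₀` has integral zero, so it is the derivative of a test function and `w` annihilates
    -- it. Thus `∫ w k = m ∫ w k₀ = c ∫ k` for every test function `k`, that is, `w = c` almost
    -- everywhere.
    set m := ∫ t, k t with hm
    have e1 : ContDiff ℝ ∞ (fun t => k t - m * k₀ t) := hk.sub (contDiff_const.mul hk₀)
    have e2 : HasCompactSupport (fun t => k t - m * k₀ t) := hkc.sub (hc₀.mul_left (f := fun _ => m))
    have e3 : tsupport (fun t => k t - m * k₀ t) ⊆ Ioi 0 := by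
      refine (tsupport_sub k (fun t => m * k₀ t)).trans (union_subset hks ?_)
      exact (tsupport_mul_subset_right (f := fun _ => m)).trans hs₀
    have e4 : ∫ t, (k t - m * k₀ t) = 0 := by
      rw [integral_sub (hk.continuous.integrable_of_hasCompactSupport hkc)
        ((hk₀.continuous.integrable_of_hasCompactSupport hc₀).const_mul m), integral_const_mul,
        hi₀, ← hm]
      ring
    obtain ⟨f, hf, hfc, hfs, hfd⟩ := exists_testFunction_primitive e1 e2 e3 e4
    have a1 := h f hf hfc hfs
    have a2 := integral_primitive_mul_deriv hg hf hfc 0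
    rw [hfd] at a1 a2
    have a3 : ∫ t in Ioi (0 : ℝ), w t * (k t - m * k₀ t) = 0 := by
      have i1 := integrableOn_Ioi_mul_test_of_memLp hv e1.continuous e2
      have i2 := integrableOn_Ioi_mul_test hP.continuousOn e1.continuous e2
      have : ∫ t in Ioi (0 : ℝ), w t * (k t - m * k₀ t)
          = (∫ t in Ioi (0 : ℝ), v t * (k t - m * k₀ t))
            - ∫ t in Ioi (0 : ℝ), (0 + ∫ x in (0 : ℝ)..t, g x) * (k t - m * k₀ t) := by
        rw [← integral_sub i1 i2]
        refine integral_congr_ae (Eventually.of_forall fun t => ?_)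
        simp only [hw]
        ring
      rw [this, a1, a2]
      ring
    have a4 : ∫ t in Ioi (0 : ℝ), w t * (k t - m * k₀ t)
        = (∫ t in Ioi (0 : ℝ), w t * k t) - m * c := by
      rw [hcdef, ← integral_const_mul, ← integral_sub (hwi k hk hkc) ((hwi k₀ hk₀ hc₀).const_mul m)]
      refine integral_congr_ae (Eventually.of_forall fun t => ?_)
      simp only
      ring
    have a5 : ∫ t in Ioi (0 : ℝ), k t • (w t - c) = (∫ t in Ioi (0 : ℝ), w t * k t) - m * c := by
      have ik : IntegrableOn (fun t => k t * c) (Ioi 0) :=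
        ((hk.continuous.integrable_of_hasCompactSupport hkc).mul_const c).integrableOn
      rw [← hki, ← integral_mul_const, ← integral_sub (hwi k hk hkc) ik]
      refine integral_congr_ae (Eventually.of_forall fun t => ?_)
      simp only [smul_eq_mul]
      ring
    rw [a5, ← a4, a3]
  have hloc : LocallyIntegrableOn (fun t => w t - c) (Ioi 0) volume := by
    have h1 : LocallyIntegrableOn v (Ioi 0) volume := by
      exact fun x _ => (hv.locallyIntegrable (by norm_num)).locallyIntegrableOn (Ioi 0) x ‹_› |>.elim
        fun U hU => ⟨U ∩ Ioi 0, inter_mem hU.1 self_mem_nhdsWithin, by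
          have := hU.2
          rwa [IntegrableOn, Measure.restrict_restrict' measurableSet_Ioi] at this⟩
    refine (h1.sub ?_).sub ((locallyIntegrable_const c).locallyIntegrableOn _)
    exact (hP.continuousOn.mono Ioi_subset_Ici_self).locallyIntegrableOn measurableSet_Ioi
  have := isOpen_Ioi.ae_eq_zero_of_integral_contDiff_smul_eq_zero hloc fun k hk hkc hks => by
    rw [← key k hk hkc hks]
    symm
    refine setIntegral_eq_integral_of_forall_compl_eq_zero fun t ht => ?_
    rw [image_eq_zero_of_notMem_tsupport fun h' => ht (hks h'), zero_smul]
  rw [ae_restrict_iff' measurableSet_Ioi]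
  filter_upwards [this] with t ht ht0
  have := ht ht0
  simp only [hw] at this
  linarith

/-- If Green's formula holds up to the boundary, the constant is the boundary value. -/
theorem ae_eq_primitive_of_trace {v g : ℝ → ℝ} {v₀ : ℝ}
    (hv : MemLp v 2 (volume.restrict (Ioi 0))) (hg : MemLp g 2 (volume.restrict (Ioi 0)))
    (h : ∀ f : ℝ → ℝ, ContDiff ℝ ∞ f → HasCompactSupport f →
      ∫ t in Ioi (0 : ℝ), v t * deriv f t = -(∫ t in Ioi (0 : ℝ), g t * f t) - v₀ * f 0) :
    ∀ᵐ t ∂(volume.restrict (Ioi (0 : ℝ))), v t = v₀ + ∫ x in (0 : ℝ)..t, g x := by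
  obtain ⟨c, hc⟩ := exists_ae_eq_primitive hv hg fun f hf hfc hfs => by
    have h0 : f 0 = 0 := image_eq_zero_of_notMem_tsupport fun h' => lt_irrefl (0 : ℝ) (hfs h')
    rw [h f hf hfc, h0]
    ring
  -- A test function equal to `1` at the end point sees the boundary term and identifies the
  -- constant `c` with `v₀`.
  let b : ContDiffBump (0 : ℝ) := ⟨1, 2, by norm_num, by norm_num⟩
  have hb1 := h b b.contDiff b.hasCompactSupport
  have hb2 := integral_primitive_mul_deriv hg b.contDiff b.hasCompactSupport c
  have hb0 : b 0 = 1 := b.one_of_mem_closedBall (by simp [b.rIn_pos.le])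
  rw [hb0] at hb1 hb2
  have : ∫ t in Ioi (0 : ℝ), v t * deriv b t
      = ∫ t in Ioi (0 : ℝ), (c + ∫ x in (0 : ℝ)..t, g x) * deriv b t := by
    refine integral_congr_ae ?_
    filter_upwards [hc] with t ht
    rw [ht]
  have hcv : c = v₀ := by linarith
  rwa [hcv] at hc

/-! ### The one-dimensional quadratic form -/

theorem integral_Ioi_congr {E : Type*} [NormedAddCommGroup E] [NormedSpace ℝ E] {f g : ℝ → E}
    (h : ∀ t, 0 < t → f t = g t) :
    ∫ t in Ioi (0 : ℝ), f t = ∫ t in Ioi (0 : ℝ), g t :=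
  setIntegral_congr_fun measurableSet_Ioi fun t ht => h t ht

theorem memLp_robinF_mul {lam ξ : ℝ} (hlam : lam < 1) {a : ℝ → ℝ}
    (ha : MemLp a 2 (volume.restrict (Ioi 0)))
    (hta : MemLp (fun t => (t - ξ) * a t) 2 (volume.restrict (Ioi 0))) :
    MemLp (fun t => robinF lam (t - ξ) * a t) 2 (volume.restrict (Ioi 0)) := by
  obtain ⟨C, hC, hb⟩ := exists_abs_robinF_le hlam (-ξ)
  have hcont : Continuous fun t => robinF lam (t - ξ) :=
    (continuous_robinF hlam).comp (continuous_id.sub continuous_const)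
  have h1 : MemLp (fun t => |(t - ξ) * a t| + C * |a t|) 2 (volume.restrict (Ioi 0)) :=
    hta.abs.add (ha.abs.const_mul C)
  refine h1.mono' (hcont.aestronglyMeasurable.mul ha.1) ?_
  filter_upwards [ae_restrict_mem measurableSet_Ioi] with t ht
  rw [Real.norm_eq_abs, abs_mul, abs_mul, ← add_mul]
  have := hb (t - ξ) (by have : (0 : ℝ) < t := ht; linarith)
  gcongr

/-- By the Riccati equation, `(F a²)' = ((t-ξ)² - lam - F²) a² + 2 F a g` with `F = robinF lam (t -
ξ)`. Hence `(g - F a)²` equals `g² + (t-ξ)² a² - lam a²` minus this derivative, whose integral is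
the boundary value `-F(-ξ) a₀²`. -/
theorem integral_sq_sub_robinF_mul {lam ξ a₀ : ℝ} (hlam : lam < 1) {a g : ℝ → ℝ}
    (ha : MemLp a 2 (volume.restrict (Ioi 0))) (hg : MemLp g 2 (volume.restrict (Ioi 0)))
    (hta : MemLp (fun t => (t - ξ) * a t) 2 (volume.restrict (Ioi 0)))
    (hprim : ∀ᵐ t ∂(volume.restrict (Ioi (0 : ℝ))), a t = a₀ + ∫ x in (0 : ℝ)..t, g x) :
    ∫ t in Ioi (0 : ℝ), (g t - robinF lam (t - ξ) * a t) ^ 2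
      = (∫ t in Ioi (0 : ℝ), g t ^ 2) + (∫ t in Ioi (0 : ℝ), ((t - ξ) * a t) ^ 2)
        - lam * (∫ t in Ioi (0 : ℝ), a t ^ 2) + robinF lam (-ξ) * a₀ ^ 2 := by
  have hA := IsPrimitive.of_integral (fun T hT => intervalIntegrable_zero_of_memLp hg hT) a₀
  set A : ℝ → ℝ := fun t => a₀ + ∫ x in (0 : ℝ)..t, g x with hAdef
  have hF : IsPrimitive (fun t => robinF lam (t - ξ))
      (fun t => (t - ξ) ^ 2 - lam - robinF lam (t - ξ) ^ 2) := by
    refine IsPrimitive.of_hasDerivAt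
      (fun t => (hasDerivAt_robinF hlam (t - ξ)).comp_sub_const t ξ) ?_
    have hcont : Continuous fun t => robinF lam (t - ξ) :=
      (continuous_robinF hlam).comp (continuous_id.sub continuous_const)
    fun_prop
  have hfa := memLp_robinF_mul hlam ha hta
  have hP := (hF.mul hA).mul hA
  have i1 : IntegrableOn (fun t => ((t - ξ) * a t) ^ 2) (Ioi 0) := hta.integrable_sq
  have i2 : IntegrableOn (fun t => a t ^ 2) (Ioi 0) := ha.integrable_sq
  have i3 : IntegrableOn (fun t => (robinF lam (t - ξ) * a t) ^ 2) (Ioi 0) := hfa.integrable_sq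
  have i4 : IntegrableOn (fun t => robinF lam (t - ξ) * a t * g t) (Ioi 0) :=
    hfa.integrable_mul (q := 2) hg
  have i5 : IntegrableOn (fun t => robinF lam (t - ξ) * a t * a t) (Ioi 0) :=
    hfa.integrable_mul (q := 2) ha
  have i6 : IntegrableOn (fun t => g t ^ 2) (Ioi 0) := hg.integrable_sq
  have i7 : IntegrableOn (fun t => (g t - robinF lam (t - ξ) * a t) ^ 2) (Ioi 0) :=
    (hg.sub hfa).integrable_sq
  have ip : IntegrableOn (fun t => ((((t - ξ) ^ 2 - lam - robinF lam (t - ξ) ^ 2) * A t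
      + robinF lam (t - ξ) * g t) * A t + robinF lam (t - ξ) * A t * g t)) (Ioi 0) := by
    refine (((i1.sub (i2.const_mul lam)).sub i3).add (i4.const_mul 2)).congr ?_
    filter_upwards [hprim] with t ht
    rw [← hAdef] at *
    simp only [Pi.add_apply, Pi.sub_apply, ht]
    ring
  have iP : IntegrableOn (fun t => robinF lam (t - ξ) * A t * A t) (Ioi 0) := by
    refine i5.congr ?_
    filter_upwards [hprim] with t ht
    rw [ht]
  have key := hP.integral_Ioi_eq ip iP
  have hA0 : A 0 = a₀ := by simp [hAdef]
  rw [hA0, zero_sub] at key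
  have e1 : ∫ t in Ioi (0 : ℝ), ((g t ^ 2 + ((t - ξ) * a t) ^ 2) - lam * a t ^ 2)
      = (∫ t in Ioi (0 : ℝ), g t ^ 2) + (∫ t in Ioi (0 : ℝ), ((t - ξ) * a t) ^ 2)
        - lam * (∫ t in Ioi (0 : ℝ), a t ^ 2) := by
    have i61 : IntegrableOn (fun t => g t ^ 2 + ((t - ξ) * a t) ^ 2) (Ioi 0) := i6.add i1
    rw [integral_sub i61 (i2.const_mul lam), integral_add i6 i1, integral_const_mul]
  have i61' : IntegrableOn (fun t => ((g t ^ 2 + ((t - ξ) * a t) ^ 2) - lam * a t ^ 2)) (Ioi 0) :=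
    (i6.add i1).sub (i2.const_mul lam)
  rw [← e1]
  have e2 : ∫ t in Ioi (0 : ℝ), (g t - robinF lam (t - ξ) * a t) ^ 2
      = ∫ t in Ioi (0 : ℝ), (((g t ^ 2 + ((t - ξ) * a t) ^ 2) - lam * a t ^ 2)
        - ((((t - ξ) ^ 2 - lam - robinF lam (t - ξ) ^ 2) * A t
      + robinF lam (t - ξ) * g t) * A t + robinF lam (t - ξ) * A t * g t)) := by
    refine integral_congr_ae ?_
    filter_upwards [hprim] with t ht
    rw [ht]
    ring
  rw [e2, integral_sub i61' ip, key]
  ring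

theorem memLp_re {v : ℝ → ℂ} {μ : Measure ℝ} (hv : MemLp v 2 μ) : MemLp (fun t => (v t).re) 2 μ :=
  hv.re

theorem memLp_im {v : ℝ → ℂ} {μ : Measure ℝ} (hv : MemLp v 2 μ) : MemLp (fun t => (v t).im) 2 μ :=
  hv.im

theorem integral_norm_sq_eq_re_add_im {v : ℝ → ℂ} {μ : Measure ℝ} (hv : MemLp v 2 μ) :
    ∫ t, ‖v t‖ ^ 2 ∂μ = (∫ t, (v t).re ^ 2 ∂μ) + ∫ t, (v t).im ^ 2 ∂μ := by
  rw [← integral_add (memLp_re hv).integrable_sq (memLp_im hv).integrable_sq]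
  refine integral_congr_ae (Eventually.of_forall fun t => ?_)
  simp only [Complex.sq_norm, Complex.normSq_apply]
  ring

theorem re_im_primitive {v g : ℝ → ℂ} {c : ℂ} (hg : MemLp g 2 (volume.restrict (Ioi 0))) {t : ℝ}
    (ht : 0 < t) (h : v t = c + ∫ x in (0 : ℝ)..t, g x) :
    (v t).re = c.re + (∫ x in (0 : ℝ)..t, (g x).re) ∧
      (v t).im = c.im + ∫ x in (0 : ℝ)..t, (g x).im := by
  have hi := intervalIntegrable_zero_of_memLp hg ht.le
  have h1 := Complex.reCLM.intervalIntegral_comp_comm hi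
  have h2 := Complex.imCLM.intervalIntegral_comp_comm hi
  simp only [Complex.reCLM_apply, Complex.imCLM_apply] at h1 h2
  rw [h, h1, h2]
  exact ⟨Complex.add_re _ _, Complex.add_im _ _⟩

/-- The ground state representation of the one-dimensional quadratic form. -/
theorem integral_norm_sq_sub_robinF_mul {lam ξ : ℝ} (hlam : lam < 1) {v g : ℝ → ℂ} {v₀ : ℂ}
    (hv : MemLp v 2 (volume.restrict (Ioi 0))) (hg : MemLp g 2 (volume.restrict (Ioi 0)))
    (htv : MemLp (fun t : ℝ => ((t : ℂ) - ξ) * v t) 2 (volume.restrict (Ioi 0)))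
    (hprim : ∀ᵐ t ∂(volume.restrict (Ioi (0 : ℝ))), v t = v₀ + ∫ x in (0 : ℝ)..t, g x) :
    MemLp (fun t => g t - robinF lam (t - ξ) * v t) 2 (volume.restrict (Ioi 0)) ∧
    ∫ t in Ioi (0 : ℝ), ‖g t - robinF lam (t - ξ) * v t‖ ^ 2
      = (∫ t in Ioi (0 : ℝ), ‖g t‖ ^ 2) + (∫ t in Ioi (0 : ℝ), ‖((t : ℂ) - ξ) * v t‖ ^ 2)
        - lam * (∫ t in Ioi (0 : ℝ), ‖v t‖ ^ 2) + robinF lam (-ξ) * ‖v₀‖ ^ 2 := by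
  have hre : ∀ t : ℝ, (((t : ℂ) - ξ) * v t).re = (t - ξ) * (v t).re := fun t => by
    rw [← Complex.ofReal_sub, Complex.re_ofReal_mul]
  have him : ∀ t : ℝ, (((t : ℂ) - ξ) * v t).im = (t - ξ) * (v t).im := fun t => by
    rw [← Complex.ofReal_sub, Complex.im_ofReal_mul]
  have htre := memLp_re htv
  have htim := memLp_im htv
  simp only [hre] at htre
  simp only [him] at htim
  have hFre := memLp_robinF_mul hlam (memLp_re hv) htre
  have hFim := memLp_robinF_mul hlam (memLp_im hv) htim
  have hFv : MemLp (fun t : ℝ => (robinF lam (t - ξ) : ℂ) * v t) 2 (volume.restrict (Ioi 0)) := by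
    refine memLp_re_im_iff.mp ⟨?_, ?_⟩
    · convert hFre using 2 with t
      exact Complex.re_ofReal_mul _ _
    · convert hFim using 2 with t
      exact Complex.im_ofReal_mul _ _
  have hsub := hg.sub hFv
  refine ⟨hsub, ?_⟩
  have hp : ∀ᵐ t ∂(volume.restrict (Ioi (0 : ℝ))),
      (v t).re = v₀.re + (∫ x in (0 : ℝ)..t, (g x).re) ∧
      (v t).im = v₀.im + ∫ x in (0 : ℝ)..t, (g x).im := by
    filter_upwards [hprim, ae_restrict_mem measurableSet_Ioi] with t ht ht0
    exact re_im_primitive hg ht0 ht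
  have k1 := integral_sq_sub_robinF_mul hlam (memLp_re hv) (memLp_re hg) htre (hp.mono fun t h => h.1)
  have k2 := integral_sq_sub_robinF_mul hlam (memLp_im hv) (memLp_im hg) htim (hp.mono fun t h => h.2)
  have e := integral_norm_sq_eq_re_add_im hsub
  simp only [Pi.sub_apply, Complex.sub_re, Complex.sub_im, Complex.re_ofReal_mul,
    Complex.im_ofReal_mul] at e
  rw [e, k1, k2, integral_norm_sq_eq_re_add_im hg, integral_norm_sq_eq_re_add_im hv,
    integral_norm_sq_eq_re_add_im htv]
  simp only [hre, him]
  rw [Complex.sq_norm v₀, Complex.normSq_apply]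
  ring

theorem weak_re_im {v g : ℝ → ℂ} {v₀ : ℂ} {f : ℝ → ℝ}
    (hv : MemLp v 2 (volume.restrict (Ioi 0))) (hg : MemLp g 2 (volume.restrict (Ioi 0)))
    (hf : ContDiff ℝ ∞ f) (hc : HasCompactSupport f)
    (h : ∫ t in Ioi (0 : ℝ), v t * (deriv f t : ℝ)
      = -(∫ t in Ioi (0 : ℝ), g t * (f t : ℝ)) - v₀ * (f 0 : ℝ)) :
    (∫ t in Ioi (0 : ℝ), (v t).re * deriv f t
      = -(∫ t in Ioi (0 : ℝ), (g t).re * f t) - v₀.re * f 0) ∧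
    (∫ t in Ioi (0 : ℝ), (v t).im * deriv f t
      = -(∫ t in Ioi (0 : ℝ), (g t).im * f t) - v₀.im * f 0) := by
  have hf' : Continuous (deriv f) := hf.continuous_deriv (by simp)
  have m1 : MemLp (fun t : ℝ => ((deriv f t : ℝ) : ℂ)) 2 (volume.restrict (Ioi 0)) :=
    ((hf'.memLp_of_hasCompactSupport hc.deriv).restrict _).ofReal
  have m2 : MemLp (fun t => (f t : ℂ)) 2 (volume.restrict (Ioi 0)) :=
    ((hf.continuous.memLp_of_hasCompactSupport hc).restrict _).ofReal
  have i1 : IntegrableOn (fun t => v t * (deriv f t : ℝ)) (Ioi 0) := hv.integrable_mul (q := 2) m1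
  have i2 : IntegrableOn (fun t => g t * (f t : ℝ)) (Ioi 0) := hg.integrable_mul (q := 2) m2
  have a1 := Complex.reCLM.integral_comp_comm i1
  have a2 := Complex.reCLM.integral_comp_comm i2
  have b1 := Complex.imCLM.integral_comp_comm i1
  have b2 := Complex.imCLM.integral_comp_comm i2
  simp only [Complex.reCLM_apply, Complex.imCLM_apply, Complex.re_mul_ofReal,
    Complex.im_mul_ofReal] at a1 a2 b1 b2
  rw [a1, a2, b1, b2, h]
  simp

theorem primitive_of_re_im {v g : ℝ → ℂ} {c : ℂ} (hg : MemLp g 2 (volume.restrict (Ioi 0)))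
    (h1 : ∀ᵐ t ∂(volume.restrict (Ioi (0 : ℝ))), (v t).re = c.re + ∫ x in (0 : ℝ)..t, (g x).re)
    (h2 : ∀ᵐ t ∂(volume.restrict (Ioi (0 : ℝ))), (v t).im = c.im + ∫ x in (0 : ℝ)..t, (g x).im) :
    ∀ᵐ t ∂(volume.restrict (Ioi (0 : ℝ))), v t = c + ∫ x in (0 : ℝ)..t, g x := by
  filter_upwards [h1, h2, ae_restrict_mem measurableSet_Ioi] with t h1 h2 ht
  have := re_im_primitive (v := fun t => c + ∫ x in (0 : ℝ)..t, g x) (c := c) hg ht rfl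
  apply Complex.ext
  · rw [h1, this.1]
  · rw [h2, this.2]

theorem complex_ae_eq_primitive_of_trace {v g : ℝ → ℂ} {v₀ : ℂ}
    (hv : MemLp v 2 (volume.restrict (Ioi 0))) (hg : MemLp g 2 (volume.restrict (Ioi 0)))
    (h : ∀ f : ℝ → ℝ, ContDiff ℝ ∞ f → HasCompactSupport f →
      ∫ t in Ioi (0 : ℝ), v t * (deriv f t : ℝ)
        = -(∫ t in Ioi (0 : ℝ), g t * (f t : ℝ)) - v₀ * (f 0 : ℝ)) :
    ∀ᵐ t ∂(volume.restrict (Ioi (0 : ℝ))), v t = v₀ + ∫ x in (0 : ℝ)..t, g x :=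
  primitive_of_re_im hg
    (ae_eq_primitive_of_trace (memLp_re hv) (memLp_re hg) fun f hf hc =>
      (weak_re_im hv hg hf hc (h f hf hc)).1)
    (ae_eq_primitive_of_trace (memLp_im hv) (memLp_im hg) fun f hf hc =>
      (weak_re_im hv hg hf hc (h f hf hc)).2)

theorem eqOn_Ici_of_ae_eq {E : Type*} [TopologicalSpace E] [T2Space E] {f g : ℝ → E}
    (h : f =ᵐ[volume.restrict (Ioi 0)] g) (hf : ContinuousOn f (Ici 0))
    (hg : ContinuousOn g (Ici 0)) : EqOn f g (Ici 0) := by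
  refine Measure.eqOn_of_ae_eq (μ := volume) ?_ hf hg ?_
  · rwa [← Measure.restrict_congr_set Ioi_ae_eq_Ici]
  · rw [interior_Ici, closure_Ioi]

/-- Functions with a continuous representative and a weak derivative are primitives. -/
theorem HasWeakDeriv.eqOn_primitive {v g : ℝ → ℂ} (h : HasWeakDeriv v g)
    (hv : MemLp v 2 (volume.restrict (Ioi 0))) (hg : MemLp g 2 (volume.restrict (Ioi 0)))
    (hcont : ContinuousOn v (Ici 0)) :
    EqOn v (fun t => v 0 + ∫ x in (0 : ℝ)..t, g x) (Ici 0) := by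
  have hw : ∀ f : ℝ → ℝ, ContDiff ℝ ∞ f → HasCompactSupport f → tsupport f ⊆ Ioi 0 →
      (∫ t in Ioi (0 : ℝ), (v t).re * deriv f t = -∫ t in Ioi (0 : ℝ), (g t).re * f t) ∧
      (∫ t in Ioi (0 : ℝ), (v t).im * deriv f t = -∫ t in Ioi (0 : ℝ), (g t).im * f t) := by
    intro f hf hc hs
    have := h (fun t => (f t : ℂ)) (Complex.ofRealCLM.contDiff.comp hf)
      (hc.comp_left (g := fun x : ℝ => (x : ℂ)) Complex.ofReal_zero)
      ((tsupport_comp_subset (g := fun x : ℝ => (x : ℂ)) Complex.ofReal_zero f).trans hs)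
    have hd : ∀ t, deriv (fun t => (f t : ℂ)) t = (deriv f t : ℝ) := fun t =>
      ((hf.differentiable (by simp) t).hasDerivAt.ofReal_comp).deriv
    simp only [hd] at this
    have := weak_re_im (v₀ := 0) hv hg hf hc (by rw [this]; simp)
    simpa using this
  obtain ⟨c1, h1⟩ := exists_ae_eq_primitive (memLp_re hv) (memLp_re hg)
    fun f hf hc hs => (hw f hf hc hs).1
  obtain ⟨c2, h2⟩ := exists_ae_eq_primitive (memLp_im hv) (memLp_im hg)
    fun f hf hc hs => (hw f hf hc hs).2
  have hae := primitive_of_re_im (v := v) (c := ⟨c1, c2⟩) hg h1 h2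
  have hpc : ContinuousOn (fun t => (⟨c1, c2⟩ : ℂ) + ∫ x in (0 : ℝ)..t, g x) (Ici 0) := by
    refine continuousOn_const.add fun t ht => ?_
    have hi := intervalIntegrable_zero_of_memLp hg (T := t + 1) (by simp only [mem_Ici] at ht; linarith)
    have := intervalIntegral.continuousOn_primitive_interval' hi (a := 0) (by simp)
    rw [uIcc_of_le (by simp only [mem_Ici] at ht; linarith)] at this
    refine (this t ⟨ht, by linarith⟩).mono_of_mem_nhdsWithin ?_
    have : Icc 0 (t + 1) = Ici 0 ∩ Iic (t + 1) := rfl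
    rw [this]
    exact inter_mem self_mem_nhdsWithin (mem_nhdsWithin_of_mem_nhds (Iic_mem_nhds (by linarith)))
  have heq := eqOn_Ici_of_ae_eq hae hcont hpc
  have h0 := heq (show (0 : ℝ) ∈ Ici 0 by simp)
  simp only [intervalIntegral.integral_same, add_zero] at h0
  rw [← h0] at heq
  exact heq

section

/-! ### Eigenfunctions of the half-line operators -/

theorem integral_sq_add_integral_mul {a b c : ℝ → ℝ} {a₀ b₀ : ℝ}
    (ha : MemLp a 2 (volume.restrict (Ioi 0))) (hb : MemLp b 2 (volume.restrict (Ioi 0)))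
    (hc : MemLp c 2 (volume.restrict (Ioi 0)))
    (hab : ∀ᵐ t ∂(volume.restrict (Ioi (0 : ℝ))), a t = a₀ + ∫ x in (0 : ℝ)..t, b x)
    (hbc : ∀ᵐ t ∂(volume.restrict (Ioi (0 : ℝ))), b t = b₀ + ∫ x in (0 : ℝ)..t, c x) :
    (∫ t in Ioi (0 : ℝ), b t ^ 2) + (∫ t in Ioi (0 : ℝ), a t * c t) = -(a₀ * b₀) := by
  have hA := IsPrimitive.of_integral (fun T hT => intervalIntegrable_zero_of_memLp hb hT) a₀
  have hB := IsPrimitive.of_integral (fun T hT => intervalIntegrable_zero_of_memLp hc hT) b₀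
  have i1 : IntegrableOn (fun t => b t ^ 2) (Ioi 0) := hb.integrable_sq
  have i2 : IntegrableOn (fun t => a t * c t) (Ioi 0) := ha.integrable_mul (q := 2) hc
  have i3 : IntegrableOn (fun t => a t * b t) (Ioi 0) := ha.integrable_mul (q := 2) hb
  have e : (fun t => b t ^ 2 + a t * c t) =ᵐ[volume.restrict (Ioi 0)]
      (fun t => b t * (b₀ + ∫ x in (0 : ℝ)..t, c x) + (a₀ + ∫ x in (0 : ℝ)..t, b x) * c t) := by
    filter_upwards [hab, hbc] with t h1 h2
    rw [← h1, ← h2]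
    ring
  have key := (hA.mul hB).integral_Ioi_eq ((i1.add i2).congr e) (i3.congr (by
    filter_upwards [hab, hbc] with t h1 h2
    rw [← h1, ← h2]))
  rw [← integral_add i1 i2, integral_congr_ae e, key]
  simp

theorem memLp_sub_mul {η : ℝ} {u : ℝ → ℂ} (hu : MemLp u 2 (volume.restrict (Ioi 0)))
    (htu : MemLp (fun t : ℝ => (t : ℂ) ^ 2 * u t) 2 (volume.restrict (Ioi 0))) :
    MemLp (fun t : ℝ => ((t : ℂ) - η) * u t) 2 (volume.restrict (Ioi 0)) := by
  have h1 : MemLp (fun t : ℝ => ‖(t : ℂ) ^ 2 * u t‖ + (1 + |η|) * ‖u t‖) 2 (volume.restrict (Ioi 0)) :=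
    htu.norm.add (hu.norm.const_mul _)
  refine h1.mono' ((by fun_prop : Continuous fun t : ℝ => (t : ℂ) - η).aestronglyMeasurable.mul hu.1) ?_
  refine Eventually.of_forall fun t => ?_
  rw [norm_mul, norm_mul, ← add_mul, norm_pow]
  gcongr
  calc ‖(t : ℂ) - η‖ ≤ ‖(t : ℂ)‖ + ‖(η : ℂ)‖ := norm_sub_le _ _
    _ ≤ _ := by
      rw [Complex.norm_real, Complex.norm_real, Real.norm_eq_abs, Real.norm_eq_abs]
      nlinarith [abs_nonneg t, sq_nonneg (|t| - 1)]

/-- Pair the eigenvalue equation with `u` and integrate by parts; the Robin condition turns the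
boundary term into `γ |u(0)|²`. The remaining clauses are the hypotheses of the ground state
representation. -/
theorem IsEigenfunction.exists_energy {γ η lam : ℝ} {u : ℝ → ℂ} (h : IsEigenfunction γ η lam u) :
    ∃ u₁ : ℝ → ℂ, ContinuousOn u₁ (Ici 0) ∧ ContinuousOn u (Ici 0) ∧
      MemLp u 2 (volume.restrict (Ioi 0)) ∧ MemLp u₁ 2 (volume.restrict (Ioi 0)) ∧
      MemLp (fun t : ℝ => ((t : ℂ) - η) * u t) 2 (volume.restrict (Ioi 0)) ∧
      EqOn u (fun t => u 0 + ∫ x in (0 : ℝ)..t, u₁ x) (Ici 0) ∧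
      (∫ t in Ioi (0 : ℝ), ‖u₁ t‖ ^ 2) + (∫ t in Ioi (0 : ℝ), ‖((t : ℂ) - η) * u t‖ ^ 2)
        = lam * (∫ t in Ioi (0 : ℝ), ‖u t‖ ^ 2) - γ * ‖u 0‖ ^ 2 := by
  obtain ⟨u₁, u₂, ⟨hc, hc1, hu, hu1, hu2, ht2, hw1, hw2⟩, hbc, -, heq⟩ := h
  have htu := memLp_sub_mul (η := η) hu ht2
  have hp1 := hw1.eqOn_primitive hu hu1 hc
  have hp2 := hw2.eqOn_primitive hu1 hu2 hc1
  refine ⟨u₁, hc1, hc, hu, hu1, htu, hp1, ?_⟩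
  have e1 : ∀ᵐ t ∂(volume.restrict (Ioi (0 : ℝ))),
      (u t).re = (u 0).re + (∫ x in (0 : ℝ)..t, (u₁ x).re) ∧
      (u t).im = (u 0).im + ∫ x in (0 : ℝ)..t, (u₁ x).im := by
    filter_upwards [ae_restrict_mem measurableSet_Ioi] with t ht
    exact re_im_primitive hu1 ht (hp1 (Ioi_subset_Ici_self ht))
  have e2 : ∀ᵐ t ∂(volume.restrict (Ioi (0 : ℝ))),
      (u₁ t).re = (u₁ 0).re + (∫ x in (0 : ℝ)..t, (u₂ x).re) ∧
      (u₁ t).im = (u₁ 0).im + ∫ x in (0 : ℝ)..t, (u₂ x).im := by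
    filter_upwards [ae_restrict_mem measurableSet_Ioi] with t ht
    exact re_im_primitive hu2 ht (hp2 (Ioi_subset_Ici_self ht))
  have k1 := integral_sq_add_integral_mul (memLp_re hu) (memLp_re hu1) (memLp_re hu2)
    (e1.mono fun t h => h.1) (e2.mono fun t h => h.1)
  have k2 := integral_sq_add_integral_mul (memLp_im hu) (memLp_im hu1) (memLp_im hu2)
    (e1.mono fun t h => h.2) (e2.mono fun t h => h.2)
  have iu := hu.integrable_norm_pow (p := 2) (by norm_num)
  have itu := htu.integrable_norm_pow (p := 2) (by norm_num)
  have i1 : IntegrableOn (fun t => (u t).re * (u₂ t).re) (Ioi 0) :=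
    (memLp_re hu).integrable_mul (q := 2) (memLp_re hu2)
  have i2 : IntegrableOn (fun t => (u t).im * (u₂ t).im) (Ioi 0) :=
    (memLp_im hu).integrable_mul (q := 2) (memLp_im hu2)
  have k3 : (∫ t in Ioi (0 : ℝ), (u t).re * (u₂ t).re) + (∫ t in Ioi (0 : ℝ), (u t).im * (u₂ t).im)
      = (∫ t in Ioi (0 : ℝ), ‖((t : ℂ) - η) * u t‖ ^ 2) - lam * (∫ t in Ioi (0 : ℝ), ‖u t‖ ^ 2) := by
    rw [← integral_add i1 i2, ← integral_const_mul, ← integral_sub itu (iu.const_mul lam)]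
    refine integral_congr_ae ?_
    filter_upwards [heq] with t ht
    have : u₂ t = ((t - η) ^ 2 - lam : ℝ) * u t := by
      push_cast
      linear_combination -ht
    rw [this, Complex.re_ofReal_mul, Complex.im_ofReal_mul, norm_mul, mul_pow,
      ← Complex.ofReal_sub, Complex.norm_real, Real.norm_eq_abs, sq_abs, Complex.sq_norm,
      Complex.normSq_apply]
    ring
  rw [hbc] at k1 k2
  rw [Complex.re_ofReal_mul] at k1
  rw [Complex.im_ofReal_mul] at k2
  rw [integral_norm_sq_eq_re_add_im hu1, Complex.sq_norm (u 0), Complex.normSq_apply]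
  linarith

theorem integral_norm_sq_pos {α E : Type*} [MeasurableSpace α] [NormedAddCommGroup E]
    {μ : Measure α} {u : α → E} (hu : MemLp u 2 μ) (h : ¬ (u =ᵐ[μ] 0)) :
    0 < ∫ t, ‖u t‖ ^ 2 ∂μ := by
  refine lt_of_le_of_ne (integral_nonneg fun t => by positivity) fun h0 => h ?_
  have := (integral_eq_zero_iff_of_nonneg (fun t => by positivity)
    (hu.integrable_norm_pow (p := 2) (by norm_num))).mp h0.symm
  filter_upwards [this] with t ht
  simpa using ht

/-- A lower bound for the eigenvalues, from the ground state representation. -/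
theorem IsEigenfunction.le_eigenvalue {γ η lam lam' : ℝ} {u : ℝ → ℂ}
    (h : IsEigenfunction γ η lam' u) (hlam : lam < 1) (hF : robinF lam (-η) ≤ γ) : lam ≤ lam' := by
  obtain ⟨u₁, -, -, hu, hu1, htu, hp, he⟩ := h.exists_energy
  obtain ⟨-, -, -, -, hne, -⟩ := h
  have hpos := integral_norm_sq_pos hu hne
  have hid := (integral_norm_sq_sub_robinF_mul hlam hu hu1 htu (by
    filter_upwards [ae_restrict_mem measurableSet_Ioi] with t ht
    exact hp (Ioi_subset_Ici_self ht))).2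
  have h0 : 0 ≤ ∫ t in Ioi (0 : ℝ), ‖u₁ t - robinF lam (t - η) * u t‖ ^ 2 :=
    integral_nonneg fun t => by positivity
  have h1 : robinF lam (-η) * ‖u 0‖ ^ 2 ≤ γ * ‖u 0‖ ^ 2 := by gcongr
  -- The energy identity and the representation together give `0 ≤ (lam' - lam) ‖u‖²`.
  by_contra hn
  have : 0 < (lam - lam') * ∫ t in Ioi (0 : ℝ), ‖u t‖ ^ 2 := mul_pos (by linarith) hpos
  nlinarith

/-- In the case of equality, the eigenfunction is a multiple of the decaying solution. -/
theorem IsEigenfunction.eq_mul_decaySol {γ η lam : ℝ} {ψ : ℝ → ℝ}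
    (h : IsEigenfunction γ η lam (fun t => (ψ t : ℂ))) (hlam : lam < 1)
    (hF : robinF lam (-η) = γ) {t : ℝ} (ht : 0 ≤ t) :
    ψ t = ψ 0 / decaySol lam (-η) * decaySol lam (t - η) := by
  obtain ⟨u₁, hc1, hc, hu, hu1, htu, hp, he⟩ := h.exists_energy
  have hp' : ∀ᵐ t ∂(volume.restrict (Ioi (0 : ℝ))), (ψ t : ℂ) = ψ 0 + ∫ x in (0 : ℝ)..t, u₁ x := by
    filter_upwards [ae_restrict_mem measurableSet_Ioi] with t ht
    exact hp (Ioi_subset_Ici_self ht)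
  obtain ⟨hm, hid⟩ := integral_norm_sq_sub_robinF_mul hlam hu hu1 htu hp'
  -- At equality the square vanishes, so `ψ' = F ψ`, and `decaySol` solves the same first-order
  -- equation. The quotient of the two therefore has derivative zero almost everywhere and, being
  -- absolutely continuous, is constant.
  have h0 : ∫ t in Ioi (0 : ℝ), ‖u₁ t - robinF lam (t - η) * ψ t‖ ^ 2 = 0 := by
    rw [hid, he, hF]
    ring
  have hae : ∀ᵐ t ∂(volume.restrict (Ioi (0 : ℝ))), u₁ t - robinF lam (t - η) * ψ t = 0 := by
    by_contra hne
    have := integral_norm_sq_pos hm hne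
    linarith
  have hA := IsPrimitive.of_integral
    (fun T hT => intervalIntegrable_zero_of_memLp (memLp_re hu1) hT) (ψ 0)
  have hAeq : ∀ t, 0 ≤ t → ψ 0 + ∫ x in (0 : ℝ)..t, (u₁ x).re = ψ t := by
    intro t ht
    rcases ht.eq_or_lt with rfl | ht
    · simp
    · have := (re_im_primitive (v := fun t => (ψ t : ℂ)) hu1 ht (hp ht.le)).1
      simpa using this.symm
  have hDpos : ∀ t, decaySol lam (t - η) ≠ 0 := fun t => (decaySol_pos hlam _).ne'
  have hD : ∀ t, HasDerivAt (fun t => decaySol lam (t - η)) (decaySolDeriv lam (t - η)) t :=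
    fun t => (hasDerivAt_decaySol hlam (t - η)).comp_sub_const t η
  have hD' : ∀ t, HasDerivAt (fun t => decaySolDeriv lam (t - η))
      (((t - η) ^ 2 - lam) * decaySol lam (t - η)) t :=
    fun t => (hasDerivAt_decaySolDeriv hlam (t - η)).comp_sub_const t η
  have hDc : Continuous fun t => decaySol lam (t - η) :=
    continuous_iff_continuousAt.mpr fun t => (hD t).continuousAt
  have hDc' : Continuous fun t => decaySolDeriv lam (t - η) :=
    continuous_iff_continuousAt.mpr fun t => (hD' t).continuousAt
  have hQ : IsPrimitive (fun t => (decaySol lam (t - η))⁻¹)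
      (fun t => -decaySolDeriv lam (t - η) / decaySol lam (t - η) ^ 2) :=
    IsPrimitive.of_hasDerivAt (fun t => (hD t).fun_inv (hDpos t))
      (hDc'.neg.div (hDc.pow 2) fun t => pow_ne_zero 2 (hDpos t))
  have key := (hA.mul hQ).integral_eq_sub ht
  rw [intervalIntegral.integral_zero_ae] at key
  · simp only [intervalIntegral.integral_same, add_zero, hAeq t ht, zero_sub] at key
    have h1 := hDpos t
    have h2 := hDpos 0
    rw [zero_sub] at h2
    field_simp at key ⊢
    linarith
  · rw [ae_restrict_iff' measurableSet_Ioi] at hae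
    filter_upwards [hae] with x hx hxm
    rw [uIoc_of_le ht] at hxm
    have hx' := congrArg Complex.re (hx hxm.1)
    rw [Complex.sub_re, Complex.re_ofReal_mul, Complex.ofReal_re, Complex.zero_re] at hx'
    rw [hAeq x hxm.1.le, ← robinF_mul hlam]
    have h1 := hDpos x
    have : (u₁ x).re = robinF lam (x - η) * ψ x := by linarith
    rw [this]
    field_simp
    ring

/-! ### Decaying solutions as eigenfunctions, and the normalized ground state. -/

theorem integrableOn_sq_of_tendsto {f : ℝ → ℝ} (hf : Continuous f)
    (h : Tendsto (fun s => s ^ 1 * f s) atTop (𝓝 0)) (a : ℝ) : IntegrableOn (fun s => f s ^ 2) (Ioi a) := by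
  have h1 : LocallyIntegrableOn (fun s => f s ^ 2) (Ici a) volume :=
    (hf.pow 2).locallyIntegrable.locallyIntegrableOn _
  have h2 : (fun s => f s ^ 2) =O[atTop] (fun s : ℝ => s ^ (-2 : ℝ)) := by
    refine Asymptotics.IsBigO.of_bound 1 ?_
    have h3 := h.abs.eventually (gt_mem_nhds (show |(0 : ℝ)| < 1 by simp))
    filter_upwards [h3, eventually_gt_atTop 0] with s hs hs0
    rw [Real.norm_of_nonneg (sq_nonneg _), Real.norm_of_nonneg (Real.rpow_nonneg hs0.le _), one_mul,
      Real.rpow_neg hs0.le, Real.rpow_two, ← one_div, le_div_iff₀ (by positivity)]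
    rw [pow_one] at hs
    calc f s ^ 2 * s ^ 2 = |s * f s| ^ 2 := by rw [sq_abs]; ring
      _ ≤ 1 := pow_le_one₀ (abs_nonneg _) hs.le
  exact (h1.integrableOn_of_isBigO_atTop h2
    (integrableAtFilter_rpow_atTop_iff.mpr (by norm_num))).mono_set Ioi_subset_Ici_self

theorem memLp_of_tendsto {f : ℝ → ℝ} (hf : Continuous f)
    (h : Tendsto (fun s => s ^ 1 * f s) atTop (𝓝 0)) (a : ℝ) : MemLp f 2 (volume.restrict (Ioi a)) :=
  (memLp_two_iff_integrable_sq hf.aestronglyMeasurable).mpr (integrableOn_sq_of_tendsto hf h a)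

theorem integral_Ioi_mul_deriv_test {u u' f : ℝ → ℂ} (hu : ∀ t, HasDerivAt u (u' t) t)
    (hu' : Continuous u') (hf : ContDiff ℝ ∞ f) (hc : HasCompactSupport f) :
    ∫ t in Ioi (0 : ℝ), u t * deriv f t = -(∫ t in Ioi (0 : ℝ), u' t * f t) - u 0 * f 0 := by
  have huc : Continuous u := continuous_iff_continuousAt.mpr fun t => (hu t).continuousAt
  have hf' : Continuous (deriv f) := hf.continuous_deriv (by simp)
  have i1 : Integrable (u * deriv f) :=
    (huc.mul hf').integrable_of_hasCompactSupport hc.deriv.mul_left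
  have i2 : Integrable (u' * f) := (hu'.mul hf.continuous).integrable_of_hasCompactSupport hc.mul_left
  have hz : Tendsto (u * f) atTop (𝓝 0) := by
    have : HasCompactSupport (u * f) := hc.mul_left
    exact this.is_zero_at_infty.mono_left atTop_le_cocompact
  have := integral_Ioi_mul_deriv_eq_deriv_mul (a := (0 : ℝ)) (u := u) (v := f) (u' := u')
    (v' := deriv f) (a' := u 0 * f 0) (fun t _ => hu t)
    (fun t _ => (hf.differentiable (by simp) t).hasDerivAt)
    i1.integrableOn i2.integrableOn ((huc.mul hf.continuous).continuousAt.tendsto.mono_left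
      nhdsWithin_le_nhds) hz
  rw [this]
  ring

/-- A rapidly decaying solution of `u'' = (s² - lam) u`. -/
structure IsDecayingSol (lam : ℝ) (U V : ℝ → ℝ) : Prop where
  hasDerivAt_fst : ∀ s, HasDerivAt U (V s) s
  hasDerivAt_snd : ∀ s, HasDerivAt V ((s ^ 2 - lam) * U s) s
  tendsto_fst : ∀ k : ℕ, Tendsto (fun s => s ^ k * U s) atTop (𝓝 0)
  tendsto_snd : ∀ k : ℕ, Tendsto (fun s => s ^ k * V s) atTop (𝓝 0)

namespace IsDecayingSol

variable {lam : ℝ} {U V : ℝ → ℝ}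

theorem continuous_fst (h : IsDecayingSol lam U V) : Continuous U :=
  continuous_iff_continuousAt.mpr fun s => (h.hasDerivAt_fst s).continuousAt

theorem continuous_snd (h : IsDecayingSol lam U V) : Continuous V :=
  continuous_iff_continuousAt.mpr fun s => (h.hasDerivAt_snd s).continuousAt

theorem memLp_comp_sub {f : ℝ → ℝ} {a : ℝ} (h : MemLp f 2 (volume.restrict (Ioi (-a)))) :
    MemLp (fun t => f (t - a)) 2 (volume.restrict (Ioi 0)) := by
  have hm := (measurePreserving_sub_right volume a).restrict_preimage (s := Ioi (-a)) measurableSet_Ioi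
  have : (fun x => x - a) ⁻¹' Ioi (-a) = Ioi 0 := by
    ext x
    simp
  rw [this] at hm
  exact h.comp_measurePreserving hm

theorem memLp_pow_mul (h : IsDecayingSol lam U V) (k : ℕ) (a : ℝ) :
    MemLp (fun s => s ^ k * U s) 2 (volume.restrict (Ioi a)) := by
  refine memLp_of_tendsto ((continuous_pow k).mul h.continuous_fst) ?_ a
  refine (h.tendsto_fst (k + 1)).congr fun s => ?_
  simp only [Pi.mul_apply]
  ring

theorem isEigenfunction (h : IsDecayingSol lam U V) {γ η : ℝ} (hbc : V (-η) = γ * U (-η))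
    (hne : ∃ s, -η < s ∧ U s ≠ 0) : IsEigenfunction γ η lam (fun t => (U (t - η) : ℂ)) := by
  have hU : ∀ t, HasDerivAt (fun t => (U (t - η) : ℂ)) (V (t - η) : ℂ) t := fun t =>
    ((h.hasDerivAt_fst (t - η)).comp_sub_const t η).ofReal_comp
  have hV : ∀ t, HasDerivAt (fun t => (V (t - η) : ℂ))
      ((((t - η) ^ 2 - lam) * U (t - η) : ℝ) : ℂ) t := fun t =>
    ((h.hasDerivAt_snd (t - η)).comp_sub_const t η).ofReal_comp
  have hUc : Continuous fun t => U (t - η) := h.continuous_fst.comp (continuous_id.sub continuous_const)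
  have hVc : Continuous fun t => V (t - η) := h.continuous_snd.comp (continuous_id.sub continuous_const)
  have hUcc : Continuous fun t => (U (t - η) : ℂ) := Complex.continuous_ofReal.comp hUc
  have hVcc : Continuous fun t => (V (t - η) : ℂ) := Complex.continuous_ofReal.comp hVc
  have hWcc : Continuous fun t : ℝ => ((((t - η) ^ 2 - lam) * U (t - η) : ℝ) : ℂ) :=
    Complex.continuous_ofReal.comp ((by fun_prop : Continuous fun t : ℝ => (t - η) ^ 2 - lam).mul hUc)
  have m0 := h.memLp_pow_mul 0 (-η)
  have m1 := h.memLp_pow_mul 1 (-η)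
  have m2 := h.memLp_pow_mul 2 (-η)
  have mU : MemLp (fun t => U (t - η)) 2 (volume.restrict (Ioi 0)) :=
    memLp_comp_sub (by simpa using m0)
  have mV : MemLp (fun t => V (t - η)) 2 (volume.restrict (Ioi 0)) :=
    memLp_comp_sub (memLp_of_tendsto h.continuous_snd (h.tendsto_snd 1) _)
  have mW : MemLp (fun t => ((t - η) ^ 2 - lam) * U (t - η)) 2 (volume.restrict (Ioi 0)) := by
    refine memLp_comp_sub (f := fun s => (s ^ 2 - lam) * U s) ((m2.sub (m0.const_mul lam)).congr_norm ?_ ?_)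
    · exact ((continuous_pow 2).sub continuous_const).mul h.continuous_fst |>.aestronglyMeasurable
    · refine Eventually.of_forall fun s => ?_
      simp only [Pi.sub_apply]
      congr 1
      ring
  have mT : MemLp (fun t => t ^ 2 * U (t - η)) 2 (volume.restrict (Ioi 0)) := by
    refine (memLp_comp_sub (f := fun s => (s + η) ^ 2 * U s) (a := η)
      (((m2.add (m1.const_mul (2 * η))).add (m0.const_mul (η ^ 2))).congr_norm ?_ ?_)).congr_norm ?_ ?_
    · exact ((continuous_id.add continuous_const).pow 2).mul h.continuous_fst |>.aestronglyMeasurable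
    · refine Eventually.of_forall fun s => ?_
      simp only [Pi.add_apply]
      congr 1
      ring
    · exact ((continuous_pow 2).mul hUc).aestronglyMeasurable
    · refine Eventually.of_forall fun s => ?_
      simp
  refine ⟨fun t => (V (t - η) : ℂ), fun t => ((((t - η) ^ 2 - lam) * U (t - η) : ℝ) : ℂ),
    ⟨hUcc.continuousOn, hVcc.continuousOn, mU.ofReal, mV.ofReal, mW.ofReal, ?_, ?_, ?_⟩, ?_, ?_, ?_⟩
  · convert mT.ofReal (K := ℂ) using 2 with t
    simp
  · intro f hf hc hs
    rw [integral_Ioi_mul_deriv_test hU hVcc hf hc,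
      image_eq_zero_of_notMem_tsupport fun h' => lt_irrefl (0 : ℝ) (hs h')]
    simp
  · intro f hf hc hs
    rw [integral_Ioi_mul_deriv_test hV hWcc hf hc,
      image_eq_zero_of_notMem_tsupport fun h' => lt_irrefl (0 : ℝ) (hs h')]
    simp
  · simp only [zero_sub, hbc]
    push_cast
    rfl
  · intro h0
    obtain ⟨s, hs, hs0⟩ := hne
    have := eqOn_Ici_of_ae_eq h0 hUcc.continuousOn continuousOn_const
      (show s + η ∈ Ici 0 by simp only [mem_Ici]; linarith)
    simp only [add_sub_cancel_right, Pi.zero_apply, Complex.ofReal_eq_zero] at this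
    exact hs0 this
  · refine Eventually.of_forall fun t => ?_
    push_cast
    ring

end IsDecayingSol

theorem isDecayingSol_decaySol {lam : ℝ} (h : lam < 1) :
    IsDecayingSol lam (decaySol lam) (decaySolDeriv lam) :=
  ⟨hasDerivAt_decaySol h, hasDerivAt_decaySolDeriv h, tendsto_pow_mul_decaySol h,
    tendsto_pow_mul_decaySolDeriv h⟩

/-- The squared norm of the decaying solution on `(s, ∞)`. -/
noncomputable def tailNorm (lam s : ℝ) : ℝ := ∫ t in Ioi (0 : ℝ), decaySol lam (t + s) ^ 2

theorem integrableOn_decaySol_sq {lam : ℝ} (h : lam < 1) (s : ℝ) :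
    IntegrableOn (fun t => decaySol lam (t + s) ^ 2) (Ioi 0) := by
  have m0 := (isDecayingSol_decaySol h).memLp_pow_mul 0 s
  have := IsDecayingSol.memLp_comp_sub (f := decaySol lam) (a := -s) (by simpa using m0)
  simpa [IntegrableOn] using this.integrable_sq

theorem tailNorm_pos {lam : ℝ} (h : lam < 1) (s : ℝ) : 0 < tailNorm lam s := by
  rw [tailNorm, setIntegral_pos_iff_support_of_nonneg_ae (Eventually.of_forall fun t => sq_nonneg _)
    (integrableOn_decaySol_sq h s)]
  have : (Function.support fun t => decaySol lam (t + s) ^ 2) = univ :=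
    eq_univ_of_forall fun t => pow_ne_zero 2 (decaySol_pos h _).ne'
  simp [this]

/-- The normalized ground state of `H[γ, ξ(γ)]`. -/
noncomputable def groundState (γ t : ℝ) : ℝ :=
  decaySol (groundEnergy γ) (t - optimalXi γ) /
    Real.sqrt (tailNorm (groundEnergy γ) (-optimalXi γ))

theorem sqrt_tailNorm_pos (γ : ℝ) :
    0 < Real.sqrt (tailNorm (groundEnergy γ) (-optimalXi γ)) :=
  Real.sqrt_pos.mpr (tailNorm_pos (groundEnergy_lt_one γ) _)

theorem groundState_pos (γ t : ℝ) : 0 < groundState γ t :=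
  div_pos (decaySol_pos (groundEnergy_lt_one γ) _) (sqrt_tailNorm_pos γ)

/-- The derivative of the ground state. -/
noncomputable def groundStateDeriv (γ t : ℝ) : ℝ :=
  decaySolDeriv (groundEnergy γ) (t - optimalXi γ) /
    Real.sqrt (tailNorm (groundEnergy γ) (-optimalXi γ))

theorem IsDecayingSol.div_const {lam : ℝ} {U V : ℝ → ℝ} (h : IsDecayingSol lam U V) (c : ℝ) :
    IsDecayingSol lam (fun s => U s / c) (fun s => V s / c) where
  hasDerivAt_fst s := (h.hasDerivAt_fst s).div_const c
  hasDerivAt_snd s := by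
    convert! (h.hasDerivAt_snd s).div_const c using 1
    ring
  tendsto_fst k := by
    have := (h.tendsto_fst k).div_const c
    rw [zero_div] at this
    refine this.congr fun s => ?_
    ring
  tendsto_snd k := by
    have := (h.tendsto_snd k).div_const c
    rw [zero_div] at this
    refine this.congr fun s => ?_
    ring

theorem groundStateDeriv_zero (γ : ℝ) : groundStateDeriv γ 0 = γ * groundState γ 0 := by
  have h := robinF_mul (groundEnergy_lt_one γ) (-optimalXi γ)
  rw [robinF_neg_optimalXi] at h
  rw [groundStateDeriv, groundState, zero_sub, ← h]
  ring

theorem integral_groundState_sq (γ : ℝ) : ∫ t in Ioi (0 : ℝ), groundState γ t ^ 2 = 1 := by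
  simp only [groundState, div_pow]
  rw [integral_div, Real.sq_sqrt (tailNorm_pos (groundEnergy_lt_one γ) _).le]
  simp only [sub_eq_add_neg]
  exact div_self (tailNorm_pos (groundEnergy_lt_one γ) _).ne'

theorem isPositiveNormalizedEigenfunction_groundState (γ : ℝ) :
    IsPositiveNormalizedEigenfunction γ (optimalXi γ) (groundEnergy γ) (groundState γ) := by
  refine ⟨?_, fun t _ => groundState_pos γ t, ?_⟩
  · refine ((isDecayingSol_decaySol (groundEnergy_lt_one γ)).div_const
      (Real.sqrt (tailNorm (groundEnergy γ) (-optimalXi γ)))).isEigenfunction ?_ ?_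
    · have := groundStateDeriv_zero γ
      simpa [groundStateDeriv, groundState] using this
    · exact ⟨-optimalXi γ + 1, by linarith,
        (div_pos (decaySol_pos (groundEnergy_lt_one γ) _) (sqrt_tailNorm_pos γ)).ne'⟩
  · simp only [sq_abs]
    exact integral_groundState_sq γ

theorem IsPositiveNormalizedEigenfunction.eqOn_groundState {γ : ℝ} {ψ : ℝ → ℝ}
    (h : IsPositiveNormalizedEigenfunction γ (optimalXi γ) (groundEnergy γ) ψ) :
    EqOn ψ (groundState γ) (Ici 0) := by
  obtain ⟨he, hpos, hnorm⟩ := h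
  have hl := groundEnergy_lt_one γ
  have key := fun t (ht : 0 ≤ t) => he.eq_mul_decaySol hl (robinF_neg_optimalXi γ) ht
  set c := ψ 0 / decaySol (groundEnergy γ) (-optimalXi γ) with hc
  set N := tailNorm (groundEnergy γ) (-optimalXi γ) with hN
  have hNpos : 0 < N := tailNorm_pos hl _
  have hc0 : 0 < c := by
    have h1 := hpos 1 one_pos
    rw [key 1 zero_le_one] at h1
    exact pos_of_mul_pos_left h1 (decaySol_pos hl _).le
  have hcN : c ^ 2 * N = 1 := by
    rw [← hnorm, hN, tailNorm, ← integral_const_mul]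
    refine integral_Ioi_congr fun t ht => ?_
    rw [sq_abs, key t ht.le, mul_pow, sub_eq_add_neg]
  have hcs : c = 1 / Real.sqrt N := by
    rw [eq_div_iff (Real.sqrt_pos.mpr hNpos).ne']
    have : (c * Real.sqrt N) ^ 2 = 1 := by rw [mul_pow, Real.sq_sqrt hNpos.le, hcN]
    nlinarith [mul_pos hc0 (Real.sqrt_pos.mpr hNpos)]
  intro t ht
  rw [key t ht, hcs, groundState, ← hN]
  ring

end

section

/-! ### Existence of eigenvalues -/

/-- A continuous family of decaying solutions, positive at infinity, for the energies below `L`. -/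
structure IsDecayingFamily (L : ℝ) (U V : ℝ → ℝ → ℝ) : Prop where
  sol : ∀ lam < L, IsDecayingSol lam (U lam) (V lam)
  continuousOn_fst : ContinuousOn (fun z : ℝ × ℝ => U z.1 z.2) (Iio L ×ˢ univ)
  continuousOn_snd : ContinuousOn (fun z : ℝ × ℝ => V z.1 z.2) (Iio L ×ˢ univ)
  pos : ∀ lam < L, ∀ s, 0 < s → lam ≤ s ^ 2 → 0 < U lam s

theorem isDecayingFamily_decaySol : IsDecayingFamily 1 decaySol decaySolDeriv :=
  ⟨fun _ h => isDecayingSol_decaySol h, continuousOn_decaySol, continuousOn_decaySolDeriv,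
    fun _ h s _ _ => decaySol_pos h s⟩

theorem continuousOn_comp_sub_two {f : ℝ → ℝ → ℝ} {L : ℝ}
    (h : ContinuousOn (fun z : ℝ × ℝ => f z.1 z.2) (Iio L ×ˢ univ)) :
    ContinuousOn (fun z : ℝ × ℝ => f (z.1 - 2) z.2) (Iio (L + 2) ×ˢ univ) := by
  refine h.comp (f := fun z : ℝ × ℝ => (z.1 - 2, z.2)) (by fun_prop) ?_
  rintro ⟨l, s⟩ ⟨hl, -⟩
  simp only [mem_Iio] at hl
  exact ⟨by simp only [mem_Iio]; linarith, mem_univ _⟩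

/-- The creation operator raises the energy by two. -/
theorem IsDecayingFamily.creation {L : ℝ} {U V : ℝ → ℝ → ℝ} (h : IsDecayingFamily L U V) :
    IsDecayingFamily (L + 2) (fun lam s => s * U (lam - 2) s - V (lam - 2) s)
      (fun lam s => s * V (lam - 2) s + (lam - 1 - s ^ 2) * U (lam - 2) s) where
  sol lam hl := by
    have hs := h.sol (lam - 2) (by linarith)
    refine ⟨fun s => ?_, fun s => ?_, fun k => ?_, fun k => ?_⟩
    · convert! ((hasDerivAt_id s).mul (hs.hasDerivAt_fst s)).sub (hs.hasDerivAt_snd s) using 1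
      simp only [id]
      ring
    · convert! ((hasDerivAt_id s).mul (hs.hasDerivAt_snd s)).add
        (((hasDerivAt_pow 2 s).const_sub (lam - 1)).mul (hs.hasDerivAt_fst s)) using 1
      simp only [id]
      push_cast
      ring
    · have := (hs.tendsto_fst (k + 1)).sub (hs.tendsto_snd k)
      rw [sub_zero] at this
      refine this.congr fun s => ?_
      ring
    · have := ((hs.tendsto_snd (k + 1)).add ((hs.tendsto_fst k).const_mul (lam - 1))).sub
        (hs.tendsto_fst (k + 2))
      simp only [mul_zero, add_zero, sub_zero] at this
      refine this.congr fun s => ?_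
      ring
  continuousOn_fst := (ContinuousOn.mul (by fun_prop) (continuousOn_comp_sub_two h.continuousOn_fst)).sub
    (continuousOn_comp_sub_two h.continuousOn_snd)
  continuousOn_snd := (ContinuousOn.mul (by fun_prop) (continuousOn_comp_sub_two h.continuousOn_snd)).add
    (ContinuousOn.mul (by fun_prop) (continuousOn_comp_sub_two h.continuousOn_fst))
  pos lam hl s hs hls := by
    have hsol := h.sol (lam - 2) (by linarith)
    have hU : ∀ t, s ≤ t → 0 < U (lam - 2) t := fun t ht =>
      h.pos (lam - 2) (by linarith) t (by linarith) (by nlinarith)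
    -- Since `t² ≥ lam > lam - 2` for `t ≥ s`, the solution is positive and strictly convex there.
    -- Its derivative increases to its limit `0`, hence is negative.
    have hV : V (lam - 2) s < 0 := by
      have ht := hsol.tendsto_snd 0
      simp only [pow_zero, one_mul] at ht
      refine neg_of_strictMonoOn_of_tendsto_zero (a := s) ?_ ht le_rfl
      refine strictMonoOn_of_deriv_pos (convex_Ici s) hsol.continuous_snd.continuousOn fun t ht => ?_
      rw [interior_Ici, mem_Ioi] at ht
      rw [(hsol.hasDerivAt_snd t).deriv]
      exact mul_pos (by nlinarith) (hU t ht.le)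
    have := mul_pos hs (hU s le_rfl)
    linarith

theorem exists_isDecayingFamily (n : ℕ) : ∃ U V, IsDecayingFamily (2 * n + 1) U V := by
  induction n with
  | zero => exact ⟨_, _, by simpa using isDecayingFamily_decaySol⟩
  | succ n ih =>
    obtain ⟨U, V, h⟩ := ih
    have := h.creation
    rw [show (2 * (n : ℝ) + 1 + 2) = 2 * ((n + 1 : ℕ) : ℝ) + 1 by push_cast; ring] at this
    exact ⟨_, _, this⟩

namespace IsDecayingFamily

variable {L : ℝ} {U V : ℝ → ℝ → ℝ}

theorem exists_ne_zero (h : IsDecayingFamily L U V) {lam : ℝ} (hl : lam < L) (s : ℝ) :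
    ∃ t, s < t ∧ 0 < U lam t := by
  refine ⟨|s| + |lam| + 1, ?_, h.pos lam hl _ (by positivity) ?_⟩
  · linarith [le_abs_self s, abs_nonneg lam]
  · have := le_abs_self lam
    nlinarith [abs_nonneg s, abs_nonneg lam]

/-- Uniqueness for the linear equation, by a Gronwall weight: for large `C` the function `e^{-Cx}
(U² + V²)` is nonincreasing on `[s, t]`. A common zero of `U` and `V` at `s` would force `U` to
vanish at `t`, where it is positive. -/
theorem snd_ne_zero (h : IsDecayingFamily L U V) {lam : ℝ} (hl : lam < L) {s : ℝ}
    (hU : U lam s = 0) : V lam s ≠ 0 := by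
  intro hV
  have hsol := h.sol lam hl
  obtain ⟨t, hst, ht⟩ := h.exists_ne_zero hl s
  set C := 1 + (|s| + |t|) ^ 2 + |lam| with hC
  have hd : ∀ x, HasDerivAt (fun x => Real.exp (-C * x) * (U lam x ^ 2 + V lam x ^ 2))
      (Real.exp (-C * x) * (2 * (U lam x * V lam x) * (1 + x ^ 2 - lam)
        - C * (U lam x ^ 2 + V lam x ^ 2))) x := by
    intro x
    have h1 : HasDerivAt (fun x => Real.exp (-C * x)) (Real.exp (-C * x) * (-C)) x := by
      have := ((hasDerivAt_id x).const_mul (-C)).exp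
      simpa using this
    convert! h1.mul (((hsol.hasDerivAt_fst x).pow 2).add ((hsol.hasDerivAt_snd x).pow 2)) using 1
    simp only [Pi.add_apply, Pi.pow_apply]
    push_cast
    ring
  have hanti : AntitoneOn (fun x => Real.exp (-C * x) * (U lam x ^ 2 + V lam x ^ 2)) (Icc s t) := by
    refine antitoneOn_of_deriv_nonpos (convex_Icc s t)
      (fun x _ => (hd x).continuousAt.continuousWithinAt)
      (fun x _ => (hd x).differentiableAt.differentiableWithinAt) fun x hx => ?_
    rw [interior_Icc] at hx
    rw [(hd x).deriv]
    refine mul_nonpos_of_nonneg_of_nonpos (Real.exp_pos _).le ?_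
    have hx2 : x ^ 2 ≤ (|s| + |t|) ^ 2 := by
      apply sq_le_sq'
      · linarith [neg_abs_le s, abs_nonneg t, hx.1]
      · linarith [le_abs_self t, abs_nonneg s, hx.2]
    have h1 : |1 + x ^ 2 - lam| ≤ C := by
      rw [abs_le]
      constructor <;> linarith [le_abs_self lam, neg_abs_le lam, sq_nonneg x]
    have h2 : 2 * (U lam x * V lam x) * (1 + x ^ 2 - lam)
        ≤ |2 * (U lam x * V lam x)| * |1 + x ^ 2 - lam| := by
      rw [← abs_mul]
      exact le_abs_self _
    have h3 : |2 * (U lam x * V lam x)| ≤ U lam x ^ 2 + V lam x ^ 2 := by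
      rw [abs_le]
      constructor <;> nlinarith [sq_nonneg (U lam x + V lam x), sq_nonneg (U lam x - V lam x)]
    have h4 := mul_le_mul h3 h1 (abs_nonneg _) (by positivity)
    linarith
  have := hanti (left_mem_Icc.mpr hst.le) (right_mem_Icc.mpr hst.le) hst.le
  simp only [hU, hV] at this
  have h5 : 0 < Real.exp (-C * t) * (U lam t ^ 2 + V lam t ^ 2) := by positivity
  norm_num at this
  norm_num at h5
  linarith

/-- For `lam ≤ 0` the product `U V` has derivative `V² + (x² - lam) U² ≥ 0` and tends to `0`, so `U
V ≤ 0` and `U²` is nonincreasing. A zero of `U` would then persist to the right, against positivity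
far out. -/
theorem fst_pos_of_nonpos (h : IsDecayingFamily L U V) {lam : ℝ} (hl : lam < L) (h0 : lam ≤ 0)
    (s : ℝ) : 0 < U lam s := by
  have hsol := h.sol lam hl
  have hmul : ∀ x, U lam x * V lam x ≤ 0 := by
    intro x
    have hmono : Monotone (fun x => U lam x * V lam x) := by
      refine monotone_of_deriv_nonneg
        (fun x => ((hsol.hasDerivAt_fst x).mul (hsol.hasDerivAt_snd x)).differentiableAt) fun x => ?_
      rw [((hsol.hasDerivAt_fst x).fun_mul (hsol.hasDerivAt_snd x)).deriv]
      nlinarith [sq_nonneg (V lam x), mul_nonneg (show 0 ≤ x ^ 2 - lam by nlinarith) (sq_nonneg (U lam x))]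
    have ht := (hsol.tendsto_fst 0).mul (hsol.tendsto_snd 0)
    simp only [pow_zero, one_mul, mul_zero] at ht
    exact hmono.ge_of_tendsto ht x
  have hanti : Antitone (fun x => U lam x ^ 2) := by
    refine antitone_of_deriv_nonpos (fun x => ((hsol.hasDerivAt_fst x).pow 2).differentiableAt)
      fun x => ?_
    have : deriv (fun x => U lam x ^ 2) x = 2 * (U lam x * V lam x) := by
      rw [((hsol.hasDerivAt_fst x).fun_pow 2).deriv]
      push_cast
      ring
    rw [this]
    linarith [hmul x]
  obtain ⟨t, hst, ht⟩ := h.exists_ne_zero hl s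
  by_contra hn
  obtain ⟨x, hx, hx0⟩ := intermediate_value_Icc hst.le hsol.continuous_fst.continuousOn
    (show (0 : ℝ) ∈ Icc (U lam s) (U lam t) from ⟨not_lt.mp hn, ht.le⟩)
  have := hanti hx.2
  simp only [hx0] at this
  nlinarith

/-- Sturm comparison with `sin (π (x - s))`. If `U` were positive on `[s, s + 1]`, the Wronskian
would be nonincreasing because `lam ≥ x² + π²` there, yet it goes from `-π U(s) < 0` to `π U(s + 1)
> 0`. -/
theorem exists_nonpos (h : IsDecayingFamily L U V) {lam s : ℝ} (hl : lam < L)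
    (hs : (|s| + 1) ^ 2 + Real.pi ^ 2 ≤ lam) : ∃ t ∈ Icc s (s + 1), U lam t ≤ 0 := by
  by_contra! hn
  have hsol := h.sol lam hl
  have hsin : ∀ x, HasDerivAt (fun x => Real.sin (Real.pi * (x - s)))
      (Real.cos (Real.pi * (x - s)) * Real.pi) x := fun x => by
    have := (((hasDerivAt_id x).sub_const s).const_mul Real.pi).sin
    simpa using this
  have hcos : ∀ x, HasDerivAt (fun x => Real.cos (Real.pi * (x - s)))
      (-Real.sin (Real.pi * (x - s)) * Real.pi) x := fun x => by
    have := (((hasDerivAt_id x).sub_const s).const_mul Real.pi).cos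
    simpa using this
  have hd : ∀ x, HasDerivAt (fun x => V lam x * Real.sin (Real.pi * (x - s))
      - Real.pi * (U lam x * Real.cos (Real.pi * (x - s))))
      ((x ^ 2 - lam + Real.pi ^ 2) * (U lam x * Real.sin (Real.pi * (x - s)))) x := by
    intro x
    convert! ((hsol.hasDerivAt_snd x).mul (hsin x)).sub
      (((hsol.hasDerivAt_fst x).mul (hcos x)).const_mul Real.pi) using 1
    ring
  have hanti : AntitoneOn (fun x => V lam x * Real.sin (Real.pi * (x - s))
      - Real.pi * (U lam x * Real.cos (Real.pi * (x - s)))) (Icc s (s + 1)) := by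
    refine antitoneOn_of_deriv_nonpos (convex_Icc _ _)
      (fun x _ => (hd x).continuousAt.continuousWithinAt)
      (fun x _ => (hd x).differentiableAt.differentiableWithinAt) fun x hx => ?_
    rw [interior_Icc] at hx
    rw [(hd x).deriv]
    have hx2 : x ^ 2 ≤ (|s| + 1) ^ 2 := by
      apply sq_le_sq'
      · linarith [neg_abs_le s, hx.1]
      · linarith [le_abs_self s, hx.2]
    have hsn : 0 ≤ Real.sin (Real.pi * (x - s)) := by
      apply Real.sin_nonneg_of_nonneg_of_le_pi
      · exact mul_nonneg Real.pi_pos.le (by linarith [hx.1])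
      · nlinarith [Real.pi_pos, hx.2]
    exact mul_nonpos_of_nonpos_of_nonneg (by linarith)
      (mul_nonneg (hn x ⟨hx.1.le, hx.2.le⟩).le hsn)
  have key := hanti (left_mem_Icc.mpr (by linarith)) (right_mem_Icc.mpr (by linarith))
    (by linarith : s ≤ s + 1)
  have h1 := hn s ⟨le_rfl, by linarith⟩
  have h2 := hn (s + 1) ⟨by linarith, le_rfl⟩
  simp only [sub_self, add_sub_cancel_left, mul_zero, mul_one, Real.sin_zero, Real.cos_zero,
    Real.sin_pi, Real.cos_pi] at key
  nlinarith [Real.pi_pos]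

/-- At energy `-c²` the function `e^{-cx} (V + c U)` has derivative `e^{-cx} x² U ≥ 0` and limit
`0`, so it is nonpositive. This fixes the sign of `V - γ U` at low energy in the shooting argument.
-/
theorem snd_lt (h : IsDecayingFamily L U V) {c s : ℝ} (hc : 0 ≤ c) (hl : -c ^ 2 < L) :
    V (-c ^ 2) s ≤ -c * U (-c ^ 2) s := by
  have hsol := h.sol _ hl
  have hd : ∀ x, HasDerivAt (fun x => Real.exp (-c * x) * (V (-c ^ 2) x + c * U (-c ^ 2) x))
      (Real.exp (-c * x) * (x ^ 2 * U (-c ^ 2) x)) x := by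
    intro x
    have h1 : HasDerivAt (fun x => Real.exp (-c * x)) (Real.exp (-c * x) * (-c)) x := by
      have := ((hasDerivAt_id x).const_mul (-c)).exp
      simpa using this
    convert! h1.mul ((hsol.hasDerivAt_snd x).add ((hsol.hasDerivAt_fst x).const_mul c)) using 1
    simp only [Pi.add_apply]
    ring
  have hmono : Monotone (fun x => Real.exp (-c * x) * (V (-c ^ 2) x + c * U (-c ^ 2) x)) := by
    refine monotone_of_deriv_nonneg (fun x => (hd x).differentiableAt) fun x => ?_
    rw [(hd x).deriv]
    have := h.fst_pos_of_nonpos hl (by nlinarith) x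
    positivity
  have ht : Tendsto (fun x => Real.exp (-c * x) * (V (-c ^ 2) x + c * U (-c ^ 2) x)) atTop (𝓝 0) := by
    have h1 := (hsol.tendsto_snd 0).add ((hsol.tendsto_fst 0).const_mul c)
    simp only [pow_zero, one_mul, mul_zero, add_zero] at h1
    refine squeeze_zero_norm' ?_ (by simpa using h1.norm)
    filter_upwards [eventually_ge_atTop 0] with x hx
    rw [norm_mul, Real.norm_of_nonneg (Real.exp_pos _).le]
    refine mul_le_of_le_one_left (norm_nonneg _) (Real.exp_le_one_iff.mpr ?_)
    nlinarith
  have := hmono.ge_of_tendsto ht s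
  have := nonpos_of_mul_nonpos_right this (Real.exp_pos _)
  linarith

/-- At the lowest Dirichlet eigenvalue the derivative at the end point is positive. -/
theorem exists_dirichlet (h : IsDecayingFamily L U V) {s L₀ : ℝ} (hL₀ : L₀ < L)
    (hs : (|s| + 1) ^ 2 + Real.pi ^ 2 ≤ L₀) : ∃ lam, 0 ≤ lam ∧ lam < L ∧ U lam s = 0 ∧ 0 < V lam s := by
  -- Beyond `T` every solution with energy at most `L₀` is positive, and so is every solution of
  -- nonpositive energy. All relevant nonpositive values of `U` therefore lie over a compact set.
  set T := L₀ + 1 + |s| with hT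
  set S : Set (ℝ × ℝ) := (Icc 0 L₀ ×ˢ Icc s T) ∩ (fun z : ℝ × ℝ => U z.1 z.2) ⁻¹' Iic 0 with hS
  have hL1 : 1 ≤ L₀ := by nlinarith [abs_nonneg s, sq_nonneg Real.pi]
  have hScomp : IsCompact S := by
    refine (isCompact_Icc.prod isCompact_Icc).of_isClosed_subset ?_ inter_subset_left
    refine ContinuousOn.preimage_isClosed_of_isClosed ?_ (isClosed_Icc.prod isClosed_Icc) isClosed_Iic
    exact h.continuousOn_fst.mono fun z hz => ⟨lt_of_le_of_lt hz.1.2 hL₀, mem_univ _⟩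
  have hmem : ∀ lam t, lam ≤ L₀ → s ≤ t → U lam t ≤ 0 → (lam, t) ∈ S := by
    intro lam t hl hst hU
    refine ⟨⟨⟨?_, hl⟩, ⟨hst, ?_⟩⟩, hU⟩
    · by_contra hn
      linarith [h.fst_pos_of_nonpos (lt_of_le_of_lt hl hL₀) (not_le.mp hn).le t]
    · by_contra hn
      have ht : T < t := not_le.mp hn
      have := h.pos lam (lt_of_le_of_lt hl hL₀) t (by linarith [abs_nonneg s])
        (by nlinarith [abs_nonneg s])
      linarith
  obtain ⟨t₁, ht₁, hU₁⟩ := h.exists_nonpos hL₀ hs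
  have hne : S.Nonempty := ⟨_, hmem L₀ t₁ le_rfl ht₁.1 hU₁⟩
  -- At the least energy admitting a nonpositive value, continuity from below gives `U ≥ 0` on `[s,
  -- ∞)`. A zero in the interior would then be a double zero, which `snd_ne_zero` excludes, so the
  -- zero sits at `s`.
  obtain ⟨⟨lam, t⟩, hz, hmin⟩ := hScomp.exists_isMinOn hne continuous_fst.continuousOn
  have hlL₀ : lam ≤ L₀ := hz.1.1.2
  have hlL : lam < L := lt_of_le_of_lt hlL₀ hL₀
  have hst : s ≤ t := hz.1.2.1
  have hnonneg : ∀ x, s ≤ x → 0 ≤ U lam x := by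
    intro x hx
    have hc : ContinuousAt (fun l => U l x) lam :=
      (continuousOn_fst_of_uncurry h.continuousOn_fst x).continuousAt (Iio_mem_nhds hlL)
    refine ge_of_tendsto (hc.tendsto.mono_left (nhdsWithin_le_nhds (s := Iio lam))) ?_
    filter_upwards [self_mem_nhdsWithin] with l hl
    by_contra hn
    have hl' : l < lam := hl
    have := hmin (hmem l x (by linarith) hx (not_le.mp hn).le)
    simp only [mem_ofPred_eq] at this
    linarith
  have hU0 : U lam t = 0 := le_antisymm hz.2 (hnonneg t hst)
  have hV0 := h.snd_ne_zero hlL hU0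
  have hder := (h.sol lam hlL).hasDerivAt_fst t
  rcases hst.eq_or_lt with rfl | hlt
  · refine ⟨lam, hz.1.1.1, hlL, hU0, lt_of_le_of_ne ?_ hV0.symm⟩
    have := hasDerivAt_iff_tendsto_slope.mp hder
    have hsub : Ioi s ⊆ {s}ᶜ := fun x hx => ne_of_gt hx
    refine ge_of_tendsto (this.mono_left (nhdsWithin_mono s hsub)) ?_
    filter_upwards [self_mem_nhdsWithin] with x hx
    have hx' : s < x := hx
    rw [slope_def_field, hU0, sub_zero]
    exact div_nonneg (hnonneg x hx'.le) (by linarith)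
  · refine absurd (IsLocalMin.hasDerivAt_eq_zero ?_ hder) hV0
    filter_upwards [lt_mem_nhds hlt] with x hx
    rw [hU0]
    exact hnonneg x hx.le

end IsDecayingFamily

/-- `mu1` is an infimum of real numbers, with value `0` on the empty set, so nonemptiness is
essential. Shooting in the energy: at `s = -η` the quantity `V - γ U` is nonpositive at energy
`-(|γ| + 1)²` and positive at the Dirichlet energy, where `U = 0 < V`. The Dirichlet energy may
exceed `1`, hence the families built with the creation operator. -/
theorem exists_isEigenfunction (γ η : ℝ) : ∃ lam u, IsEigenfunction γ η lam u := by
  set s := -η with hs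
  set L₀ := (|s| + 1) ^ 2 + Real.pi ^ 2 with hL₀
  obtain ⟨n, hn⟩ := exists_nat_gt L₀
  have hL : L₀ < 2 * n + 1 := by
    have : (0 : ℝ) ≤ n := n.cast_nonneg
    linarith
  obtain ⟨U, V, h⟩ := exists_isDecayingFamily n
  obtain ⟨l₁, hl₁, hl₁L, hU, hV⟩ := h.exists_dirichlet hL le_rfl
  set c := |γ| + 1 with hc
  have hc0 : 0 ≤ c := by positivity
  have hl₀ : -c ^ 2 ≤ l₁ := by nlinarith
  have hl₀L : -c ^ 2 < 2 * n + 1 := lt_of_le_of_lt hl₀ hl₁L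
  have hlow : V (-c ^ 2) s - γ * U (-c ^ 2) s ≤ 0 := by
    have h1 := h.snd_lt (s := s) hc0 hl₀L
    have h2 := h.fst_pos_of_nonpos hl₀L (by nlinarith) s
    have h3 : 0 ≤ (γ + c) * U (-c ^ 2) s :=
      mul_nonneg (by linarith [neg_abs_le γ]) h2.le
    linarith
  have hup : 0 ≤ V l₁ s - γ * U l₁ s := by
    rw [hU]
    linarith
  have hcont : ContinuousOn (fun l => V l s - γ * U l s) (Icc (-c ^ 2) l₁) :=
    ((continuousOn_fst_of_uncurry h.continuousOn_snd s).sub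
      (continuousOn_const.mul (continuousOn_fst_of_uncurry h.continuousOn_fst s))).mono
      fun l hl => lt_of_le_of_lt hl.2 hl₁L
  obtain ⟨lam, hlam, h0⟩ := intermediate_value_Icc hl₀ hcont ⟨hlow, hup⟩
  have hlamL : lam < 2 * n + 1 := lt_of_le_of_lt hlam.2 hl₁L
  simp only at h0
  obtain ⟨t, ht, ht0⟩ := h.exists_ne_zero hlamL s
  exact ⟨lam, _, (h.sol lam hlamL).isEigenfunction (by rw [← hs]; linarith) ⟨t, ht, ht0.ne'⟩⟩

theorem mu1_ge {γ η lam : ℝ} (hlam : lam < 1) (hF : robinF lam (-η) ≤ γ) : lam ≤ mu1 γ η := by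
  obtain ⟨l, u, hu⟩ := exists_isEigenfunction γ η
  refine le_csInf ⟨l, u, hu⟩ ?_
  rintro l' ⟨u', hu'⟩
  exact hu'.le_eigenvalue hlam hF

theorem mu1_optimalXi (γ : ℝ) : mu1 γ (optimalXi γ) = groundEnergy γ := by
  refine le_antisymm (csInf_le ⟨groundEnergy γ, ?_⟩
    ⟨_, (isPositiveNormalizedEigenfunction_groundState γ).1⟩)
    (mu1_ge (groundEnergy_lt_one γ) (robinF_groundEnergy_le γ _))
  rintro l ⟨u, hu⟩
  exact hu.le_eigenvalue (groundEnergy_lt_one γ) (robinF_groundEnergy_le γ _)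

/-- For `η ≠ optimalXi γ` the inequality `robinF E (-η) < γ` is strict, so by continuity it survives
for an energy slightly above `E`, and that energy still bounds `mu1 γ η` from below. -/
theorem groundEnergy_lt_mu1 {γ η : ℝ} (h : η ≠ optimalXi γ) : groundEnergy γ < mu1 γ η := by
  have hE := groundEnergy_lt_one γ
  have hc : ContinuousAt (fun l => robinF l (-η)) (groundEnergy γ) :=
    (continuousOn_fst_of_uncurry continuousOn_uncurry_robinF (-η)).continuousAt (Iio_mem_nhds hE)
  have hev := (hc.eventually (gt_mem_nhds (robinF_lt_of_ne h))).and (gt_mem_nhds hE)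
  obtain ⟨l, hl, hgt⟩ := ((hev.filter_mono nhdsWithin_le_nhds).and
    (self_mem_nhdsWithin : Ioi (groundEnergy γ) ∈ 𝓝[>] groundEnergy γ)).exists
  exact lt_of_lt_of_le hgt (mu1_ge hl.2 hl.1.le)

theorem isMinimizer_iff (γ η : ℝ) : IsMinimizer γ η ↔ η = optimalXi γ := by
  constructor
  · intro h
    by_contra hne
    have h1 := h (optimalXi γ)
    rw [mu1_optimalXi] at h1
    linarith [groundEnergy_lt_mu1 hne]
  · rintro rfl η
    rw [mu1_optimalXi]
    exact mu1_ge (groundEnergy_lt_one γ) (robinF_groundEnergy_le γ _)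

end

/-! ### Differentiability of the ground state energy -/

theorem continuousOn_tailNorm :
    ContinuousOn (fun z : ℝ × ℝ => tailNorm z.1 z.2) (Iio 1 ×ˢ univ) := by
  rintro ⟨lam, s⟩ ⟨hl, -⟩
  apply ContinuousAt.continuousWithinAt
  simp only [mem_Iio] at hl
  set M := |s| + 1 with hM
  set B := hermiteInt (-(lam + 1) / 2) (-M) + 1 with hB
  have h1 : ∀ᶠ z : ℝ × ℝ in 𝓝 (lam, s), z.1 < 1 := continuousAt_fst.eventually (gt_mem_nhds hl)
  have h2 : ∀ᶠ z : ℝ × ℝ in 𝓝 (lam, s), |z.2| < M :=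
    (continuousAt_snd.abs).eventually (gt_mem_nhds (by simp [hM]))
  have h3 : ∀ᶠ z : ℝ × ℝ in 𝓝 (lam, s), hermiteInt (-(z.1 + 1) / 2) (-M) < B := by
    have hc : ContinuousAt (fun z : ℝ × ℝ => hermiteInt (-(z.1 + 1) / 2) (-M)) (lam, s) := by
      have hc0 : ContinuousAt (fun z : ℝ × ℝ => hermiteInt z.1 z.2) (-(lam + 1) / 2, -M) :=
        continuousOn_hermiteInt.continuousAt
          (prod_mem_nhds (Ioi_mem_nhds (by linarith)) univ_mem)
      exact ContinuousAt.comp (g := fun z : ℝ × ℝ => hermiteInt z.1 z.2) (x := (lam, s))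
        (f := fun z : ℝ × ℝ => (-(z.1 + 1) / 2, -M)) hc0 (by fun_prop)
    exact hc.eventually (gt_mem_nhds (by simp only; rw [hB]; linarith))
  refine continuousAt_of_dominated
    (bound := fun t => B ^ 2 * Real.exp (M ^ 2) * Real.exp (-(1 / 2) * t ^ 2)) ?_ ?_ ?_ ?_
  · filter_upwards [h1] with z hz
    have := (isDecayingSol_decaySol hz).continuous_fst
    exact ((this.comp (continuous_id.add continuous_const)).pow 2).aestronglyMeasurable
  · filter_upwards [h1, h2, h3] with z hz hz2 hz3
    filter_upwards [ae_restrict_mem measurableSet_Ioi] with t ht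
    have ht0 : 0 < t := ht
    rw [Real.norm_of_nonneg (sq_nonneg _), decaySol, mul_pow, ← Real.exp_nat_mul]
    have hb := (abs_lt.mp hz2)
    have hI : hermiteInt (-(z.1 + 1) / 2) (t + z.2) ≤ B :=
      ((hermiteInt_strictAnti (by linarith)).antitone (by linarith)).trans hz3.le
    have hI0 := hermiteInt_pos (p := -(z.1 + 1) / 2) (by linarith) (t + z.2)
    have hexp : Real.exp (((2 : ℕ) : ℝ) * (-(t + z.2) ^ 2 / 2))
        ≤ Real.exp (M ^ 2) * Real.exp (-(1 / 2) * t ^ 2) := by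
      rw [← Real.exp_add]
      apply Real.exp_le_exp.mpr
      push_cast
      have : z.2 ^ 2 ≤ M ^ 2 := sq_le_sq' hb.1.le hb.2.le
      nlinarith [sq_nonneg (t + 2 * z.2)]
    calc _ ≤ (Real.exp (M ^ 2) * Real.exp (-(1 / 2) * t ^ 2)) * B ^ 2 := by gcongr
      _ = _ := by ring
  · exact ((integrable_exp_neg_mul_sq (by norm_num)).const_mul _).integrableOn
  · refine Eventually.of_forall fun t => ?_
    have hc0 : ContinuousAt (fun z : ℝ × ℝ => decaySol z.1 z.2) (lam, t + s) :=
      continuousOn_decaySol.continuousAt (prod_mem_nhds (Iio_mem_nhds hl) univ_mem)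
    exact (ContinuousAt.comp (g := fun z : ℝ × ℝ => decaySol z.1 z.2) (x := (lam, s))
      (f := fun z : ℝ × ℝ => (z.1, t + z.2)) hc0 (by fun_prop)).pow 2

/-- The ground state for `γ` is a trial state for `γ'`: its Robin energy changes only by `(γ' - γ)
φ_γ(0)²`, and the representation at energy `groundEnergy γ'` bounds it below. That bound holds for
every `ξ`, so `optimalXi γ` may be kept. -/
theorem groundEnergy_le (γ γ' : ℝ) :
    groundEnergy γ' ≤ groundEnergy γ + (γ' - γ) * groundState γ 0 ^ 2 := by
  obtain ⟨he, -, hn⟩ := isPositiveNormalizedEigenfunction_groundState γ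
  obtain ⟨u₁, -, -, hu, hu1, htu, hp, hen⟩ := he.exists_energy
  have hid := (integral_norm_sq_sub_robinF_mul (groundEnergy_lt_one γ') hu hu1 htu (by
    filter_upwards [ae_restrict_mem measurableSet_Ioi] with t ht
    exact hp (Ioi_subset_Ici_self ht))).2
  have h0 : 0 ≤ ∫ t in Ioi (0 : ℝ),
      ‖u₁ t - robinF (groundEnergy γ') (t - optimalXi γ) * groundState γ t‖ ^ 2 :=
    integral_nonneg fun t => by positivity
  have hF : robinF (groundEnergy γ') (-optimalXi γ) * ‖(groundState γ 0 : ℂ)‖ ^ 2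
      ≤ γ' * ‖(groundState γ 0 : ℂ)‖ ^ 2 := by
    gcongr
    exact robinF_groundEnergy_le γ' _
  have hn' : ∫ t in Ioi (0 : ℝ), ‖(groundState γ t : ℂ)‖ ^ 2 = 1 := by
    simpa only [Complex.norm_real, Real.norm_eq_abs] using hn
  have hsq : ‖(groundState γ 0 : ℂ)‖ ^ 2 = groundState γ 0 ^ 2 := by
    rw [Complex.norm_real, Real.norm_eq_abs, sq_abs]
  rw [hn'] at hid hen
  rw [hsq] at hid hen hF
  linarith

theorem groundState_zero_sq_antitone : Antitone fun γ => groundState γ 0 ^ 2 := by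
  intro γ γ' h
  rcases h.eq_or_lt with rfl | h
  · exact le_rfl
  have h1 := groundEnergy_le γ γ'
  have h2 := groundEnergy_le γ' γ
  have : 0 ≤ (γ' - γ) * (groundState γ 0 ^ 2 - groundState γ' 0 ^ 2) := by linarith
  have := nonneg_of_mul_nonneg_right this (by linarith)
  simp only
  linarith

/-- The supergradients `groundState γ 0 ^ 2` decrease in `γ`. For `γ' > γ - 1` they are at most the
one at `γ - 1`, so `groundEnergy` is locally Lipschitz. -/
theorem continuous_groundEnergy : Continuous groundEnergy := by
  refine continuous_iff_continuousAt.mpr fun γ => ?_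
  rw [ContinuousAt, tendsto_iff_norm_sub_tendsto_zero]
  have hb : Tendsto (fun γ' => |γ' - γ| * groundState (γ - 1) 0 ^ 2) (𝓝 γ) (𝓝 0) := by
    have : Continuous fun γ' => |γ' - γ| * groundState (γ - 1) 0 ^ 2 := by fun_prop
    simpa using this.tendsto γ
  refine squeeze_zero' (Eventually.of_forall fun _ => norm_nonneg _) ?_ hb
  filter_upwards [lt_mem_nhds (show γ - 1 < γ by linarith)] with γ' hγ'
  have h1 := groundEnergy_le γ γ'
  have h2 := groundEnergy_le γ' γ
  have h3 := groundState_zero_sq_antitone hγ'.le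
  have h4 := groundState_zero_sq_antitone (show γ - 1 ≤ γ by linarith)
  simp only at h3 h4
  have p1 := sq_nonneg (groundState γ 0)
  have p2 := sq_nonneg (groundState γ' 0)
  rw [Real.norm_eq_abs, abs_le]
  rcases le_total γ γ' with h | h
  · rw [abs_of_nonneg (by linarith)]
    constructor <;> nlinarith
  · rw [abs_of_nonpos (by linarith)]
    constructor <;> nlinarith

theorem optimalXi_eq_sqrt (γ : ℝ) : optimalXi γ = Real.sqrt (groundEnergy γ + γ ^ 2) := by
  rw [← optimalXi_sq, Real.sqrt_sq (optimalXi_pos γ).le]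

theorem continuous_optimalXi : Continuous optimalXi := by
  rw [show optimalXi = fun γ => Real.sqrt (groundEnergy γ + γ ^ 2) from funext optimalXi_eq_sqrt]
  exact (continuous_groundEnergy.add (continuous_pow 2)).sqrt

theorem continuous_groundState_zero_sq : Continuous fun γ => groundState γ 0 ^ 2 := by
  have hm : Continuous fun γ => (groundEnergy γ, -optimalXi γ) :=
    continuous_groundEnergy.prodMk continuous_optimalXi.neg
  have h1 : Continuous fun γ => decaySol (groundEnergy γ) (-optimalXi γ) :=
    ContinuousOn.comp_continuous (g := fun z : ℝ × ℝ => decaySol z.1 z.2)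
      (f := fun γ => (groundEnergy γ, -optimalXi γ)) continuousOn_decaySol hm fun γ => ⟨groundEnergy_lt_one γ, mem_univ _⟩
  have h2 : Continuous fun γ => tailNorm (groundEnergy γ) (-optimalXi γ) :=
    ContinuousOn.comp_continuous (g := fun z : ℝ × ℝ => tailNorm z.1 z.2)
      (f := fun γ => (groundEnergy γ, -optimalXi γ)) continuousOn_tailNorm hm fun γ => ⟨groundEnergy_lt_one γ, mem_univ _⟩
  have h3 : Continuous fun γ => decaySol (groundEnergy γ) (-optimalXi γ) /
      Real.sqrt (tailNorm (groundEnergy γ) (-optimalXi γ)) :=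
    h1.div h2.sqrt fun γ => (sqrt_tailNorm_pos γ).ne'
  simp only [groundState, zero_sub]
  exact h3.pow 2

theorem hasDerivAt_groundEnergy (γ : ℝ) : HasDerivAt groundEnergy (groundState γ 0 ^ 2) γ := by
  rw [hasDerivAt_iff_isLittleO, Asymptotics.isLittleO_iff]
  intro c hc
  have := (continuous_groundState_zero_sq.tendsto γ).eventually (Metric.ball_mem_nhds _ hc)
  filter_upwards [this] with γ' hγ'
  rw [Real.dist_eq] at hγ'
  have h1 := groundEnergy_le γ γ'
  have h2 := groundEnergy_le γ' γ
  rw [Real.norm_eq_abs, Real.norm_eq_abs, smul_eq_mul]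
  -- The two supergradient inequalities place the remainder between `(γ' - γ) (φ_{γ'}(0)² -
  -- φ_γ(0)²)` and `0`.
  have h3 : |groundEnergy γ' - groundEnergy γ - (γ' - γ) * groundState γ 0 ^ 2|
      ≤ |(γ' - γ) * (groundState γ' 0 ^ 2 - groundState γ 0 ^ 2)| := by
    rw [abs_le]
    constructor
    · have := neg_abs_le ((γ' - γ) * (groundState γ' 0 ^ 2 - groundState γ 0 ^ 2))
      nlinarith
    · have := abs_nonneg ((γ' - γ) * (groundState γ' 0 ^ 2 - groundState γ 0 ^ 2))
      linarith
  refine h3.trans ?_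
  rw [abs_mul, mul_comm]
  gcongr

theorem contDiff_groundEnergy : ContDiff ℝ 1 groundEnergy := by
  rw [contDiff_one_iff_deriv]
  refine ⟨fun γ => (hasDerivAt_groundEnergy γ).differentiableAt, ?_⟩
  rw [show deriv groundEnergy = fun γ => groundState γ 0 ^ 2 from
    funext fun γ => (hasDerivAt_groundEnergy γ).deriv]
  exact continuous_groundState_zero_sq

section

/-! ### Plancherel's theorem and the partial Fourier transform -/

-- Both transforms have the same pairing with every test function: the `L²` transform through its
-- action on tempered distributions, the integral one by Fubini. Plancherel thereby applies to the
-- integral transform.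
open FourierTransform SchwartzMap in
theorem fourier_toLp_ae_eq {f : ℝ → ℂ} (hf : Integrable f) (hf2 : MemLp f 2) :
    (𝓕 (hf2.toLp f) : Lp ℂ 2 (volume : Measure ℝ)) =ᵐ[volume] 𝓕 f := by
  have hcont : Continuous (𝓕 f) := VectorFourier.fourierIntegral_continuous
    Real.continuous_fourierChar (by fun_prop) hf
  refine ae_eq_of_integral_contDiff_smul_eq
    ((Lp.memLp _).locallyIntegrable (by norm_num)) hcont.locallyIntegrable fun g hg hgc => ?_
  have hgC : ContDiff ℝ ∞ (fun x => (g x : ℂ)) := Complex.ofRealCLM.contDiff.comp hg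
  have hgcC : HasCompactSupport (fun x => (g x : ℂ)) :=
    hgc.comp_left (g := fun x : ℝ => (x : ℂ)) Complex.ofReal_zero
  set G : 𝓢(ℝ, ℂ) := hgcC.toSchwartzMap hgC with hG
  have hGx : ∀ x, G x = (g x : ℂ) := fun x => rfl
  have h1 := congrArg (fun T : 𝓢'(ℝ, ℂ) => T G)
    (MeasureTheory.Lp.fourier_toTemperedDistribution_eq (hf2.toLp f))
  simp only [TemperedDistribution.fourier_apply, Lp.toTemperedDistribution_apply, hGx] at h1
  have h2 : ∫ x, (𝓕 G) x • (hf2.toLp f) x = ∫ x, (𝓕 G) x • f x := by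
    refine integral_congr_ae ?_
    filter_upwards [hf2.coeFn_toLp] with x hx
    rw [hx]
  have h3 : ∫ x, (𝓕 G) x • f x = ∫ x, G x • 𝓕 f x := by
    have := VectorFourier.integral_fourierIntegral_smul_eq_flip (μ := volume) (ν := volume)
      (L := innerₗ ℝ) (f := G) (g := f) Real.continuous_fourierChar
      (by exact continuous_inner) G.integrable hf
    rw [flip_innerₗ] at this
    rw [SchwartzMap.fourier_coe]
    exact this
  simp only [hGx] at h3
  rw [h2, h3] at h1
  simpa only [Complex.real_smul, smul_eq_mul] using h1.symm

open FourierTransform in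
theorem memLp_fourier {f : ℝ → ℂ} (hf : Integrable f) (hf2 : MemLp f 2) : MemLp (𝓕 f) 2 :=
  (memLp_congr_ae (fourier_toLp_ae_eq hf hf2)).mp (Lp.memLp _)

theorem integral_norm_sq_eq_toLp_norm {f : ℝ → ℂ} (hf2 : MemLp f 2) :
    ∫ x, ‖f x‖ ^ 2 = ‖hf2.toLp f‖ ^ 2 := by
  have h1 := L2.inner_def (𝕜 := ℂ) (hf2.toLp f) (hf2.toLp f)
  rw [inner_self_eq_norm_sq_to_K] at h1
  have h2 : ∫ x, inner ℂ ((hf2.toLp f) x) ((hf2.toLp f) x) = ∫ x, ((‖f x‖ ^ 2 : ℝ) : ℂ) := by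
    refine integral_congr_ae ?_
    filter_upwards [hf2.coeFn_toLp] with x hx
    rw [hx, inner_self_eq_norm_sq_to_K]
    push_cast
    rfl
  rw [h2, integral_complex_ofReal] at h1
  refine Complex.ofReal_injective (h1.symm.trans ?_)
  push_cast
  rfl

open FourierTransform in
theorem integral_norm_fourier_sq {f : ℝ → ℂ} (hf : Integrable f) (hf2 : MemLp f 2) :
    ∫ k, ‖𝓕 f k‖ ^ 2 = ∫ x, ‖f x‖ ^ 2 := by
  rw [integral_norm_sq_eq_toLp_norm hf2, integral_norm_sq_eq_toLp_norm (memLp_fourier hf hf2),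
    ← MeasureTheory.Lp.norm_fourier_eq (hf2.toLp f)]
  congr 2
  refine Lp.ext ?_
  filter_upwards [(memLp_fourier hf hf2).coeFn_toLp, fourier_toLp_ae_eq hf hf2] with x h1 h2
  rw [h1, h2]

/-- The Fourier transform in the first variable. -/
noncomputable def partialFourier (W : ℝ × ℝ → ℂ) (k t : ℝ) : ℂ :=
  ∫ x : ℝ, Complex.exp (↑(-2 * Real.pi * x * k) * Complex.I) * W (x, t)

open FourierTransform in
theorem partialFourier_eq (W : ℝ × ℝ → ℂ) (k t : ℝ) :
    partialFourier W k t = 𝓕 (fun x => W (x, t)) k := by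
  rw [Real.fourier_real_eq_integral_exp_smul]
  rfl

variable {ν : Measure ℝ} [SFinite ν]

/-- Bounded support in `x₁` makes almost every `L²` slice integrable, so the partial transform is a
genuine integral. This is why a cutoff is introduced before transforming. -/
theorem ae_integrable_slice {W : ℝ × ℝ → ℂ} {R : ℝ} (hW : MemLp W 2 (volume.prod ν))
    (hR : ∀ x t, R < |x| → W (x, t) = 0) :
    ∀ᵐ t ∂ν, Integrable (fun x => W (x, t)) ∧ MemLp (fun x => W (x, t)) 2 := by
  have h1 := (hW.integrable_norm_pow (p := 2) (by norm_num)).prod_left_ae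
  have h2 : ∀ᵐ t ∂ν, AEStronglyMeasurable (fun x => W (x, t)) volume := hW.1.prodMk_right
  filter_upwards [h1, h2] with t ht hm
  have hL : MemLp (fun x => W (x, t)) 2 := (memLp_two_iff_integrable_sq_norm hm).mpr ht
  refine ⟨?_, hL⟩
  have h3 : IntegrableOn (fun x => W (x, t)) (Icc (-R) R) :=
    (hL.restrict (Icc (-R) R)).integrable (by norm_num)
  refine (integrableOn_iff_integrable_of_support_subset fun x hx => ?_).mp h3
  rw [mem_Icc, ← abs_le]
  by_contra hn
  exact hx (hR x t (not_le.mp hn))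

theorem partialFourier_ae_congr {W W' : ℝ × ℝ → ℂ} (h : W =ᵐ[volume.prod ν] W') :
    ∀ᵐ t ∂ν, ∀ k, partialFourier W k t = partialFourier W' k t := by
  have h1 : ∀ᵐ t ∂ν, ∀ᵐ x ∂(volume : Measure ℝ), W (x, t) = W' (x, t) := by
    exact Measure.ae_ae_of_ae_prod (Measure.measurePreserving_swap.quasiMeasurePreserving.ae h)
  filter_upwards [h1] with t ht k
  refine integral_congr_ae ?_
  filter_upwards [ht] with x hx
  rw [hx]

theorem aestronglyMeasurable_partialFourier {W : ℝ × ℝ → ℂ}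
    (hW : AEStronglyMeasurable W (volume.prod ν)) :
    AEStronglyMeasurable (fun q : ℝ × ℝ => partialFourier W q.1 q.2) (volume.prod ν) := by
  refine ⟨fun q => partialFourier (hW.mk W) q.1 q.2, ?_, ?_⟩
  · refine StronglyMeasurable.integral_prod_right (f := fun (q : ℝ × ℝ) (x : ℝ) =>
      Complex.exp (↑(-2 * Real.pi * x * q.1) * Complex.I) * hW.mk W (x, q.2)) ?_
    refine StronglyMeasurable.mul ?_ ?_
    · refine Continuous.stronglyMeasurable ?_
      fun_prop
    · exact hW.stronglyMeasurable_mk.comp_measurable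
        (g := fun p : (ℝ × ℝ) × ℝ => (p.2, p.1.2)) (by fun_prop)
  · have := Measure.quasiMeasurePreserving_snd (μ := (volume : Measure ℝ)).ae
      (partialFourier_ae_congr hW.ae_eq_mk)
    filter_upwards [this] with q hq using hq q.1

theorem integrable_norm_partialFourier_sq {W : ℝ × ℝ → ℂ} {R : ℝ} (hW : MemLp W 2 (volume.prod ν))
    (hR : ∀ x t, R < |x| → W (x, t) = 0) :
    Integrable (fun q : ℝ × ℝ => ‖partialFourier W q.1 q.2‖ ^ 2) (volume.prod ν) := by
  have hm : AEStronglyMeasurable (fun q : ℝ × ℝ => ‖partialFourier W q.1 q.2‖ ^ 2)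
      (volume.prod ν) := (aestronglyMeasurable_partialFourier hW.1).norm.pow 2
  rw [integrable_prod_iff' hm]
  have hs := ae_integrable_slice hW hR
  constructor
  · filter_upwards [hs] with t ht
    simp only [partialFourier_eq]
    exact (memLp_fourier ht.1 ht.2).integrable_norm_pow (p := 2) (by norm_num)
  · have := (hW.integrable_norm_pow (p := 2) (by norm_num)).integral_prod_right
    refine this.congr ?_
    filter_upwards [hs] with t ht
    simp only [partialFourier_eq, norm_pow, norm_norm]
    exact (integral_norm_fourier_sq ht.1 ht.2).symm

theorem integral_norm_partialFourier_sq {W : ℝ × ℝ → ℂ} {R : ℝ} (hW : MemLp W 2 (volume.prod ν))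
    (hR : ∀ x t, R < |x| → W (x, t) = 0) :
    ∫ k, ∫ t, ‖partialFourier W k t‖ ^ 2 ∂ν = ∫ z, ‖W z‖ ^ 2 ∂(volume.prod ν) := by
  have hi := integrable_norm_partialFourier_sq hW hR
  rw [← integral_prod _ hi, integral_prod_symm _ hi,
    integral_prod_symm _ (hW.integrable_norm_pow (p := 2) (by norm_num))]
  refine integral_congr_ae ?_
  filter_upwards [ae_integrable_slice hW hR] with t ht
  simp only [partialFourier_eq]
  exact integral_norm_fourier_sq ht.1 ht.2

theorem ae_memLp_partialFourier {W : ℝ × ℝ → ℂ} {R : ℝ} (hW : MemLp W 2 (volume.prod ν))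
    (hR : ∀ x t, R < |x| → W (x, t) = 0) :
    ∀ᵐ k, MemLp (partialFourier W k) 2 ν := by
  have h1 := (integrable_norm_partialFourier_sq hW hR).prod_right_ae
  have h2 : ∀ᵐ k ∂(volume : Measure ℝ), AEStronglyMeasurable (fun t => partialFourier W k t) ν :=
    (aestronglyMeasurable_partialFourier hW.1).prodMk_left
  filter_upwards [h1, h2] with k hk hm
  exact (memLp_two_iff_integrable_sq_norm hm).mpr hk

theorem integral_partialFourier_mul {W : ℝ × ℝ → ℂ} {R : ℝ} (hW : MemLp W 2 (volume.prod ν))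
    (hR : ∀ x t, R < |x| → W (x, t) = 0) {h : ℝ → ℂ} (hh : MemLp h 2 ν) (k : ℝ) :
    ∫ t, partialFourier W k t * h t ∂ν
      = ∫ z, W z * (Complex.exp (↑(-2 * Real.pi * z.1 * k) * Complex.I) * h z.2)
        ∂((volume : Measure ℝ).prod ν) := by
  set e : ℝ → ℂ := fun x => Complex.exp (↑(-2 * Real.pi * x * k) * Complex.I) with he
  have hec : Continuous e := by fun_prop
  -- The plane wave is not square integrable; truncating it where `W` vanishes changes nothing and
  -- gives the integrability required by Fubini.
  set c : ℝ → ℂ := (Icc (-R) R).indicator e with hcdef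
  have hcm : AEStronglyMeasurable c volume := hec.aestronglyMeasurable.indicator measurableSet_Icc
  have hc : Integrable (fun x => ‖c x‖ ^ 2) := by
    have h1 : IntegrableOn (fun x => ‖e x‖ ^ 2) (Icc (-R) R) :=
      (hec.norm.pow 2).continuousOn.integrableOn_Icc
    refine (h1.integrable_indicator measurableSet_Icc).congr (Eventually.of_forall fun x => ?_)
    simp only [hcdef, indicator]
    split_ifs <;> simp
  have hH : MemLp (fun z : ℝ × ℝ => c z.1 * h z.2) 2 (volume.prod ν) := by
    have hm : AEStronglyMeasurable (fun z : ℝ × ℝ => c z.1 * h z.2) (volume.prod ν) :=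
      hcm.comp_fst.mul hh.1.comp_snd
    rw [memLp_two_iff_integrable_sq_norm hm]
    simp only [norm_mul, mul_pow]
    exact hc.mul_prod (hh.integrable_norm_pow (p := 2) (by norm_num))
  have heq : ∀ z : ℝ × ℝ, W z * (c z.1 * h z.2) = W z * (e z.1 * h z.2) := by
    rintro ⟨x, t⟩
    by_cases hx : x ∈ Icc (-R) R
    · simp only [hcdef, indicator_of_mem hx]
    · rw [mem_Icc, ← abs_le] at hx
      rw [hR x t (not_le.mp hx), zero_mul, zero_mul]
  have hi : Integrable (fun z : ℝ × ℝ => W z * (e z.1 * h z.2)) (volume.prod ν) := by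
    refine (hW.integrable_mul (q := 2) hH).congr (Eventually.of_forall fun z => ?_)
    exact heq z
  rw [integral_prod_symm _ hi]
  refine integral_congr_ae (Eventually.of_forall fun t => ?_)
  simp only [partialFourier]
  rw [← integral_mul_const]
  refine integral_congr_ae (Eventually.of_forall fun x => ?_)
  simp only [he]
  ring

end

section

/-! ### The lower bound in the half-plane -/

theorem volume_restrict_halfPlane :
    (volume : Measure (ℝ × ℝ)).restrict halfPlane
      = (volume : Measure ℝ).prod (volume.restrict (Ioi 0)) := by
  have h1 : halfPlane = univ ×ˢ Ioi (0 : ℝ) := by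
    ext z
    simp [halfPlane]
  rw [h1, Measure.volume_eq_prod, ← Measure.prod_restrict, Measure.restrict_univ]

/-- The oscillating factor of the test functions. -/
noncomputable def testPhase (k : ℝ) (z : ℝ × ℝ) : ℂ :=
  Complex.exp (((-2 * Real.pi * z.1 * k - z.1 * z.2 / 2 : ℝ) : ℂ) * Complex.I)

theorem contDiff_testPhase (k : ℝ) : ContDiff ℝ ∞ (testPhase k) := by
  refine ContDiff.cexp (ContDiff.mul (Complex.ofRealCLM.contDiff.comp ?_) contDiff_const)
  exact ((contDiff_const.mul contDiff_fst).mul contDiff_const).sub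
    ((contDiff_fst.mul contDiff_snd).div_const 2)

theorem hasDerivAt_testPhase_fst (k x t : ℝ) :
    HasDerivAt (fun x => testPhase k (x, t))
      (testPhase k (x, t) * (((-2 * Real.pi * k - t / 2 : ℝ) : ℂ) * Complex.I)) x := by
  have h1 : HasDerivAt (fun x : ℝ => -2 * Real.pi * x * k - x * t / 2) (-2 * Real.pi * k - t / 2) x := by
    convert! (((hasDerivAt_id x).const_mul (-2 * Real.pi)).mul_const k).sub
      (((hasDerivAt_id x).mul_const t).div_const 2) using 1
    simp
  exact (h1.ofReal_comp.mul_const Complex.I).cexp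

theorem hasDerivAt_testPhase_snd (k x t : ℝ) :
    HasDerivAt (fun t => testPhase k (x, t))
      (testPhase k (x, t) * (((-(x / 2) : ℝ) : ℂ) * Complex.I)) t := by
  have h1 : HasDerivAt (fun t : ℝ => -2 * Real.pi * x * k - x * t / 2) (-(x / 2)) t := by
    have := (((hasDerivAt_id t).const_mul x).div_const 2).const_sub (-2 * Real.pi * x * k)
    simpa using this
  exact (h1.ofReal_comp.mul_const Complex.I).cexp

/-- Test functions `e^{i(...)} ρ(x₁) h(x₂)`. -/
noncomputable def testFun (k : ℝ) (ρ h : ℝ → ℝ) (z : ℝ × ℝ) : ℂ :=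
  testPhase k z * ((ρ z.1 * h z.2 : ℝ) : ℂ)

theorem tsupport_testFun_subset (k : ℝ) (ρ h : ℝ → ℝ) :
    tsupport (testFun k ρ h) ⊆ tsupport ρ ×ˢ tsupport h := by
  refine closure_minimal (fun z hz => ?_) ((isClosed_tsupport ρ).prod (isClosed_tsupport h))
  constructor
  · by_contra hn
    exact hz (by simp [testFun, image_eq_zero_of_notMem_tsupport hn])
  · by_contra hn
    exact hz (by simp [testFun, image_eq_zero_of_notMem_tsupport hn])

theorem hasCompactSupport_testFun (k : ℝ) {ρ h : ℝ → ℝ} (hρ : HasCompactSupport ρ)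
    (hh : HasCompactSupport h) : HasCompactSupport (testFun k ρ h) :=
  (hρ.isCompact.prod hh.isCompact).of_isClosed_subset (isClosed_tsupport _)
    (tsupport_testFun_subset k ρ h)

theorem contDiff_testFun (k : ℝ) {ρ h : ℝ → ℝ} (hρ : ContDiff ℝ ∞ ρ) (hh : ContDiff ℝ ∞ h) :
    ContDiff ℝ ∞ (testFun k ρ h) :=
  (contDiff_testPhase k).mul (Complex.ofRealCLM.contDiff.comp
    ((hρ.comp contDiff_fst).mul (hh.comp contDiff_snd)))

theorem continuous_testFun (k : ℝ) {ρ h : ℝ → ℝ} (hρ : Continuous ρ) (hh : Continuous h) :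
    Continuous (testFun k ρ h) :=
  (contDiff_testPhase k).continuous.mul (Complex.continuous_ofReal.comp
    ((hρ.comp continuous_fst).mul (hh.comp continuous_snd)))

theorem fderiv_apply_fst {f : ℝ × ℝ → ℂ} {x t : ℝ} {f' : ℂ} (hf : DifferentiableAt ℝ f (x, t))
    (h : HasDerivAt (fun x => f (x, t)) f' x) : fderiv ℝ f (x, t) (1, 0) = f' :=
  (hf.hasFDerivAt.comp_hasDerivAt x ((hasDerivAt_id x).prodMk (hasDerivAt_const x t))).unique h

theorem fderiv_apply_snd {f : ℝ × ℝ → ℂ} {x t : ℝ} {f' : ℂ} (hf : DifferentiableAt ℝ f (x, t))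
    (h : HasDerivAt (fun t => f (x, t)) f' t) : fderiv ℝ f (x, t) (0, 1) = f' :=
  (hf.hasFDerivAt.comp_hasDerivAt t ((hasDerivAt_const t x).prodMk (hasDerivAt_id t))).unique h

theorem fderiv_testFun_fst (k : ℝ) {ρ h : ℝ → ℝ} (hρ : ContDiff ℝ ∞ ρ) (hh : ContDiff ℝ ∞ h)
    (z : ℝ × ℝ) : fderiv ℝ (testFun k ρ h) z (1, 0)
      = testFun k ρ h z * (((-2 * Real.pi * k - z.2 / 2 : ℝ) : ℂ) * Complex.I)
        + testFun k (deriv ρ) h z := by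
  refine fderiv_apply_fst ((contDiff_testFun k hρ hh).differentiable (by simp) z) ?_
  have h1 := (((hρ.differentiable (by simp) z.1).hasDerivAt.mul_const (h z.2)).ofReal_comp)
  convert! (hasDerivAt_testPhase_fst k z.1 z.2).mul h1 using 1
  simp only [testFun]
  push_cast
  ring

theorem fderiv_testFun_snd (k : ℝ) {ρ h : ℝ → ℝ} (hρ : ContDiff ℝ ∞ ρ) (hh : ContDiff ℝ ∞ h)
    (z : ℝ × ℝ) : fderiv ℝ (testFun k ρ h) z (0, 1)
      = testFun k ρ h z * (((-(z.1 / 2) : ℝ) : ℂ) * Complex.I) + testFun k ρ (deriv h) z := by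
  refine fderiv_apply_snd ((contDiff_testFun k hρ hh).differentiable (by simp) z) ?_
  have h1 := (((hh.differentiable (by simp) z.2).hasDerivAt.const_mul (ρ z.1)).ofReal_comp)
  convert! (hasDerivAt_testPhase_snd k z.1 z.2).mul h1 using 1
  simp only [testFun]
  push_cast
  ring

/-- Cutoff in the first variable and gauge transformation. -/
noncomputable def gaugeCut (ρ : ℝ → ℝ) (w : ℝ × ℝ → ℂ) (z : ℝ × ℝ) : ℂ :=
  ((ρ z.1 : ℝ) : ℂ) * Complex.exp (((-(z.1 * z.2 / 2) : ℝ) : ℂ) * Complex.I) * w z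

/-- The gauge factor `e^{-i x₁ x₂ / 2}` turns the magnetic derivatives into `∂₁ + i x₂` and `∂₂`.
Together with the Fourier kernel it forms `testPhase`, so pairing a transformed slice with `h`
amounts to testing `w` against `testFun k ρ h`. -/
theorem gaugeCut_mul (k : ℝ) (ρ h : ℝ → ℝ) (w : ℝ × ℝ → ℂ) (z : ℝ × ℝ) :
    gaugeCut ρ w z * (Complex.exp (↑(-2 * Real.pi * z.1 * k) * Complex.I) * ((h z.2 : ℝ) : ℂ))
      = w z * testFun k ρ h z := by
  have : testPhase k z = Complex.exp (((-(z.1 * z.2 / 2) : ℝ) : ℂ) * Complex.I)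
      * Complex.exp (↑(-2 * Real.pi * z.1 * k) * Complex.I) := by
    rw [testPhase, ← Complex.exp_add]
    congr 1
    push_cast
    ring
  rw [gaugeCut, testFun, this]
  push_cast
  ring

theorem norm_gaugeCut_add (ρ ρ' : ℝ → ℝ) (w w' : ℝ × ℝ → ℂ) (z : ℝ × ℝ) :
    ‖gaugeCut ρ w z + gaugeCut ρ' w' z‖ = ‖(ρ z.1 : ℂ) * w z + (ρ' z.1 : ℂ) * w' z‖ := by
  have : gaugeCut ρ w z + gaugeCut ρ' w' z
      = Complex.exp (((-(z.1 * z.2 / 2) : ℝ) : ℂ) * Complex.I)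
        * ((ρ z.1 : ℂ) * w z + (ρ' z.1 : ℂ) * w' z) := by
    simp only [gaugeCut]
    ring
  rw [this, norm_mul, Complex.norm_exp_ofReal_mul_I, one_mul]

theorem norm_gaugeCut (ρ : ℝ → ℝ) (w : ℝ × ℝ → ℂ) (z : ℝ × ℝ) :
    ‖gaugeCut ρ w z‖ = ‖(ρ z.1 : ℂ) * w z‖ := by
  have := norm_gaugeCut_add ρ 0 w 0 z
  simpa [gaugeCut] using this

theorem exists_bound_of_compact {ρ : ℝ → ℝ} (hc : HasCompactSupport ρ) :
    ∃ R, ∀ x, R < |x| → ρ x = 0 := by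
  obtain ⟨R, hR⟩ := hc.isCompact.isBounded.subset_closedBall 0
  refine ⟨R, fun x hx => image_eq_zero_of_notMem_tsupport fun h => ?_⟩
  have := hR h
  rw [mem_closedBall_zero_iff, Real.norm_eq_abs] at this
  linarith

theorem memLp_gaugeCut {ρ : ℝ → ℝ} (hρ : Continuous ρ) (hc : HasCompactSupport ρ) {w : ℝ × ℝ → ℂ}
    {μ : Measure (ℝ × ℝ)} (hw : MemLp w 2 μ) : MemLp (gaugeCut ρ w) 2 μ := by
  obtain ⟨C, hC⟩ := hc.exists_bound_of_continuous hρ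
  have hcont : Continuous fun z : ℝ × ℝ => ((ρ z.1 : ℝ) : ℂ) *
      Complex.exp (((-(z.1 * z.2 / 2) : ℝ) : ℂ) * Complex.I) := by fun_prop
  refine (hw.norm.const_mul C).mono' (hcont.aestronglyMeasurable.mul hw.1) ?_
  refine Eventually.of_forall fun z => ?_
  rw [norm_gaugeCut, norm_mul, Complex.norm_real]
  gcongr
  exact hC _

theorem integrable_mul_test {w F : ℝ × ℝ → ℂ} {s : Set (ℝ × ℝ)} (hw : MemLp w 2 (volume.restrict s))
    (hF : Continuous F) (hc : HasCompactSupport F) : IntegrableOn (fun z => w z * F z) s :=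
  hw.integrable_mul (q := 2) ((hF.memLp_of_hasCompactSupport hc).restrict _)

variable {u d₁ d₂ : ℝ × ℝ → ℂ} {g : ℝ → ℂ} {ρ : ℝ → ℝ}

theorem partialFourier_gaugeCut_mul {w : ℝ × ℝ → ℂ} (hw : MemLp w 2 (volume.restrict halfPlane))
    (hρ : Continuous ρ) (hc : HasCompactSupport ρ) {h : ℝ → ℝ} (hh : Continuous h)
    (hhc : HasCompactSupport h) (k : ℝ) :
    ∫ t in Ioi (0 : ℝ), partialFourier (gaugeCut ρ w) k t * ((h t : ℝ) : ℂ)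
      = ∫ z in halfPlane, w z * testFun k ρ h z := by
  obtain ⟨R, hR⟩ := exists_bound_of_compact hc
  have hm := memLp_gaugeCut hρ hc hw
  rw [volume_restrict_halfPlane] at hm ⊢
  have hh2 : MemLp (fun t => ((h t : ℝ) : ℂ)) 2 (volume.restrict (Ioi 0)) :=
    ((hh.memLp_of_hasCompactSupport hhc).restrict _).ofReal
  rw [integral_partialFourier_mul (R := R) hm (fun x t hx => by simp [gaugeCut, hR x hx]) hh2 k]
  exact integral_congr_ae (Eventually.of_forall fun z => gaugeCut_mul k ρ h w z)

theorem continuous_deriv_test {ρ : ℝ → ℝ} (hρ : ContDiff ℝ ∞ ρ) : Continuous (deriv ρ) :=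
  hρ.continuous_deriv (by simp)

open FourierTransform in
/-- The partial Fourier transform of `u` has the expected weak derivative and trace. -/
theorem partialFourier_weak_deriv (hu : MemMagneticH1 u d₁ d₂) (hg : IsTrace u d₂ g)
    (hρ : ContDiff ℝ ∞ ρ) (hc : HasCompactSupport ρ) {h : ℝ → ℝ} (hh : ContDiff ℝ ∞ h)
    (hhc : HasCompactSupport h) (k : ℝ) :
    ∫ t in Ioi (0 : ℝ), partialFourier (gaugeCut ρ u) k t * ((deriv h t : ℝ) : ℂ)
      = -(∫ t in Ioi (0 : ℝ), partialFourier (gaugeCut ρ d₂) k t * ((h t : ℝ) : ℂ))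
        - 𝓕 (fun x => (ρ x : ℂ) * g x) k * ((h 0 : ℝ) : ℂ) := by
  obtain ⟨hu0, -, hu2, -⟩ := hu
  rw [partialFourier_gaugeCut_mul hu0 hρ.continuous hc (continuous_deriv_test hh) hhc.deriv,
    partialFourier_gaugeCut_mul hu2 hρ.continuous hc hh.continuous hhc]
  have key := hg.2 _ (contDiff_testFun k hρ hh) (hasCompactSupport_testFun k hc hhc)
  have hF := continuous_testFun k hρ.continuous hh.continuous
  have hFc := hasCompactSupport_testFun k hc hhc
  have i1 := integrable_mul_test hu0 (continuous_testFun k hρ.continuous (continuous_deriv_test hh))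
    (hasCompactSupport_testFun k hc hhc.deriv)
  have i2 := integrable_mul_test hu0 (F := fun z => testFun k ρ h z * (((z.1 / 2 : ℝ) : ℂ) * Complex.I))
    (hF.mul (by fun_prop)) hFc.mul_right
  have i3 := integrable_mul_test hu2 hF hFc
  have e1 : ∫ z in halfPlane, u z * fderiv ℝ (testFun k ρ h) z (0, 1)
      = (∫ z in halfPlane, u z * testFun k ρ (deriv h) z)
        - ∫ z in halfPlane, u z * (testFun k ρ h z * (((z.1 / 2 : ℝ) : ℂ) * Complex.I)) := by
    rw [← integral_sub i1 i2]
    refine integral_congr_ae (Eventually.of_forall fun z => ?_)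
    simp only
    rw [fderiv_testFun_snd k hρ hh]
    push_cast
    ring
  have e2 : ∫ z in halfPlane, (d₂ z + Complex.I * (A₀ z).2 * u z) * testFun k ρ h z
      = (∫ z in halfPlane, d₂ z * testFun k ρ h z)
        + ∫ z in halfPlane, u z * (testFun k ρ h z * (((z.1 / 2 : ℝ) : ℂ) * Complex.I)) := by
    rw [← integral_add i3 i2]
    refine integral_congr_ae (Eventually.of_forall fun z => ?_)
    simp only [A₀]
    ring
  have e3 : ∫ s : ℝ, g s * testFun k ρ h (s, 0)
      = 𝓕 (fun x => (ρ x : ℂ) * g x) k * ((h 0 : ℝ) : ℂ) := by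
    rw [Real.fourier_real_eq_integral_exp_smul, ← integral_mul_const]
    refine integral_congr_ae (Eventually.of_forall fun s => ?_)
    simp only [testFun, testPhase, mul_zero, zero_div, sub_zero, smul_eq_mul]
    push_cast
    ring
  -- The terms carrying `z.1 / 2` cancel: the gauge has removed the second component of `A₀`.
  rw [e1, e2, e3] at key
  linear_combination key

/-- The first magnetic derivative becomes multiplication by `i (t + 2πk)`. -/
theorem partialFourier_fst (hu : MemMagneticH1 u d₁ d₂) (hρ : ContDiff ℝ ∞ ρ)
    (hc : HasCompactSupport ρ) {h : ℝ → ℝ} (hh : ContDiff ℝ ∞ h) (hhc : HasCompactSupport h)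
    (hhs : tsupport h ⊆ Ioi 0) (k : ℝ) :
    (∫ t in Ioi (0 : ℝ), partialFourier (gaugeCut ρ d₁) k t * ((h t : ℝ) : ℂ))
      + (∫ t in Ioi (0 : ℝ), partialFourier (gaugeCut (deriv ρ) u) k t * ((h t : ℝ) : ℂ))
    = Complex.I * ∫ t in Ioi (0 : ℝ), partialFourier (gaugeCut ρ u) k t
        * (((t + 2 * Real.pi * k) * h t : ℝ) : ℂ) := by
  obtain ⟨hu0, hu1, -, hgrad⟩ := hu
  have hρ' := continuous_deriv_test hρ
  have hlin : Continuous fun t => (t + 2 * Real.pi * k) * h t :=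
    (by fun_prop : Continuous fun t : ℝ => t + 2 * Real.pi * k).mul hh.continuous
  have hlinc : HasCompactSupport fun t => (t + 2 * Real.pi * k) * h t := hhc.mul_left
  rw [partialFourier_gaugeCut_mul hu1 hρ.continuous hc hh.continuous hhc,
    partialFourier_gaugeCut_mul hu0 hρ' hc.deriv hh.continuous hhc,
    partialFourier_gaugeCut_mul hu0 hρ.continuous hc hlin hlinc]
  have hF := continuous_testFun k hρ.continuous hh.continuous
  have hFc := hasCompactSupport_testFun k hc hhc
  have key := (hgrad _ (contDiff_testFun k hρ hh) hFc
    ((tsupport_testFun_subset k ρ h).trans fun z hz => hhs hz.2)).1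
  have i1 := integrable_mul_test hu0 (F := fun z => testFun k ρ h z
    * (((-2 * Real.pi * k - z.2 / 2 : ℝ) : ℂ) * Complex.I)) (hF.mul (by fun_prop)) hFc.mul_right
  have i2 := integrable_mul_test hu0 (continuous_testFun k hρ' hh.continuous)
    (hasCompactSupport_testFun k hc.deriv hhc)
  have i3 := integrable_mul_test hu1 hF hFc
  have i4 := integrable_mul_test hu0 (F := fun z => testFun k ρ h z
    * (((-z.2 / 2 : ℝ) : ℂ) * Complex.I)) (hF.mul (by fun_prop)) hFc.mul_right
  have e1 : ∫ z in halfPlane, u z * fderiv ℝ (testFun k ρ h) z (1, 0)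
      = (∫ z in halfPlane, u z * (testFun k ρ h z
          * (((-2 * Real.pi * k - z.2 / 2 : ℝ) : ℂ) * Complex.I)))
        + ∫ z in halfPlane, u z * testFun k (deriv ρ) h z := by
    rw [← integral_add i1 i2]
    refine integral_congr_ae (Eventually.of_forall fun z => ?_)
    simp only
    rw [fderiv_testFun_fst k hρ hh]
    ring
  have e2 : ∫ z in halfPlane, (d₁ z + Complex.I * (A₀ z).1 * u z) * testFun k ρ h z
      = (∫ z in halfPlane, d₁ z * testFun k ρ h z)
        + ∫ z in halfPlane, u z * (testFun k ρ h z * (((-z.2 / 2 : ℝ) : ℂ) * Complex.I)) := by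
    rw [← integral_add i3 i4]
    refine integral_congr_ae (Eventually.of_forall fun z => ?_)
    simp only [A₀]
    ring
  have e3 : Complex.I * ∫ z in halfPlane, u z * testFun k ρ (fun t => (t + 2 * Real.pi * k) * h t) z
      = -(∫ z in halfPlane, u z * (testFun k ρ h z
          * (((-2 * Real.pi * k - z.2 / 2 : ℝ) : ℂ) * Complex.I)))
        - ∫ z in halfPlane, u z * (testFun k ρ h z * (((-z.2 / 2 : ℝ) : ℂ) * Complex.I)) := by
    have i1n : IntegrableOn (fun z => -(u z * (testFun k ρ h z
      * (((-2 * Real.pi * k - z.2 / 2 : ℝ) : ℂ) * Complex.I)))) halfPlane := i1.neg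
    rw [← integral_const_mul, ← integral_neg, ← integral_sub i1n i4]
    refine integral_congr_ae (Eventually.of_forall fun z => ?_)
    simp only [testFun]
    push_cast
    ring
  rw [e1, e2] at key
  rw [e3]
  linear_combination key

theorem locallyIntegrableOn_of_memLp {v : ℝ → ℂ} (hv : MemLp v 2 (volume.restrict (Ioi 0))) :
    LocallyIntegrableOn v (Ioi 0) volume := by
  intro x _
  obtain ⟨U, hU, hUi⟩ := hv.locallyIntegrable (by norm_num) x
  refine ⟨U ∩ Ioi 0, inter_mem (mem_nhdsWithin_of_mem_nhds hU) self_mem_nhdsWithin, ?_⟩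
  rwa [IntegrableOn, Measure.restrict_restrict' measurableSet_Ioi] at hUi

/-- Pointwise form of `partialFourier_fst`. The term with `deriv ρ` is the commutator of `∂₁` with
the cutoff; the right-hand side is the potential `t - ξ` with `ξ = -2πk`. -/
theorem partialFourier_fst_ae (hu : MemMagneticH1 u d₁ d₂) (hρ : ContDiff ℝ ∞ ρ)
    (hc : HasCompactSupport ρ) {k : ℝ}
    (m1 : MemLp (partialFourier (gaugeCut ρ d₁) k) 2 (volume.restrict (Ioi 0)))
    (m2 : MemLp (partialFourier (gaugeCut (deriv ρ) u) k) 2 (volume.restrict (Ioi 0)))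
    (m3 : MemLp (partialFourier (gaugeCut ρ u) k) 2 (volume.restrict (Ioi 0))) :
    ∀ᵐ t ∂(volume.restrict (Ioi (0 : ℝ))),
      partialFourier (gaugeCut ρ d₁) k t + partialFourier (gaugeCut (deriv ρ) u) k t
        = Complex.I * (((t : ℂ) - ((-(2 * Real.pi * k) : ℝ) : ℂ)) * partialFourier (gaugeCut ρ u) k t) := by
  have l3 : LocallyIntegrableOn (fun t : ℝ => Complex.I * (((t : ℂ) - ((-(2 * Real.pi * k) : ℝ) : ℂ))
      * partialFourier (gaugeCut ρ u) k t)) (Ioi 0) volume := by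
    have := (locallyIntegrableOn_of_memLp m3).continuousOn_mul (g := fun t : ℝ =>
      Complex.I * ((t : ℂ) - ((-(2 * Real.pi * k) : ℝ) : ℂ))) (by fun_prop) isOpen_Ioi.isLocallyClosed
    refine this.congr ?_
    exact Eventually.of_forall fun t => by ring
  have hloc := ((locallyIntegrableOn_of_memLp m1).add (locallyIntegrableOn_of_memLp m2)).sub l3
  have := isOpen_Ioi.ae_eq_zero_of_integral_contDiff_smul_eq_zero hloc fun h hh hhc hhs => by
    have key := partialFourier_fst hu hρ hc hh hhc hhs k
    have mh : MemLp (fun t => ((h t : ℝ) : ℂ)) 2 (volume.restrict (Ioi 0)) :=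
      ((hh.continuous.memLp_of_hasCompactSupport hhc).restrict _).ofReal
    have hlin : Continuous fun t => (t + 2 * Real.pi * k) * h t :=
      (by fun_prop : Continuous fun t : ℝ => t + 2 * Real.pi * k).mul hh.continuous
    have hlinc : HasCompactSupport fun t => (t + 2 * Real.pi * k) * h t := hhc.mul_left
    have mh' : MemLp (fun t => (((t + 2 * Real.pi * k) * h t : ℝ) : ℂ)) 2 (volume.restrict (Ioi 0)) :=
      ((hlin.memLp_of_hasCompactSupport hlinc).restrict _).ofReal
    have i1 : IntegrableOn (fun t => partialFourier (gaugeCut ρ d₁) k t * ((h t : ℝ) : ℂ)) (Ioi 0) :=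
      m1.integrable_mul (q := 2) mh
    have i2 : IntegrableOn (fun t => partialFourier (gaugeCut (deriv ρ) u) k t * ((h t : ℝ) : ℂ))
      (Ioi 0) := m2.integrable_mul (q := 2) mh
    have i3 : IntegrableOn (fun t => partialFourier (gaugeCut ρ u) k t
      * (((t + 2 * Real.pi * k) * h t : ℝ) : ℂ)) (Ioi 0) := m3.integrable_mul (q := 2) mh'
    have i12 : IntegrableOn (fun t => partialFourier (gaugeCut ρ d₁) k t * ((h t : ℝ) : ℂ)
      + partialFourier (gaugeCut (deriv ρ) u) k t * ((h t : ℝ) : ℂ)) (Ioi 0) := i1.add i2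
    rw [← integral_const_mul, ← integral_add i1 i2, ← sub_eq_zero,
      ← integral_sub i12 (i3.const_mul _)] at key
    rw [← key, ← setIntegral_eq_integral_of_forall_compl_eq_zero (s := Ioi 0) fun t ht => by
      rw [image_eq_zero_of_notMem_tsupport fun h' => ht (hhs h'), zero_smul]]
    refine integral_congr_ae (Eventually.of_forall fun t => ?_)
    simp only [Pi.add_apply, Pi.sub_apply, Complex.real_smul]
    push_cast
    ring
  rw [ae_restrict_iff' measurableSet_Ioi]
  filter_upwards [this] with t ht ht0
  exact sub_eq_zero.mp (ht ht0)

open FourierTransform in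
/-- The lower bound for the cut-off function. -/
theorem cutoff_lower_bound (γ : ℝ) (hu : MemMagneticH1 u d₁ d₂) (hg : IsTrace u d₂ g)
    (hρ : ContDiff ℝ ∞ ρ) (hc : HasCompactSupport ρ) :
    groundEnergy γ * (∫ z in halfPlane, ‖(ρ z.1 : ℂ) * u z‖ ^ 2)
      ≤ (∫ z in halfPlane, ‖(ρ z.1 : ℂ) * d₂ z‖ ^ 2)
        + (∫ z in halfPlane, ‖(ρ z.1 : ℂ) * d₁ z + ((deriv ρ z.1 : ℝ) : ℂ) * u z‖ ^ 2)
        + γ * ∫ s : ℝ, ‖(ρ s : ℂ) * g s‖ ^ 2 := by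
  have hρ' := continuous_deriv_test hρ
  obtain ⟨hu0, hu1, hu2, -⟩ := id hu
  obtain ⟨R, hR⟩ := exists_bound_of_compact hc
  obtain ⟨R', hR'⟩ := exists_bound_of_compact hc.deriv
  have zu : ∀ (w : ℝ × ℝ → ℂ) x t, R < |x| → gaugeCut ρ w (x, t) = 0 := fun w x t hx => by
    simp [gaugeCut, hR x hx]
  have zu' : ∀ (w : ℝ × ℝ → ℂ) x t, R' < |x| → gaugeCut (deriv ρ) w (x, t) = 0 := fun w x t hx => by
    simp [gaugeCut, hR' x hx]
  have mu := memLp_gaugeCut hρ.continuous hc hu0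
  have mu' := memLp_gaugeCut hρ' hc.deriv hu0
  have md1 := memLp_gaugeCut hρ.continuous hc hu1
  have md2 := memLp_gaugeCut hρ.continuous hc hu2
  have e0 : ∀ w : ℝ × ℝ → ℂ, ∫ z in halfPlane, ‖(ρ z.1 : ℂ) * w z‖ ^ 2
      = ∫ z in halfPlane, ‖gaugeCut ρ w z‖ ^ 2 := fun w => by simp only [norm_gaugeCut]
  have e1 : ∫ z in halfPlane, ‖(ρ z.1 : ℂ) * d₁ z + ((deriv ρ z.1 : ℝ) : ℂ) * u z‖ ^ 2
      = ∫ z in halfPlane, ‖(gaugeCut ρ d₁ + gaugeCut (deriv ρ) u) z‖ ^ 2 := by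
    simp only [Pi.add_apply, norm_gaugeCut_add]
  rw [e0, e0, e1]
  rw [volume_restrict_halfPlane] at *
  have ms := md1.add mu'
  have zs : ∀ x t, max R R' < |x| → (gaugeCut ρ d₁ + gaugeCut (deriv ρ) u) (x, t) = 0 := by
    intro x t hx
    rw [Pi.add_apply, zu d₁ x t (lt_of_le_of_lt (le_max_left _ _) hx),
      zu' u x t (lt_of_le_of_lt (le_max_right _ _) hx), add_zero]
  -- the boundary term
  obtain ⟨C, hC⟩ := hc.exists_bound_of_continuous hρ.continuous
  have hgm : MemLp (fun x => (ρ x : ℂ) * g x) 2 := by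
    refine (hg.1.norm.const_mul C).mono'
      ((Complex.continuous_ofReal.comp hρ.continuous).aestronglyMeasurable.mul hg.1.1)
      (Eventually.of_forall fun x => ?_)
    rw [norm_mul, Complex.norm_real]
    gcongr
    exact hC x
  have hgi : Integrable (fun x => (ρ x : ℂ) * g x) := by
    have hρ2 : MemLp (fun x => (ρ x : ℂ)) 2 := (hρ.continuous.memLp_of_hasCompactSupport hc).ofReal
    exact hρ2.integrable_mul (q := 2) hg.1
  rw [← integral_norm_partialFourier_sq mu (zu u), ← integral_norm_partialFourier_sq md2 (zu d₂),
    ← integral_norm_partialFourier_sq ms zs, ← integral_norm_fourier_sq hgi hgm]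
  have iu : Integrable fun k => ∫ t in Ioi (0 : ℝ), ‖partialFourier (gaugeCut ρ u) k t‖ ^ 2 := (integrable_norm_partialFourier_sq mu (zu u)).integral_prod_left
  have id2 : Integrable fun k => ∫ t in Ioi (0 : ℝ), ‖partialFourier (gaugeCut ρ d₂) k t‖ ^ 2 := (integrable_norm_partialFourier_sq md2 (zu d₂)).integral_prod_left
  have is : Integrable fun k => ∫ t in Ioi (0 : ℝ),
      ‖partialFourier (gaugeCut ρ d₁ + gaugeCut (deriv ρ) u) k t‖ ^ 2 := (integrable_norm_partialFourier_sq ms zs).integral_prod_left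
  have ig := (memLp_fourier hgi hgm).integrable_norm_pow (p := 2) (by norm_num)
  have ids : Integrable fun k => (∫ t in Ioi (0 : ℝ), ‖partialFourier (gaugeCut ρ d₂) k t‖ ^ 2)
      + ∫ t in Ioi (0 : ℝ), ‖partialFourier (gaugeCut ρ d₁ + gaugeCut (deriv ρ) u) k t‖ ^ 2 :=
    id2.add is
  rw [← integral_const_mul, ← integral_const_mul, ← integral_add id2 is,
    ← integral_add ids (ig.const_mul γ)]
  refine integral_mono_ae (iu.const_mul _) (ids.add (ig.const_mul γ)) ?_
  filter_upwards [ae_memLp_partialFourier mu (zu u), ae_memLp_partialFourier md1 (zu d₁),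
    ae_memLp_partialFourier mu' (zu' u), ae_memLp_partialFourier md2 (zu d₂)] with k k0 k1 k2 k3
  have hfst := partialFourier_fst_ae hu hρ hc k1 k2 k0
  have hsum : ∀ᵐ t ∂(volume.restrict (Ioi (0 : ℝ))),
      partialFourier (gaugeCut ρ d₁ + gaugeCut (deriv ρ) u) k t
        = partialFourier (gaugeCut ρ d₁) k t + partialFourier (gaugeCut (deriv ρ) u) k t := by
    filter_upwards [ae_integrable_slice md1 (zu d₁), ae_integrable_slice mu' (zu' u)] with t h1 h2
    simp only [partialFourier, Pi.add_apply, mul_add]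
    have he : ∀ w : ℝ → ℂ, Integrable w → Integrable
        (fun x : ℝ => Complex.exp (↑(-2 * Real.pi * x * k) * Complex.I) * w x) := by
      intro w hw
      have hec : Continuous fun x : ℝ => Complex.exp (↑(-2 * Real.pi * x * k) * Complex.I) := by
        fun_prop
      refine hw.norm.mono' (hec.aestronglyMeasurable.mul hw.1) (Eventually.of_forall fun x => ?_)
      rw [norm_mul, Complex.norm_exp_ofReal_mul_I, one_mul]
    exact integral_add (he _ h1.1) (he _ h2.1)
  set ξ : ℝ := -(2 * Real.pi * k) with hξ
  have hnorm : ∀ᵐ t : ℝ ∂(volume.restrict (Ioi (0 : ℝ))),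
      ‖((t : ℂ) - ξ) * partialFourier (gaugeCut ρ u) k t‖
        = ‖partialFourier (gaugeCut ρ d₁ + gaugeCut (deriv ρ) u) k t‖ := by
    filter_upwards [hfst, hsum] with t h1 h2
    rw [h2, h1, norm_mul Complex.I, Complex.norm_I, one_mul]
  have mt : MemLp (fun t : ℝ => ((t : ℂ) - ξ) * partialFourier (gaugeCut ρ u) k t) 2
      (volume.restrict (Ioi 0)) := by
    refine (k1.add k2).congr_norm
      ((by fun_prop : Continuous fun t : ℝ => (t : ℂ) - ξ).aestronglyMeasurable.mul k0.1) ?_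
    filter_upwards [hfst] with t h1
    rw [Pi.add_apply, h1, norm_mul Complex.I, Complex.norm_I, one_mul]
  have hprim := complex_ae_eq_primitive_of_trace k0 k3 fun f hf hfc =>
    partialFourier_weak_deriv hu hg hρ hc hf hfc k
  -- The half-line representation in the fibre over `k`. Its boundary coefficient `robinF
  -- (groundEnergy γ) (-ξ)` is at most `γ` whatever `ξ` is, so a single energy serves all fibres.
  have hid := (integral_norm_sq_sub_robinF_mul (groundEnergy_lt_one γ) k0 k3 mt hprim).2
  have h0 : 0 ≤ ∫ t in Ioi (0 : ℝ), ‖partialFourier (gaugeCut ρ d₂) k t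
      - robinF (groundEnergy γ) (t - ξ) * partialFourier (gaugeCut ρ u) k t‖ ^ 2 :=
    integral_nonneg fun t => by positivity
  have hF : robinF (groundEnergy γ) (-ξ) * ‖𝓕 (fun x => (ρ x : ℂ) * g x) k‖ ^ 2
      ≤ γ * ‖𝓕 (fun x => (ρ x : ℂ) * g x) k‖ ^ 2 := by
    gcongr
    exact robinF_groundEnergy_le γ _
  have e2 : ∫ t in Ioi (0 : ℝ), ‖((t : ℂ) - ξ) * partialFourier (gaugeCut ρ u) k t‖ ^ 2
      = ∫ t in Ioi (0 : ℝ), ‖partialFourier (gaugeCut ρ d₁ + gaugeCut (deriv ρ) u) k t‖ ^ 2 := by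
    refine integral_congr_ae ?_
    filter_upwards [hnorm] with t ht
    rw [ht]
  rw [e2] at hid
  linarith

/-- Dominated convergence for cut-offs. -/
theorem tendsto_integral_cutoff {α : Type*} [MeasurableSpace α] {μ : Measure α} {w v : α → ℂ}
    (hw : MemLp w 2 μ) (hv : MemLp v 2 μ) {p q : ℕ → α → ℝ} {C : ℝ}
    (hp : ∀ n, AEStronglyMeasurable (p n) μ) (hq : ∀ n, AEStronglyMeasurable (q n) μ)
    (hp1 : ∀ n a, |p n a| ≤ 1) (hqC : ∀ n a, |q n a| ≤ C)
    (hpt : ∀ a, Tendsto (fun n => p n a) atTop (𝓝 1))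
    (hqt : ∀ a, Tendsto (fun n => q n a) atTop (𝓝 0)) :
    Tendsto (fun n => ∫ a, ‖(p n a : ℂ) * w a + (q n a : ℂ) * v a‖ ^ 2 ∂μ) atTop
      (𝓝 (∫ a, ‖w a‖ ^ 2 ∂μ)) := by
  refine tendsto_integral_of_dominated_convergence (fun a => 2 * ‖w a‖ ^ 2 + 2 * C ^ 2 * ‖v a‖ ^ 2)
    (fun n => ?_) ?_ (fun n => Eventually.of_forall fun a => ?_) (Eventually.of_forall fun a => ?_)
  · exact (((Complex.continuous_ofReal.comp_aestronglyMeasurable (hp n)).mul hw.1).add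
      ((Complex.continuous_ofReal.comp_aestronglyMeasurable (hq n)).mul hv.1)).norm.pow 2
  · exact ((hw.integrable_norm_pow (p := 2) (by norm_num)).const_mul 2).add
      ((hv.integrable_norm_pow (p := 2) (by norm_num)).const_mul _)
  · rw [Real.norm_of_nonneg (by positivity)]
    have h1 : ‖(p n a : ℂ) * w a + (q n a : ℂ) * v a‖ ≤ ‖w a‖ + C * ‖v a‖ := by
      refine (norm_add_le _ _).trans ?_
      rw [norm_mul, norm_mul, Complex.norm_real, Complex.norm_real]
      exact add_le_add (mul_le_of_le_one_left (norm_nonneg _) (hp1 n a))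
        (mul_le_mul_of_nonneg_right (hqC n a) (norm_nonneg _))
    calc ‖(p n a : ℂ) * w a + (q n a : ℂ) * v a‖ ^ 2 ≤ (‖w a‖ + C * ‖v a‖) ^ 2 := by gcongr
      _ ≤ 2 * ‖w a‖ ^ 2 + 2 * C ^ 2 * ‖v a‖ ^ 2 := by nlinarith [sq_nonneg (‖w a‖ - C * ‖v a‖)]
  · have h1 := (((Complex.continuous_ofReal.tendsto _).comp (hpt a)).mul_const (w a)).add
      (((Complex.continuous_ofReal.tendsto _).comp (hqt a)).mul_const (v a))
    simpa using h1.norm.pow 2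

/-- Dilations `χ(x / (n + 1))` of one bump; the derivatives are `O(1 / (n + 1))`, so the commutator
term disappears in the limit. -/
theorem exists_cutoff : ∃ (ρ : ℕ → ℝ → ℝ) (C : ℝ), (∀ n, ContDiff ℝ ∞ (ρ n)) ∧
    (∀ n, HasCompactSupport (ρ n)) ∧ (∀ n x, |ρ n x| ≤ 1) ∧ (∀ n x, |deriv (ρ n) x| ≤ C) ∧
    (∀ x, Tendsto (fun n => ρ n x) atTop (𝓝 1)) ∧
    ∀ x, Tendsto (fun n => deriv (ρ n) x) atTop (𝓝 0) := by
  obtain ⟨χ, χs, χc, χ0, χn, χl⟩ : ∃ χ : ℝ → ℝ, ContDiff ℝ ∞ χ ∧ HasCompactSupport χ ∧ χ 0 = 1 ∧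
      (∀ x, 0 ≤ χ x) ∧ ∀ x, χ x ≤ 1 := by
    have b : ContDiffBump (0 : ℝ) := default
    exact ⟨b, b.contDiff, b.hasCompactSupport,
      b.one_of_mem_closedBall (Metric.mem_closedBall_self b.rIn_pos.le), fun _ => b.nonneg,
      fun _ => b.le_one⟩
  obtain ⟨C, hC⟩ := χc.deriv.exists_bound_of_continuous (continuous_deriv_test χs)
  have hc0 : ∀ n : ℕ, (0 : ℝ) < 1 / ((n : ℝ) + 1) := fun n => Nat.one_div_pos_of_nat
  have hc1 : ∀ n : ℕ, 1 / ((n : ℝ) + 1) ≤ 1 := fun n => by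
    rw [div_le_one (by positivity)]
    simp
  have hct : Tendsto (fun n : ℕ => 1 / ((n : ℝ) + 1)) atTop (𝓝 0) :=
    tendsto_one_div_add_atTop_nhds_zero_nat
  have hder : ∀ (n : ℕ) x, deriv (fun x => χ (1 / ((n : ℝ) + 1) * x)) x
      = 1 / ((n : ℝ) + 1) * deriv χ (1 / ((n : ℝ) + 1) * x) := fun n x =>
    deriv_comp_mul_left _ _ _
  have hb : ∀ (n : ℕ) x, |deriv (fun x => χ (1 / ((n : ℝ) + 1) * x)) x|
      ≤ 1 / ((n : ℝ) + 1) * C := fun n x => by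
    rw [hder, abs_mul, abs_of_pos (hc0 n)]
    exact mul_le_mul_of_nonneg_left (hC _) (hc0 n).le
  have hcs : ∀ n : ℕ, HasCompactSupport fun x => χ (1 / ((n : ℝ) + 1) * x) := fun n => by
    have h1 := χc.comp_smul (c := 1 / ((n : ℝ) + 1)) (hc0 n).ne'
    simpa only [smul_eq_mul] using h1
  have hC0 : 0 ≤ C := (norm_nonneg _).trans (hC 0)
  refine ⟨fun n x => χ (1 / ((n : ℝ) + 1) * x), C, fun n => χs.comp (contDiff_const.mul contDiff_id),
    hcs, fun n x => ?_, fun n x => ?_, fun x => ?_,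
    fun x => ?_⟩
  · rw [abs_of_nonneg (χn _)]
    exact χl _
  · exact (hb n x).trans (mul_le_of_le_one_left hC0 (hc1 n))
  · have h2 := (χs.continuous.tendsto (0 * x)).comp (hct.mul_const x)
    rw [zero_mul, χ0] at h2
    exact h2
  · refine squeeze_zero_norm (fun n => hb n x) ?_
    simpa using hct.mul_const C

/-- The lower bound for the magnetic quadratic form with Robin boundary condition. -/
theorem groundEnergy_mul_le (γ : ℝ) (hu : MemMagneticH1 u d₁ d₂) (hg : IsTrace u d₂ g) :
    groundEnergy γ * (∫ z in halfPlane, ‖u z‖ ^ 2)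
      ≤ (∫ z in halfPlane, (‖d₁ z‖ ^ 2 + ‖d₂ z‖ ^ 2)) + γ * ∫ s : ℝ, ‖g s‖ ^ 2 := by
  obtain ⟨ρ, C, hρ, hc, hρ1, hρC, hρt, hρt'⟩ := exists_cutoff
  have m1 : ∀ n, AEStronglyMeasurable (fun z : ℝ × ℝ => ρ n z.1) (volume.restrict halfPlane) :=
    fun n => ((hρ n).continuous.comp continuous_fst).aestronglyMeasurable
  have m2 : ∀ n, AEStronglyMeasurable (fun z : ℝ × ℝ => deriv (ρ n) z.1)
      (volume.restrict halfPlane) :=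
    fun n => ((continuous_deriv_test (hρ n)).comp continuous_fst).aestronglyMeasurable
  have key : ∀ {w : ℝ × ℝ → ℂ}, MemLp w 2 (volume.restrict halfPlane) → Tendsto
      (fun n => ∫ z in halfPlane, ‖(ρ n z.1 : ℂ) * w z‖ ^ 2) atTop
      (𝓝 (∫ z in halfPlane, ‖w z‖ ^ 2)) := fun {w} hw => by
    have := tendsto_integral_cutoff (q := fun _ _ => 0) (C := 0) hw hw m1
      (fun n => aestronglyMeasurable_const) (fun n z => hρ1 n z.1) (fun n z => by simp)
      (fun z => hρt z.1) (fun z => tendsto_const_nhds)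
    simpa only [Complex.ofReal_zero, zero_mul, add_zero] using this
  have t0 := (key hu.1).const_mul (groundEnergy γ)
  have t2 := key hu.2.2.1
  have t1 := tendsto_integral_cutoff hu.2.1 hu.1 m1 m2 (fun n z => hρ1 n z.1)
    (fun n z => hρC n z.1) (fun z => hρt z.1) (fun z => hρt' z.1)
  have t3 : Tendsto (fun n => ∫ s, ‖(ρ n s : ℂ) * g s‖ ^ 2) atTop (𝓝 (∫ s, ‖g s‖ ^ 2)) := by
    have := tendsto_integral_cutoff (q := fun _ _ => 0) (C := 0) hg.1 hg.1
      (fun n => (hρ n).continuous.aestronglyMeasurable)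
      (fun n => aestronglyMeasurable_const) (fun n s => hρ1 n s) (fun n s => by simp)
      (fun s => hρt s) (fun s => tendsto_const_nhds)
    simpa only [Complex.ofReal_zero, zero_mul, add_zero] using this
  have := le_of_tendsto_of_tendsto' t0 ((t2.add t1).add (t3.const_mul γ))
    fun n => cutoff_lower_bound γ hu hg (hρ n) (hc n)
  rw [integral_add (hu.2.1.integrable_norm_pow (p := 2) (by norm_num))
    (hu.2.2.1.integrable_norm_pow (p := 2) (by norm_num))]
  linarith

end

section

/-! ### The upper bound in the half-plane -/

namespace IsDecayingSol

variable {lam : ℝ} {U V : ℝ → ℝ}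

theorem memLp_sub (h : IsDecayingSol lam U V) (η : ℝ) :
    MemLp (fun t => U (t - η)) 2 (volume.restrict (Ioi 0)) :=
  memLp_comp_sub (by simpa using h.memLp_pow_mul 0 (-η))

theorem memLp_snd_sub (h : IsDecayingSol lam U V) (η : ℝ) :
    MemLp (fun t => V (t - η)) 2 (volume.restrict (Ioi 0)) :=
  memLp_comp_sub (memLp_of_tendsto h.continuous_snd (h.tendsto_snd 1) _)

theorem memLp_sub_mul_sub (h : IsDecayingSol lam U V) (η : ℝ) :
    MemLp (fun t => (t - η) * U (t - η)) 2 (volume.restrict (Ioi 0)) :=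
  memLp_comp_sub (f := fun s => s * U s) (by simpa using h.memLp_pow_mul 1 (-η))

theorem integral_energy (h : IsDecayingSol lam U V) (η : ℝ) :
    (∫ t in Ioi (0 : ℝ), V (t - η) ^ 2) + ∫ t in Ioi (0 : ℝ), ((t - η) * U (t - η)) ^ 2
      = lam * (∫ t in Ioi (0 : ℝ), U (t - η) ^ 2) - U (-η) * V (-η) := by
  have hU : ∀ t, HasDerivAt (fun t => U (t - η)) (V (t - η)) t := fun t =>
    (h.hasDerivAt_fst (t - η)).comp_sub_const t η
  have hV : ∀ t, HasDerivAt (fun t => V (t - η)) (((t - η) ^ 2 - lam) * U (t - η)) t := fun t =>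
    (h.hasDerivAt_snd (t - η)).comp_sub_const t η
  have hUc : Continuous fun t => U (t - η) := h.continuous_fst.comp (continuous_id.sub continuous_const)
  have hVc : Continuous fun t => V (t - η) := h.continuous_snd.comp (continuous_id.sub continuous_const)
  have hWc : Continuous fun t : ℝ => ((t - η) ^ 2 - lam) * U (t - η) :=
    (by fun_prop : Continuous fun t : ℝ => (t - η) ^ 2 - lam).mul hUc
  have mU := h.memLp_sub η
  have mT := h.memLp_sub_mul_sub η
  have mW : MemLp (fun t => ((t - η) ^ 2 - lam) * U (t - η)) 2 (volume.restrict (Ioi 0)) := by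
    refine memLp_comp_sub (f := fun s => (s ^ 2 - lam) * U s)
      (((h.memLp_pow_mul 2 _).sub ((h.memLp_pow_mul 0 _).const_mul lam)).congr_norm ?_ ?_)
    · exact ((continuous_pow 2).sub continuous_const).mul h.continuous_fst |>.aestronglyMeasurable
    · refine Eventually.of_forall fun s => ?_
      simp only [Pi.sub_apply]
      congr 1
      ring
  have key := integral_sq_add_integral_mul (a₀ := U (-η)) (b₀ := V (-η)) mU (h.memLp_snd_sub η) mW
    (Eventually.of_forall fun t => by
      rw [intervalIntegral.integral_eq_sub_of_hasDerivAt (fun x _ => hU x)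
        (hVc.intervalIntegrable _ _), zero_sub]
      ring)
    (Eventually.of_forall fun t => by
      rw [intervalIntegral.integral_eq_sub_of_hasDerivAt (fun x _ => hV x)
        (hWc.intervalIntegrable _ _), zero_sub]
      ring)
  have e : ∫ t in Ioi (0 : ℝ), U (t - η) * (((t - η) ^ 2 - lam) * U (t - η))
      = (∫ t in Ioi (0 : ℝ), ((t - η) * U (t - η)) ^ 2) - lam * ∫ t in Ioi (0 : ℝ), U (t - η) ^ 2 := by
    rw [← integral_const_mul, ← integral_sub mT.integrable_sq (mU.integrable_sq.const_mul lam)]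
    congr 1 with t
    ring
  rw [e] at key
  linarith

end IsDecayingSol

theorem isDecayingSol_groundState (γ : ℝ) : IsDecayingSol (groundEnergy γ)
    (fun s => groundState γ (s + optimalXi γ)) (fun s => groundStateDeriv γ (s + optimalXi γ)) := by
  simpa only [groundState, groundStateDeriv, add_sub_cancel_right] using
    (isDecayingSol_decaySol (groundEnergy_lt_one γ)).div_const
      (Real.sqrt (tailNorm (groundEnergy γ) (-optimalXi γ)))

theorem integral_groundState_energy (γ : ℝ) :
    (∫ t in Ioi (0 : ℝ), groundStateDeriv γ t ^ 2)
        + (∫ t in Ioi (0 : ℝ), ((t - optimalXi γ) * groundState γ t) ^ 2)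
      = groundEnergy γ - γ * groundState γ 0 ^ 2 := by
  have := (isDecayingSol_groundState γ).integral_energy (optimalXi γ)
  simp only [sub_add_cancel, neg_add_cancel, integral_groundState_sq, groundStateDeriv_zero] at this
  rw [this]
  ring

/-! ### Green's formulas on the half-plane, by slicing. -/

section Green

variable {u U f : ℝ × ℝ → ℂ}

theorem hasCompactSupport_fderiv_mul (hc : HasCompactSupport f) (v : ℝ × ℝ) :
    HasCompactSupport fun z => u z * fderiv ℝ f z v :=
  (hc.fderiv_apply ℝ v).mul_left

theorem continuous_fderiv_test (hf : ContDiff ℝ ∞ f) (v : ℝ × ℝ) :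
    Continuous fun z => fderiv ℝ f z v :=
  (hf.continuous_fderiv (by simp)).clm_apply continuous_const

theorem hasCompactSupport_slice_fst (hc : HasCompactSupport f) (x : ℝ) :
    HasCompactSupport fun t => f (x, t) :=
  hc.comp_isClosedEmbedding (g := fun t => (x, t)) (by
    refine Topology.IsClosedEmbedding.of_continuous_injective_isClosedMap (by fun_prop) ?_ ?_
    · intro a b h
      simpa using h
    · intro s hs
      have : (fun t => (x, t)) '' s = {x} ×ˢ s := by
        ext ⟨a, b⟩
        simp [eq_comm, and_comm]
      rw [this]
      exact isClosed_singleton.prod hs)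

theorem hasCompactSupport_slice_snd (hc : HasCompactSupport f) (t : ℝ) :
    HasCompactSupport fun x => f (x, t) :=
  hasCompactSupport_slice_fst (f := fun z => f z.swap)
    (hc.comp_homeomorph (Homeomorph.prodComm ℝ ℝ)) t

theorem integral_halfPlane_mul_fderiv_snd (hu : Continuous u) (hU : Continuous U)
    (h : ∀ x t, HasDerivAt (fun t => u (x, t)) (U (x, t)) t) (hf : ContDiff ℝ ∞ f)
    (hc : HasCompactSupport f) :
    ∫ z in halfPlane, u z * fderiv ℝ f z (0, 1)
      = -(∫ z in halfPlane, U z * f z) - ∫ s : ℝ, u (s, 0) * f (s, 0) := by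
  have i1 : IntegrableOn (fun z => u z * fderiv ℝ f z (0, 1)) halfPlane :=
    ((hu.mul (continuous_fderiv_test hf _)).integrable_of_hasCompactSupport
      (hasCompactSupport_fderiv_mul hc _)).integrableOn
  have i2 : IntegrableOn (fun z => U z * f z) halfPlane :=
    ((hU.mul hf.continuous).integrable_of_hasCompactSupport hc.mul_left).integrableOn
  have i3 : Integrable fun s : ℝ => u (s, 0) * f (s, 0) :=
    ((hu.mul hf.continuous).comp (Continuous.prodMk_left 0)).integrable_of_hasCompactSupport
      (hasCompactSupport_slice_snd hc.mul_left 0)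
  rw [IntegrableOn, volume_restrict_halfPlane] at i1 i2
  have i4 : Integrable fun x => -∫ t in Ioi (0 : ℝ), U (x, t) * f (x, t) := i2.integral_prod_left.neg
  rw [volume_restrict_halfPlane, integral_prod _ i1, integral_prod _ i2, ← integral_neg,
    ← integral_sub i4 i3]
  congr 1 with x
  have hfx : ContDiff ℝ ∞ fun t => f (x, t) := hf.comp (contDiff_const.prodMk contDiff_id)
  rw [← integral_Ioi_mul_deriv_test (h x) (hU.comp (Continuous.prodMk_right x)) hfx
    (hasCompactSupport_slice_fst hc x)]
  congr 1 with t
  rw [fderiv_apply_snd (hf.differentiable (by simp) _)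
    (hfx.differentiable (by simp) t).hasDerivAt]

theorem integral_halfPlane_mul_fderiv_fst (hu : Continuous u) (hU : Continuous U)
    (h : ∀ x t, HasDerivAt (fun x => u (x, t)) (U (x, t)) x) (hf : ContDiff ℝ ∞ f)
    (hc : HasCompactSupport f) :
    ∫ z in halfPlane, u z * fderiv ℝ f z (1, 0) = -∫ z in halfPlane, U z * f z := by
  have c1 := (hu.mul (continuous_fderiv_test hf (1, 0)))
  have s1 := hasCompactSupport_fderiv_mul (u := u) hc (1, 0)
  have c2 := hU.mul hf.continuous
  have s2 : HasCompactSupport fun z => U z * f z := hc.mul_left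
  have i1 : IntegrableOn (fun z => u z * fderiv ℝ f z (1, 0)) halfPlane :=
    (c1.integrable_of_hasCompactSupport s1).integrableOn
  have i2 : IntegrableOn (fun z => U z * f z) halfPlane :=
    (c2.integrable_of_hasCompactSupport s2).integrableOn
  rw [IntegrableOn, volume_restrict_halfPlane] at i1 i2
  rw [volume_restrict_halfPlane, integral_prod_symm _ i1, integral_prod_symm _ i2, ← integral_neg]
  congr 1 with t
  have hfx : ContDiff ℝ ∞ fun x => f (x, t) := hf.comp (contDiff_id.prodMk contDiff_const)
  have hd : ∀ x, fderiv ℝ f (x, t) (1, 0) = deriv (fun x => f (x, t)) x := fun x =>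
    fderiv_apply_fst (hf.differentiable (by simp) _) (hfx.differentiable (by simp) x).hasDerivAt
  have j1 := (c1.comp (Continuous.prodMk_left t)).integrable_of_hasCompactSupport
    (μ := volume) (hasCompactSupport_slice_snd s1 t)
  have j2 := (c2.comp (Continuous.prodMk_left t)).integrable_of_hasCompactSupport
    (μ := volume) (hasCompactSupport_slice_snd s2 t)
  have j3 := ((hu.mul hf.continuous).comp (Continuous.prodMk_left t)).integrable_of_hasCompactSupport
    (μ := volume) (hasCompactSupport_slice_snd hc.mul_left t)
  simp only [hd]
  refine integral_mul_deriv_eq_deriv_mul_of_integrable (u := fun x => u (x, t))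
    (v := fun x => f (x, t)) (fun x _ => h x t)
    (fun x _ => (hfx.differentiable (by simp) x).hasDerivAt) ?_ j2 j3
  refine j1.congr (Eventually.of_forall fun x => ?_)
  simp only [Function.comp_apply, Pi.mul_apply, hd]

end Green

end

/-! ### Trial functions and their Rayleigh quotients. -/

section

/-- Trial functions `e^{i(x₁ x₂ / 2 - c x₁)} a(x₁) b(x₂)`. -/
noncomputable def trialFun (c : ℝ) (a b : ℝ → ℝ) (z : ℝ × ℝ) : ℂ :=
  Complex.exp (((z.1 * z.2 / 2 - c * z.1 : ℝ) : ℂ) * Complex.I) * ((a z.1 * b z.2 : ℝ) : ℂ)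

theorem continuous_trialFun (c : ℝ) {a b : ℝ → ℝ} (ha : Continuous a) (hb : Continuous b) :
    Continuous (trialFun c a b) := by
  unfold trialFun
  fun_prop

theorem hasDerivAt_trialFun_fst (c : ℝ) {a b : ℝ → ℝ} {a' x : ℝ} (ha : HasDerivAt a a' x) (t : ℝ) :
    HasDerivAt (fun x => trialFun c a b (x, t))
      (Complex.exp (((x * t / 2 - c * x : ℝ) : ℂ) * Complex.I) * (((t / 2 - c : ℝ) : ℂ) * Complex.I)
        * ((a x * b t : ℝ) : ℂ)
        + Complex.exp (((x * t / 2 - c * x : ℝ) : ℂ) * Complex.I) * ((a' * b t : ℝ) : ℂ)) x := by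
  have h1 : HasDerivAt (fun x : ℝ => x * t / 2 - c * x) (t / 2 - c) x := by
    convert! (((hasDerivAt_id x).mul_const t).div_const 2).sub ((hasDerivAt_id x).const_mul c) using 1
    simp
  exact ((h1.ofReal_comp.mul_const Complex.I).cexp).mul (ha.mul_const (b t)).ofReal_comp

theorem hasDerivAt_trialFun_snd (c : ℝ) {a b : ℝ → ℝ} {b' t : ℝ} (hb : HasDerivAt b b' t) (x : ℝ) :
    HasDerivAt (fun t => trialFun c a b (x, t))
      (Complex.exp (((x * t / 2 - c * x : ℝ) : ℂ) * Complex.I) * (((x / 2 : ℝ) : ℂ) * Complex.I)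
        * ((a x * b t : ℝ) : ℂ)
        + Complex.exp (((x * t / 2 - c * x : ℝ) : ℂ) * Complex.I) * ((a x * b' : ℝ) : ℂ)) t := by
  have h1 : HasDerivAt (fun t : ℝ => x * t / 2 - c * x) (x / 2) t := by
    convert! (((hasDerivAt_id t).const_mul x).div_const 2).sub_const (c * x) using 1
    simp
  exact ((h1.ofReal_comp.mul_const Complex.I).cexp).mul (hb.const_mul (a x)).ofReal_comp

theorem norm_trialFun_sq (c : ℝ) (a b : ℝ → ℝ) (z : ℝ × ℝ) :
    ‖trialFun c a b z‖ ^ 2 = a z.1 ^ 2 * b z.2 ^ 2 := by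
  rw [trialFun, norm_mul, Complex.norm_exp_ofReal_mul_I, one_mul, Complex.norm_real,
    Real.norm_eq_abs, sq_abs, mul_pow]

/-- After removal of the common phase the two terms are the real and imaginary parts of a number, so
no cross term appears. The cost of the cutoff thus decouples from the half-line energy. -/
theorem norm_trialFun_add_sq (c : ℝ) (a b a' b' : ℝ → ℝ) (z : ℝ × ℝ) :
    ‖trialFun c a b z + Complex.I * trialFun c a' b' z‖ ^ 2
      = a z.1 ^ 2 * b z.2 ^ 2 + a' z.1 ^ 2 * b' z.2 ^ 2 := by
  have : trialFun c a b z + Complex.I * trialFun c a' b' z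
      = Complex.exp (((z.1 * z.2 / 2 - c * z.1 : ℝ) : ℂ) * Complex.I)
        * (((a z.1 * b z.2 : ℝ) : ℂ) + ((a' z.1 * b' z.2 : ℝ) : ℂ) * Complex.I) := by
    simp only [trialFun]
    ring
  rw [this, norm_mul, Complex.norm_exp_ofReal_mul_I, one_mul, ← Complex.normSq_eq_norm_sq,
    Complex.normSq_add_mul_I]
  ring

theorem integrableOn_halfPlane_sq_mul_sq {a b : ℝ → ℝ} (ha : MemLp a 2)
    (hb : MemLp b 2 (volume.restrict (Ioi 0))) :
    IntegrableOn (fun z : ℝ × ℝ => a z.1 ^ 2 * b z.2 ^ 2) halfPlane := by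
  rw [IntegrableOn, volume_restrict_halfPlane]
  exact ha.integrable_sq.mul_prod hb.integrable_sq

theorem integral_halfPlane_sq_mul_sq (a b : ℝ → ℝ) :
    ∫ z in halfPlane, a z.1 ^ 2 * b z.2 ^ 2 = (∫ x, a x ^ 2) * ∫ t in Ioi (0 : ℝ), b t ^ 2 := by
  rw [volume_restrict_halfPlane]
  exact integral_prod_mul (fun x => a x ^ 2) fun t => b t ^ 2

theorem memLp_trialFun (c : ℝ) {a b : ℝ → ℝ} (ha : Continuous a) (hb : Continuous b)
    (ha2 : MemLp a 2) (hb2 : MemLp b 2 (volume.restrict (Ioi 0))) :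
    MemLp (trialFun c a b) 2 (volume.restrict halfPlane) := by
  rw [memLp_two_iff_integrable_sq_norm (continuous_trialFun c ha hb).aestronglyMeasurable]
  simp only [norm_trialFun_sq]
  exact integrableOn_halfPlane_sq_mul_sq ha2 hb2

section

variable {c : ℝ} {ρ φ φ' : ℝ → ℝ}

/-- The first magnetic derivative of a trial function. -/
noncomputable def trialDeriv (c : ℝ) (ρ φ : ℝ → ℝ) (z : ℝ × ℝ) : ℂ :=
  trialFun c (deriv ρ) φ z + Complex.I * trialFun c ρ (fun t => (t - c) * φ t) z

theorem isTrace_trialFun (hρ : ContDiff ℝ ∞ ρ) (hc : HasCompactSupport ρ)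
    (hφ : ∀ t, HasDerivAt φ (φ' t) t) (hφ' : Continuous φ') :
    IsTrace (trialFun c ρ φ) (trialFun c ρ φ') (fun s => trialFun c ρ φ (s, 0)) := by
  have hφc : Continuous φ := continuous_iff_continuousAt.mpr fun t => (hφ t).continuousAt
  have hu := continuous_trialFun c hρ.continuous hφc
  have hu2 := continuous_trialFun c hρ.continuous hφ'
  constructor
  · refine (hu.comp (Continuous.prodMk_left 0)).memLp_of_hasCompactSupport ?_
    refine hc.mono fun s hs h0 => hs ?_
    simp [trialFun, h0]
  · intro f hf hfc
    refine integral_halfPlane_mul_fderiv_snd hu (U := fun z => trialFun c ρ φ' z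
      + Complex.I * (A₀ z).2 * trialFun c ρ φ z) ?_ (fun x t => ?_) hf hfc
    · have : Continuous fun z : ℝ × ℝ => Complex.I * (((A₀ z).2 : ℝ) : ℂ) := by
        unfold A₀
        fun_prop
      exact hu2.add (this.mul hu)
    · convert! hasDerivAt_trialFun_snd c (a := ρ) (hφ t) x using 1
      simp only [trialFun, A₀]
      push_cast
      ring

/-- The phase is the inverse gauge times a plane wave of frequency `-c`. The first magnetic
derivative acts as `∂₁ + i (x₂ - c)` on `ρ φ`, the second as `∂₂`. -/
theorem memMagneticH1_trialFun (hρ : ContDiff ℝ ∞ ρ) (hc : HasCompactSupport ρ)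
    (hφ : ∀ t, HasDerivAt φ (φ' t) t) (hφ' : Continuous φ')
    (m0 : MemLp φ 2 (volume.restrict (Ioi 0))) (m1 : MemLp φ' 2 (volume.restrict (Ioi 0)))
    (m2 : MemLp (fun t => (t - c) * φ t) 2 (volume.restrict (Ioi 0))) :
    MemMagneticH1 (trialFun c ρ φ) (trialDeriv c ρ φ) (trialFun c ρ φ') := by
  have hφc : Continuous φ := continuous_iff_continuousAt.mpr fun t => (hφ t).continuousAt
  have hρ' := continuous_deriv_test hρ
  have hρ2 : MemLp ρ 2 := hρ.continuous.memLp_of_hasCompactSupport hc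
  have hρ2' : MemLp (deriv ρ) 2 := hρ'.memLp_of_hasCompactSupport hc.deriv
  have htφ : Continuous fun t => (t - c) * φ t := by fun_prop
  have hu := continuous_trialFun c hρ.continuous hφc
  refine ⟨memLp_trialFun c hρ.continuous hφc hρ2 m0,
    (memLp_trialFun c hρ' hφc hρ2' m0).add
      ((memLp_trialFun c hρ.continuous htφ hρ2 m2).const_mul Complex.I),
    memLp_trialFun c hρ.continuous hφ' hρ2 m1, fun f hf hfc hfs => ⟨?_, ?_⟩⟩
  · refine integral_halfPlane_mul_fderiv_fst hu (U := fun z => trialDeriv c ρ φ z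
      + Complex.I * (A₀ z).1 * trialFun c ρ φ z) ?_ (fun x t => ?_) hf hfc
    · have : Continuous fun z : ℝ × ℝ => Complex.I * (((A₀ z).1 : ℝ) : ℂ) := by
        unfold A₀
        fun_prop
      exact ((continuous_trialFun c hρ' hφc).add
        (continuous_const.mul (continuous_trialFun c hρ.continuous htφ))).add (this.mul hu)
    · convert! hasDerivAt_trialFun_fst c (b := φ) (hρ.differentiable (by simp) x).hasDerivAt t using 1
      simp only [trialDeriv, trialFun, A₀]
      push_cast
      ring
  · rw [(isTrace_trialFun hρ hc hφ hφ').2 f hf hfc]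
    have : ∀ s : ℝ, f (s, 0) = 0 := fun s =>
      image_eq_zero_of_notMem_tsupport fun h => lt_irrefl (0 : ℝ) (hfs h)
    simp [this]

theorem integral_norm_trialFun_sq :
    ∫ z in halfPlane, ‖trialFun c ρ φ z‖ ^ 2 = (∫ x, ρ x ^ 2) * ∫ t in Ioi (0 : ℝ), φ t ^ 2 := by
  simp only [norm_trialFun_sq]
  exact integral_halfPlane_sq_mul_sq _ _

theorem integral_trialFun_energy (hρ : ContDiff ℝ ∞ ρ) (hc : HasCompactSupport ρ)
    (m0 : MemLp φ 2 (volume.restrict (Ioi 0))) (m1 : MemLp φ' 2 (volume.restrict (Ioi 0)))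
    (m2 : MemLp (fun t => (t - c) * φ t) 2 (volume.restrict (Ioi 0))) :
    ∫ z in halfPlane, (‖trialDeriv c ρ φ z‖ ^ 2 + ‖trialFun c ρ φ' z‖ ^ 2)
      = (∫ x, deriv ρ x ^ 2) * (∫ t in Ioi (0 : ℝ), φ t ^ 2)
        + (∫ x, ρ x ^ 2) * ((∫ t in Ioi (0 : ℝ), φ' t ^ 2)
          + ∫ t in Ioi (0 : ℝ), ((t - c) * φ t) ^ 2) := by
  have hρ2 : MemLp ρ 2 := hρ.continuous.memLp_of_hasCompactSupport hc
  have hρ2' : MemLp (deriv ρ) 2 := (continuous_deriv_test hρ).memLp_of_hasCompactSupport hc.deriv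
  have i0 := integrableOn_halfPlane_sq_mul_sq hρ2' m0
  have i1 := integrableOn_halfPlane_sq_mul_sq hρ2 m1
  have i2 := integrableOn_halfPlane_sq_mul_sq hρ2 m2
  have i02 : IntegrableOn (fun z : ℝ × ℝ => deriv ρ z.1 ^ 2 * φ z.2 ^ 2
    + ρ z.1 ^ 2 * ((z.2 - c) * φ z.2) ^ 2) halfPlane := i0.add i2
  simp only [trialDeriv, norm_trialFun_add_sq, norm_trialFun_sq]
  rw [integral_add i02 i1, integral_add i0 i2, integral_halfPlane_sq_mul_sq,
    integral_halfPlane_sq_mul_sq, integral_halfPlane_sq_mul_sq ρ fun t => (t - c) * φ t]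
  ring

end

/-- The Rayleigh quotients defining `Theta`. -/
def rayleighQuotients (γ : ℝ) : Set ℝ :=
    {r : ℝ | ∃ (u d₁ d₂ : ℝ × ℝ → ℂ) (g : ℝ → ℂ),
      MemMagneticH1 u d₁ d₂ ∧ IsTrace u d₂ g ∧
      ¬ (u =ᵐ[volume.restrict halfPlane] 0) ∧
      r = ((∫ x in halfPlane, (‖d₁ x‖ ^ 2 + ‖d₂ x‖ ^ 2)) + γ * ∫ s : ℝ, ‖g s‖ ^ 2)
          / ∫ x in halfPlane, ‖u x‖ ^ 2}

theorem groundEnergy_mem_lowerBounds (γ : ℝ) : groundEnergy γ ∈ lowerBounds (rayleighQuotients γ) := by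
  rintro r ⟨u, d₁, d₂, g, hu, hg, hne, rfl⟩
  rw [le_div_iff₀ (integral_norm_sq_pos hu.1 hne)]
  exact groundEnergy_mul_le γ hu hg

/-- The ground state has half-line energy `E - γ φ(0)²`, and the boundary integral restores `γ
φ(0)²`. What exceeds `E` is the kinetic energy of the cutoff. -/
theorem add_div_mem_rayleighQuotients (γ : ℝ) {ρ : ℝ → ℝ} (hρ : ContDiff ℝ ∞ ρ) (hc : HasCompactSupport ρ)
    (hpos : 0 < ∫ x, ρ x ^ 2) :
    groundEnergy γ + (∫ x, deriv ρ x ^ 2) / ∫ x, ρ x ^ 2 ∈ rayleighQuotients γ := by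
  have hs := isDecayingSol_groundState γ
  have m0 := hs.memLp_sub (optimalXi γ)
  have m1 := hs.memLp_snd_sub (optimalXi γ)
  have m2 := hs.memLp_sub_mul_sub (optimalXi γ)
  simp only [sub_add_cancel] at m0 m1 m2
  have hφ : ∀ t, HasDerivAt (groundState γ) (groundStateDeriv γ t) t := fun t => by
    simpa using (hs.hasDerivAt_fst (t - optimalXi γ)).comp_sub_const t (optimalXi γ)
  have hφ' : Continuous (groundStateDeriv γ) := by
    have := hs.continuous_snd.comp (continuous_sub_right (optimalXi γ))
    simpa only [Function.comp_def, sub_add_cancel] using this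
  have hu := memMagneticH1_trialFun hρ hc hφ hφ' m0 m1 m2
  have hg := isTrace_trialFun (c := optimalXi γ) hρ hc hφ hφ'
  have hn : ∫ z in halfPlane, ‖trialFun (optimalXi γ) ρ (groundState γ) z‖ ^ 2 = ∫ x, ρ x ^ 2 := by
    rw [integral_norm_trialFun_sq, integral_groundState_sq, mul_one]
  refine ⟨_, _, _, _, hu, hg, fun h0 => ?_, ?_⟩
  · refine hpos.ne' ?_
    rw [← hn, integral_eq_zero_of_ae]
    filter_upwards [h0] with z hz
    simp [hz]
  · rw [integral_trialFun_energy hρ hc m0 m1 m2, hn, integral_groundState_energy,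
      integral_groundState_sq]
    simp only [norm_trialFun_sq]
    rw [integral_mul_const]
    field_simp
    ring

/-- Replacing `ρ` by `ρ(a x)` multiplies the excess over `groundEnergy γ` by `a²`; letting `a → 0`
matches the lower bound. -/
theorem Theta_eq_groundEnergy (γ : ℝ) : Theta γ = groundEnergy γ := by
  obtain ⟨ρ, hρ, hc, h0⟩ : ∃ ρ : ℝ → ℝ, ContDiff ℝ ∞ ρ ∧ HasCompactSupport ρ ∧ ρ 0 = 1 := by
    have b : ContDiffBump (0 : ℝ) := default
    exact ⟨b, b.contDiff, b.hasCompactSupport,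
      b.one_of_mem_closedBall (Metric.mem_closedBall_self b.rIn_pos.le)⟩
  have hρ2 : MemLp ρ 2 := hρ.continuous.memLp_of_hasCompactSupport hc
  have hpos : 0 < ∫ x, ρ x ^ 2 :=
    (hρ.continuous.pow 2).integral_pos_of_hasCompactSupport_nonneg_nonzero
      (hc.mono fun x hx h => hx (by simp [h])) (fun x => sq_nonneg _) (x := 0) (by simp [h0])
  set κ := (∫ x, deriv ρ x ^ 2) / ∫ x, ρ x ^ 2 with hκ
  have key : ∀ a : ℝ, 0 < a → Theta γ ≤ groundEnergy γ + a ^ 2 * κ := by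
    intro a ha
    have hcs : HasCompactSupport fun x => ρ (a * x) := by
      have h1 := hc.comp_smul (c := a) ha.ne'
      simpa only [smul_eq_mul] using h1
    have e1 : ∫ x, ρ (a * x) ^ 2 = a⁻¹ * ∫ x, ρ x ^ 2 := by
      rw [Measure.integral_comp_mul_left (fun x => ρ x ^ 2) a, abs_of_pos (inv_pos.mpr ha),
        smul_eq_mul]
    have e2 : ∫ x, deriv (fun x => ρ (a * x)) x ^ 2 = a * ∫ x, deriv ρ x ^ 2 := by
      have : ∀ x, deriv (fun x => ρ (a * x)) x = a * deriv ρ (a * x) := fun x =>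
        deriv_comp_mul_left _ _ _
      simp only [this, mul_pow]
      rw [integral_const_mul, Measure.integral_comp_mul_left (fun x => deriv ρ x ^ 2) a,
        abs_of_pos (inv_pos.mpr ha), smul_eq_mul]
      field_simp
    have h1 : Theta γ ≤ _ := csInf_le ⟨_, groundEnergy_mem_lowerBounds γ⟩
      (add_div_mem_rayleighQuotients γ (ρ := fun x => ρ (a * x))
        (hρ.comp (contDiff_const.mul contDiff_id)) hcs (by rw [e1]; positivity))
    rw [e1, e2] at h1
    refine h1.trans_eq ?_
    rw [hκ]
    field_simp
  refine le_antisymm ?_ ?_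
  · have ht : Tendsto (fun a : ℝ => groundEnergy γ + a ^ 2 * κ) (𝓝[>] 0) (𝓝 (groundEnergy γ)) := by
      have : Continuous fun a : ℝ => groundEnergy γ + a ^ 2 * κ := by fun_prop
      have := this.tendsto 0
      simp only [ne_eq, OfNat.ofNat_ne_zero, not_false_eq_true, zero_pow, zero_mul, add_zero] at this
      exact this.mono_left nhdsWithin_le_nhds
    refine ge_of_tendsto ht ?_
    filter_upwards [self_mem_nhdsWithin] with a ha
    exact key a ha
  · exact le_csInf ⟨_, add_div_mem_rayleighQuotients γ hρ hc hpos⟩ (groundEnergy_mem_lowerBounds γ)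

end

end RobinHalfPlane

/-- Ground states are compared on `[0, ∞)` only, because their values at negative arguments carry no
information. -/
theorem mainTheorem7 :
    ∃ (ξ : ℝ → ℝ) (φ : ℝ → ℝ → ℝ),
      -- `ξ γ` is positive and is the unique minimizer of the first eigenvalue
      (∀ γ : ℝ, 0 < ξ γ ∧ ∀ η : ℝ, RobinHalfPlane.IsMinimizer γ η ↔ η = ξ γ) ∧
      -- `φ γ` is the unique positive normalized ground state, with eigenvalue `Θ(γ)`
      (∀ γ : ℝ,
        RobinHalfPlane.IsPositiveNormalizedEigenfunction γ (ξ γ) (RobinHalfPlane.Theta γ) (φ γ) ∧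
        ∀ ψ : ℝ → ℝ,
          RobinHalfPlane.IsPositiveNormalizedEigenfunction γ (ξ γ) (RobinHalfPlane.Theta γ) ψ →
            Set.EqOn ψ (φ γ) (Set.Ici 0)) ∧
      ContDiff ℝ 1 RobinHalfPlane.Theta ∧
      (∀ γ : ℝ, HasDerivAt RobinHalfPlane.Theta (|φ γ 0| ^ 2) γ) ∧
      HasDerivAt RobinHalfPlane.Theta (6 * RobinHalfPlane.M3 0 (ξ 0) (φ 0)) 0 ∧
      0 < RobinHalfPlane.M3 0 (ξ 0) (φ 0) := by
  have hΘ : RobinHalfPlane.Theta = RobinHalfPlane.groundEnergy :=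
    funext RobinHalfPlane.Theta_eq_groundEnergy
  rw [hΘ]
  have h0 := RobinHalfPlane.groundState_pos 0 0
  have hd : ∀ γ, HasDerivAt RobinHalfPlane.groundEnergy (|RobinHalfPlane.groundState γ 0| ^ 2) γ :=
    fun γ => by
      rw [sq_abs]
      exact RobinHalfPlane.hasDerivAt_groundEnergy γ
  have hM : RobinHalfPlane.M3 0 (RobinHalfPlane.optimalXi 0) (RobinHalfPlane.groundState 0)
      = |RobinHalfPlane.groundState 0 0| ^ 2 / 6 := by
    rw [RobinHalfPlane.M3]
    ring
  refine ⟨RobinHalfPlane.optimalXi, RobinHalfPlane.groundState,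
    fun γ => ⟨RobinHalfPlane.optimalXi_pos γ, RobinHalfPlane.isMinimizer_iff γ⟩,
    fun γ => ⟨RobinHalfPlane.isPositiveNormalizedEigenfunction_groundState γ,
      fun ψ hψ => hψ.eqOn_groundState⟩,
    RobinHalfPlane.contDiff_groundEnergy, hd, ?_, ?_⟩
  · rw [hM, mul_div_cancel₀ _ (by norm_num)]
    exact hd 0
  · rw [hM]
    positivity
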